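/- \textbf{No long-range correlations.} Let $a>b>0$ be constants, put $\varepsilon=\frac{b}{a+b}$, and let $\delta=1$ if $\varepsilon\le\frac13$ and $\delta=\frac{(1-2\varepsilon)^2}{\varepsilon^2}$ if $\varepsilon\ge\frac13$. Generate a marked graph $G$ on $n$ vertices with spins $\sigma\in\{+1,-1\}^n$ as follows. \begin{itemize} \item The spins are independent and uniform. Given $\sigma$, the precursor graph $G_{\mathrm{pre}}$ has independent edges; a pair of distinct vertices is joined with probability $a/n$ if their spins agree and $b/n$ if they differ (these numbers are replaced by $1$ in the case, irrelevant for large $n$, that they exceed $1$). \item A vertex is \emph{good} if at least three of its neighbours in $G_{\mathrm{pre}}$ have degree different from $2$ in $G_{\mathrm{pre}}$. A vertex of degree $2$ in $G_{\mathrm{pre}}$ whose two neighbours are both good is \emph{marked}. \item For each marked vertex $v$ whose two neighbours both have spin opposite to that of $v$, independently with probability $\delta$, both edges at $v$ are deleted. The resulting graph, together with the sets of good and of marked vertices (as determined in $G_{\mathrm{pre}}$), is $G$. \end{itemize} For every constant $K$ there is a sequence $\eta_n\to0$, depending only on $a,b,K$, such that the following holds for every $n$. Let $A=A(G)$, $B=B(G)$,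 $C=C(G)$ be a rule that assigns to every marked graph $G$ that occurs with positive probability a partition of its vertices into three (possibly empty) parts such that $G$ has no edge between $A$ and $C$, $|A\cup B|\le K n^{1/8}$, and $B$ contains no marked vertex. Then, with probability at least $1-\eta_n$ over $(G,\sigma)$, $$\bigl|\Pr(\sigma_A\mid G,\sigma_{B\cup C})-\Pr(\sigma_A\mid G,\sigma_B)\bigr|\le \eta_n\,\Pr(\sigma_A\mid G,\sigma_B).$$ In other words, $\Pr(\sigma_A\mid G,\sigma_{B\cup C})=(1+o(1))\Pr(\sigma_A\mid G,\sigma_B)$ for asymptotically almost every $(G,\sigma)$. Here $\sigma_S$ denotes the spins on $S$, and $\Pr(\sigma_A\mid G,\sigma_S)$ is the conditional probability that the spins on $A$ are those of $\sigma$, given that the marked graph is $G$ and that the spins on $S$ are those of $\sigma$. -/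

import Mathlib

open Filter Topology
open scoped Classical

noncomputable section

namespace SemirandomBlockModel

/-- Community labels (spins) of the `n` vertices, with values `+1` and `-1`. -/
abbrev Spins (n : ℕ) : Type := Fin n → ℤˣ

/-- The noise parameter `ε = b / (a + b)`. -/
def noise (a b : ℝ) : ℝ := b / (a + b)

/-- The cutting probability `δ` of the adversary. -/
def cutProb (a b : ℝ) : ℝ :=
  if noise a b ≤ 1 / 3 then 1 else (1 - 2 * noise a b) ^ 2 / noise a b ^ 2

/-- The probability of an edge between vertices of spins `s` and `t`: it is `a / n` or `b / n`.
(The truncation at `1` matters only for the finitely many `n` with `n < a` or `n < b`.) -/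
def edgeProb (a b : ℝ) (n : ℕ) (s t : ℤˣ) : ℝ :=
  min 1 ((if s = t then a else b) / n)

/-- The unordered pairs of distinct vertices, each listed once. -/
def pairs (n : ℕ) : Finset (Fin n × Fin n) := {p | p.1 < p.2}

/-- The conditional probability of the precursor graph `H` given the spins `σ` in the
stochastic block model `G(n, a/n, b/n)`: the edges are independent. -/
def graphProb (a b : ℝ) {n : ℕ} (σ : Spins n) (H : SimpleGraph (Fin n)) : ℝ :=
  ∏ p ∈ pairs n,
    if H.Adj p.1 p.2 then edgeProb a b n (σ p.1) (σ p.2)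
    else 1 - edgeProb a b n (σ p.1) (σ p.2)

/-- The vertices marked *good* by the adversary: at least three of the neighbours
have degree different from `2`. -/
def goodVertices {n : ℕ} (H : SimpleGraph (Fin n)) : Finset (Fin n) :=
  {v | 3 ≤ (Finset.univ.filter fun u => H.Adj v u ∧ H.degree u ≠ 2).card}

/-- The vertices that receive the second mark: degree `2`, with both neighbours good. -/
def markedVertices {n : ℕ} (H : SimpleGraph (Fin n)) : Finset (Fin n) :=
  {v | H.degree v = 2 ∧ ∀ w, H.Adj v w → w ∈ goodVertices H}

/-- The marked vertices whose two neighbours both have the opposite spin. -/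
def cuttableVertices {n : ℕ} (σ : Spins n) (H : SimpleGraph (Fin n)) : Finset (Fin n) :=
  {v | v ∈ markedVertices H ∧ ∀ w, H.Adj v w → σ w ≠ σ v}

/-- The conditional probability, given spins and precursor, that the adversary cuts exactly the
vertices in `D`: each cuttable vertex is cut independently with probability `δ`. -/
def cutSetProb (a b : ℝ) {n : ℕ} (σ : Spins n) (H : SimpleGraph (Fin n))
    (D : Finset (Fin n)) : ℝ :=
  if D ⊆ cuttableVertices σ H then
    ∏ v ∈ cuttableVertices σ H, if v ∈ D then cutProb a b else 1 - cutProb a b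
  else 0

/-- The graph obtained from `H` by deleting all edges incident to the vertices in `D`. -/
def cutGraph {n : ℕ} (H : SimpleGraph (Fin n)) (D : Finset (Fin n)) : SimpleGraph (Fin n) where
  Adj u v := H.Adj u v ∧ u ∉ D ∧ v ∉ D
  symm := ⟨fun _ _ h => ⟨h.1.symm, h.2.2, h.2.1⟩⟩
  loopless := ⟨fun _ h => h.1.ne rfl⟩

/-- A graph on `n` vertices together with the two vertex markings. -/
@[ext]
structure MarkedGraph (n : ℕ) where
  graph : SimpleGraph (Fin n)
  good : Finset (Fin n)
  marked : Finset (Fin n)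

/-- An outcome of the experiment: spins, precursor graph, and set of vertices that are cut. -/
abbrev Outcome (n : ℕ) : Type := Spins n × SimpleGraph (Fin n) × Finset (Fin n)

/-- The spins of an outcome. -/
def spins {n : ℕ} (ω : Outcome n) : Spins n := ω.1

/-- The graph that is revealed in an outcome: the precursor after the cuts,
with the markings that were assigned in the precursor. -/
def observed {n : ℕ} (ω : Outcome n) : MarkedGraph n where
  graph := cutGraph ω.2.1 ω.2.2
  good := goodVertices ω.2.1
  marked := markedVertices ω.2.1

/-- The probability of an outcome: uniform spins, then the precursor from the stochastic block
model, then the random cuts of the adversary. -/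
def law (a b : ℝ) (n : ℕ) (ω : Outcome n) : ℝ :=
  (1 / 2) ^ n * graphProb a b ω.1 ω.2.1 * cutSetProb a b ω.1 ω.2.1 ω.2.2

/-- The probability of an event. -/
def prob (a b : ℝ) {n : ℕ} (E : Set (Outcome n)) : ℝ :=
  ∑ ω with ω ∈ E, law a b n ω

/-- The conditional probability of `E` given `F`. -/
def condProb (a b : ℝ) {n : ℕ} (E F : Set (Outcome n)) : ℝ :=
  prob a b (E ∩ F) / prob a b F

/-- The event that the revealed marked graph is `G`. -/
def graphEvent {n : ℕ} (G : MarkedGraph n) : Set (Outcome n) := {ω | observed ω = G}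

/-- The event that the spins on the vertex set `S` are those prescribed by `τ`. -/
def spinEvent {n : ℕ} (S : Finset (Fin n)) (τ : Spins n) : Set (Outcome n) :=
  {ω | ∀ v ∈ S, spins ω v = τ v}

/-- The conditional probability `P(σ_A | G, σ_S)`, as a function of the revealed marked graph `G`
and the spins `σ`: given that the revealed graph is `G` and that the spins on `S` are those
of `σ`, the probability that the spins on `A` are those of `σ`. -/
def posterior (a b : ℝ) {n : ℕ} (G : MarkedGraph n) (σ : Spins n) (A S : Finset (Fin n)) : ℝ :=
  condProb a b (spinEvent A σ) (graphEvent G ∩ spinEvent S σ)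

/-- `G` occurs with positive probability as the revealed marked graph. -/
def IsPossible (a b : ℝ) {n : ℕ} (G : MarkedGraph n) : Prop := 0 < prob a b (graphEvent G)

/-- `A`, `B`, `C` partition the vertices of `G` (parts may be empty), `B` separates `A` from `C`,
`A ∪ B` has at most `K n ^ (1/8)` vertices, and `B` has no marked vertex. -/
structure IsSeparatingPartition {n : ℕ} (K : ℝ) (G : MarkedGraph n)
    (A B C : Finset (Fin n)) : Prop where
  disjoint_AB : Disjoint A B
  disjoint_AC : Disjoint A C
  disjoint_BC : Disjoint B C
  cover : A ∪ B ∪ C = Finset.univ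
  separates : ∀ u ∈ A, ∀ v ∈ C, ¬ G.graph.Adj u v
  card_le : ((A ∪ B).card : ℝ) ≤ K * (n : ℝ) ^ (1 / 8 : ℝ)
  not_marked : Disjoint B G.marked

lemma edgeProb_nonneg {a b : ℝ} (hb : 0 < b) (hab : b < a) (n : ℕ) (s t : ℤˣ) :
    0 ≤ edgeProb a b n s t := by
  have : 0 < a := hb.trans hab
  unfold edgeProb
  split_ifs <;> positivity

lemma cutProb_mem_Icc {a b : ℝ} (hb : 0 < b) (hab : b < a) :
    0 < cutProb a b ∧ cutProb a b ≤ 1 := by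
  have hs : 0 < a + b := by linarith
  have h2 : noise a b < 1 / 2 := by unfold noise; rw [div_lt_iff₀ hs]; linarith
  unfold cutProb
  split_ifs with h
  · norm_num
  · push Not at h
    have h0 : 0 < noise a b := by linarith
    have h1 : 0 < 1 - 2 * noise a b := by linarith
    refine ⟨by positivity, ?_⟩
    rw [div_le_one (by positivity)]
    nlinarith

lemma law_nonneg {a b : ℝ} (hb : 0 < b) (hab : b < a) (n : ℕ) (ω : Outcome n) :
    0 ≤ law a b n ω := by
  obtain ⟨h0, h1⟩ := cutProb_mem_Icc hb hab
  unfold law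
  refine mul_nonneg (mul_nonneg (by positivity) ?_) ?_
  · refine Finset.prod_nonneg fun p _ => ?_
    split_ifs
    · exact edgeProb_nonneg hb hab ..
    · exact sub_nonneg.2 (min_le_left _ _)
  · unfold cutSetProb
    split_ifs
    · refine Finset.prod_nonneg fun p _ => ?_
      split_ifs
      · exact h0.le
      · exact sub_nonneg.2 h1
    · exact le_rfl

lemma sum_cutSetProb (a b : ℝ) {n : ℕ} (σ : Spins n) (H : SimpleGraph (Fin n)) :
    ∑ D, cutSetProb a b σ H D = 1 := by
  unfold cutSetProb
  rw [← Finset.sum_filter]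
  have h := Finset.prod_add (fun _ : Fin n => cutProb a b) (fun _ => 1 - cutProb a b)
    (cuttableVertices σ H)
  simp only [add_sub_cancel, Finset.prod_const_one] at h
  refine Eq.trans ?_ h.symm
  refine Finset.sum_congr (by ext D; simp) fun D hD => ?_
  rw [Finset.prod_ite]
  have hD' := Finset.mem_powerset.1 hD
  congr 1
  · refine Finset.prod_congr ?_ fun _ _ => rfl
    ext v; simp only [Finset.mem_filter]; exact ⟨fun h => h.2, fun h => ⟨hD' h, h⟩⟩
  · refine Finset.prod_congr ?_ fun _ _ => rfl
    ext v; simp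

lemma sum_graphProb (a b : ℝ) {n : ℕ} (σ : Spins n) :
    ∑ H, graphProb a b σ H = 1 := by
  have h := Finset.prod_add (fun p : Fin n × Fin n => edgeProb a b n (σ p.1) (σ p.2))
    (fun p => 1 - edgeProb a b n (σ p.1) (σ p.2)) (pairs n)
  simp only [add_sub_cancel, Finset.prod_const_one] at h
  refine Eq.trans ?_ h.symm
  refine Finset.sum_bij' (fun H _ => (pairs n).filter fun p => H.Adj p.1 p.2)
    (fun t _ => SimpleGraph.fromRel fun u v => (u, v) ∈ t) ?_ ?_ ?_ ?_ ?_
  · intro H _; simp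
  · intro t _; simp
  · intro H _
    ext u v
    simp only [SimpleGraph.fromRel_adj, Finset.mem_filter, pairs, Finset.mem_univ, true_and]
    constructor
    · rintro ⟨_, h | h⟩
      exacts [h.2, h.2.symm]
    · intro h
      exact ⟨h.ne, (lt_or_gt_of_ne h.ne).imp (fun k => ⟨k, h⟩) (fun k => ⟨k, h.symm⟩)⟩
  · intro t ht
    have ht' := Finset.mem_powerset.1 ht
    ext ⟨u, v⟩
    simp only [SimpleGraph.fromRel_adj, Finset.mem_filter]
    constructor
    · rintro ⟨hp, _, h | h⟩
      · exact h
      · have h1 := ht' h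
        simp only [pairs, Finset.mem_filter, Finset.mem_univ, true_and] at h1 hp
        exact absurd h1 hp.le.not_gt
    · intro h
      have h1 := ht' h
      refine ⟨h1, ?_, Or.inl h⟩
      simp only [pairs, Finset.mem_filter, Finset.mem_univ, true_and] at h1
      exact h1.ne
  · intro H _
    unfold graphProb
    rw [Finset.prod_ite]
    congr 1
    refine Finset.prod_congr ?_ fun _ _ => rfl
    ext p; simp only [Finset.mem_filter, Finset.mem_sdiff]; tauto

/-- The weights `law a b n` form a probability distribution. -/
lemma sum_law (a b : ℝ) (n : ℕ) : ∑ ω, law a b n ω = 1 := by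
  unfold law
  rw [Fintype.sum_prod_type]
  simp_rw [Fintype.sum_prod_type, ← Finset.mul_sum, sum_cutSetProb, mul_one, ← Finset.mul_sum,
    sum_graphProb]
  simp

end SemirandomBlockModel

end

open SemirandomBlockModel

/-! Put `X = n ^ (1/8)`. For a fixed revealed graph `G`, let `W τ` be the joint weight of `G` and
the spins `τ` (`jointWeight`). The theorem follows once exchanging the spins on `A` between two
configurations that agree on `B` changes the product of their weights by a factor `1 + O(1/X)` only.
If `W` factorised exactly over `A ∪ B` and `B ∪ C`, the spins on `A` and `C` would be conditionally
independent given those on `B`.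

The weight is explicit. A marked vertex has degree 2 and its neighbours are good, hence of degree at
least 3, so no two marked vertices are adjacent. Thus `G` reveals which vertices were cut, namely
the isolated marked ones, and the compatible precursors arise by joining each cut vertex to any two
good vertices of opposite spin; doing so does not alter the markings (`markings_eq_of_cutGraph_eq`,
`card_precursors`). Up to a constant, `W τ` is the block model probability of the revealed graph,
times local factors at the uncut marked vertices, times the number of restorations
(`exists_jointWeight_eq`).

Edges and marked vertices give no interaction across `B`, since `B` separates and contains no marked
vertex. Two global effects remain. The non-edges between `A` and `C` give a bilinear interaction of
strength `O(1/n)` between the sums of spins on `A` and on `C`. The restoration count depends on the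
spins only through their sums over the good and over the cut vertices. If the sums over `C`, over
its good vertices and over its cut vertices are `O(X ^ 6)`, then, as `A` has `O(X)` vertices and
there are at least `c * X ^ 8` good ones, both effects are `O(1/X)` in the exponent
(`jointWeight_mul_le`).

Such balance is typical. The sums in question have mean zero by the global spin flip, and variance
`O(X ^ 10)` by the Efron–Stein inequality, because one independent bit influences the statistics
only within distance 3. Chebyshev's inequality bounds the exceptional probability by `O(X ^ (-2))`,
and Markov's inequality makes balance likely also conditionally on `G` and the spins on `A ∪ B` or
on `B` (`prob_markov`). A ratio comparison restricted to balanced configurations completes the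
argument (`abs_ratio_sub_le`). -/

namespace SemirandomBlockModel

/-! ### Independent bits and the Efron–Stein inequality -/

/-- The probability of the vector `ω` when its entries are independent and equal to `true` with
probabilities `p`. -/
noncomputable def bitWeight {ι : Type*} [Fintype ι] (p : ι → ℝ) (ω : ι → Bool) : ℝ :=
  ∏ i, if ω i then p i else 1 - p i

/-- The mean of a function of independent bits. -/
noncomputable def bitMean {ι : Type*} [Fintype ι] (p : ι → ℝ) (F : (ι → Bool) → ℝ) : ℝ :=
  ∑ ω, bitWeight p ω * F ω

section Bits

variable {ι : Type*} [Fintype ι] {p : ι → ℝ}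

lemma bitWeight_nonneg (hp : ∀ i, 0 ≤ p i ∧ p i ≤ 1) (ω : ι → Bool) : 0 ≤ bitWeight p ω := by
  refine Finset.prod_nonneg fun i _ => ?_
  split_ifs
  · exact (hp i).1
  · linarith [(hp i).2]

lemma bitMean_prod (p : ι → ℝ) (f : ι → Bool → ℝ) :
    bitMean p (fun ω => ∏ i, f i (ω i)) = ∏ i, (p i * f i true + (1 - p i) * f i false) := by
  unfold bitMean bitWeight
  simp_rw [← Finset.prod_mul_distrib]
  have h := Finset.prod_univ_sum (fun _ : ι => (Finset.univ : Finset Bool))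
    (fun i c => (if c then p i else 1 - p i) * f i c)
  rw [Fintype.piFinset_univ] at h
  rw [← h]
  simp

lemma bitMean_const (p : ι → ℝ) (c : ℝ) : bitMean p (fun _ => c) = c := by
  have h := bitMean_prod p (fun _ _ => 1)
  simp only [Finset.prod_const_one, mul_one, add_sub_cancel] at h
  unfold bitMean at h ⊢
  rw [← Finset.sum_mul]
  simp only [mul_one] at h
  rw [h, one_mul]

lemma bitMean_mono (hp : ∀ i, 0 ≤ p i ∧ p i ≤ 1) {F F' : (ι → Bool) → ℝ} (h : ∀ ω, F ω ≤ F' ω) :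
    bitMean p F ≤ bitMean p F' :=
  Finset.sum_le_sum fun ω _ => mul_le_mul_of_nonneg_left (h ω) (bitWeight_nonneg hp ω)

lemma bitMean_add (p : ι → ℝ) (F F' : (ι → Bool) → ℝ) :
    bitMean p (fun ω => F ω + F' ω) = bitMean p F + bitMean p F' := by
  simp only [bitMean, mul_add, Finset.sum_add_distrib]

lemma bitMean_sub (p : ι → ℝ) (F F' : (ι → Bool) → ℝ) :
    bitMean p (fun ω => F ω - F' ω) = bitMean p F - bitMean p F' := by
  simp only [bitMean, mul_sub, Finset.sum_sub_distrib]

lemma bitMean_const_mul (p : ι → ℝ) (c : ℝ) (F : (ι → Bool) → ℝ) :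
    bitMean p (fun ω => c * F ω) = c * bitMean p F := by
  simp only [bitMean, Finset.mul_sum]
  exact Finset.sum_congr rfl fun _ _ => by ring

lemma bitMean_sum {κ : Type*} (p : ι → ℝ) (s : Finset κ) (F : κ → (ι → Bool) → ℝ) :
    bitMean p (fun ω => ∑ k ∈ s, F k ω) = ∑ k ∈ s, bitMean p (F k) := by
  simp only [bitMean, Finset.mul_sum]
  exact Finset.sum_comm

lemma sq_bitMean_le (hp : ∀ i, 0 ≤ p i ∧ p i ≤ 1) (F : (ι → Bool) → ℝ) :
    bitMean p F ^ 2 ≤ bitMean p (fun ω => F ω ^ 2) := by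
  have h : 0 ≤ bitMean p (fun ω => (F ω - bitMean p F) ^ 2) :=
    Finset.sum_nonneg fun ω _ => mul_nonneg (bitWeight_nonneg hp ω) (sq_nonneg _)
  have e : (fun ω => (F ω - bitMean p F) ^ 2)
      = fun ω => F ω ^ 2 - 2 * bitMean p F * F ω + bitMean p F ^ 2 := by
    funext ω; ring
  rw [e, bitMean_add, bitMean_sub, bitMean_const_mul, bitMean_const] at h
  nlinarith

/-- The probability of a cylinder event. -/
lemma bitMean_cylinder (p : ι → ℝ) (ok : ι → Bool → Prop) :
    bitMean p (fun ω => if ∀ i, ok i (ω i) then 1 else 0)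
      = ∏ i, (p i * (if ok i true then 1 else 0) + (1 - p i) * (if ok i false then 1 else 0)) := by
  rw [← bitMean_prod p (fun i c => if ok i c then 1 else 0)]
  congr 1
  funext ω
  rw [Finset.prod_ite_zero]
  simp

end Bits

lemma bitMean_equiv {α β : Type*} [Fintype α] [Fintype β] (e : α ≃ β) (p : β → ℝ)
    (F : (β → Bool) → ℝ) :
    bitMean p F = bitMean (fun i => p (e i)) (fun ω => F (fun j => ω (e.symm j))) := by
  unfold bitMean bitWeight
  refine Fintype.sum_equiv (Equiv.arrowCongr e.symm (Equiv.refl Bool)) _ _ fun ω => ?_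
  simp only [Equiv.arrowCongr_apply, Equiv.symm_symm, Equiv.coe_refl, Function.comp_apply, id,
    Equiv.apply_symm_apply]
  congr 1
  exact (Fintype.prod_equiv e _ _ fun i => rfl).symm

/-- Conditioning on the bit `none`. It drives the induction on the number of bits in `efronStein`.
-/
lemma bitMean_option {α : Type*} [Fintype α] (p : Option α → ℝ) (F : (Option α → Bool) → ℝ) :
    bitMean p F = p none * bitMean (fun i => p (some i)) (fun ω => F (fun o => o.elim true ω))
      + (1 - p none) * bitMean (fun i => p (some i)) (fun ω => F (fun o => o.elim false ω)) := by
  have key := Fintype.sum_equiv (Equiv.piOptionEquivProd (β := fun _ : Option α => Bool))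
    (fun ω => (∏ i, if ω i then p i else 1 - p i) * F ω)
    (fun x => (∏ i, if (Option.elim i x.1 x.2 : Bool) then p i else 1 - p i) *
      F (fun o => o.elim x.1 x.2)) (fun ω => by
        have e : (fun o : Option α => o.elim (ω none) (fun a => ω (some a))) = ω := by
          funext o; cases o <;> rfl
        simp only [Equiv.piOptionEquivProd_apply, Fintype.prod_option, Option.elim]
        congr 2
        exact e.symm)
  unfold bitMean bitWeight
  rw [Finset.mul_sum, Finset.mul_sum]
  convert key using 1
  · congr!
  · rw [Fintype.sum_prod_type]
    simp only [Fintype.prod_option, mul_assoc, Fintype.univ_bool, Finset.mem_singleton,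
      Bool.true_eq_false, not_false_eq_true, Finset.sum_insert, Finset.sum_singleton,
      Option.elim, if_true, Bool.false_eq_true, if_false]
    congr!

/-- The statement of the Efron–Stein inequality for independent bits indexed by `ι`. -/
def EfronStein (ι : Type*) [Fintype ι] : Prop :=
  ∀ [DecidableEq ι] (p : ι → ℝ), (∀ i, 0 ≤ p i ∧ p i ≤ 1) → ∀ F : (ι → Bool) → ℝ,
    bitMean p (fun ω => F ω ^ 2) - bitMean p F ^ 2 ≤
      ∑ i, p i * (1 - p i) * bitMean p (fun ω =>
        (F (Function.update ω i true) - F (Function.update ω i false)) ^ 2)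

lemma EfronStein.of_equiv {α β : Type*} [Fintype α] [Fintype β] (e : α ≃ β) (h : EfronStein α) :
    EfronStein β := by
  intro _ p hp F
  have h' := h (fun i => p (e i)) (fun i => hp _) (fun ω => F (fun j => ω (e.symm j)))
  rw [bitMean_equiv e p F, bitMean_equiv e p (fun ω => F ω ^ 2)]
  refine h'.trans (le_of_eq ?_)
  refine Fintype.sum_equiv e _ _ fun i => ?_
  rw [bitMean_equiv e p]
  congr 2
  funext ω
  have key : ∀ c, (fun j => Function.update ω i c (e.symm j))
      = Function.update (fun j => ω (e.symm j)) (e i) c := by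
    intro c; funext j
    by_cases hj : j = e i
    · subst hj; simp
    · have : e.symm j ≠ i := fun hh => hj (by rw [← hh, e.apply_symm_apply])
      simp [Function.update_of_ne hj, Function.update_of_ne this]
  rw [key, key]

/-- Law of total variance: if the new bit has probability `t` and the conditional means are `m₁` and
`m₀`, the variance is `t * Var₁ + (1 - t) * Var₀ + t * (1 - t) * (m₁ - m₀) ^ 2`. The induction
hypothesis bounds the conditional variances, and Jensen's inequality bounds `(m₁ - m₀) ^ 2` by the
mean square of the discrete derivative in the new bit. -/
lemma EfronStein.option {α : Type*} [Fintype α] (h : EfronStein α) : EfronStein (Option α) := by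
  intro _ p hp F
  set q : α → ℝ := fun i => p (some i)
  have hq : ∀ i, 0 ≤ q i ∧ q i ≤ 1 := fun i => hp _
  have h1 := h q hq (fun ω => F (fun o => o.elim true ω))
  have h0 := h q hq (fun ω => F (fun o => o.elim false ω))
  have hd := sq_bitMean_le hq (fun ω => F (fun o => o.elim true ω) - F (fun o => o.elim false ω))
  rw [bitMean_sub] at hd
  have upn : ∀ c d (ω : α → Bool), Function.update (fun o : Option α => o.elim d ω) none c
      = fun o => o.elim c ω := by
    intro c d ω; funext o; cases o <;> simp [Function.update]
  have ups : ∀ c d (ω : α → Bool) i, Function.update (fun o : Option α => o.elim d ω) (some i) c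
      = fun o => o.elim d (Function.update ω i c) := by
    intro c d ω i; funext o; cases o <;> simp [Function.update]
  rw [Fintype.sum_option]
  simp only [bitMean_option p, upn, ups]
  obtain ⟨hp0, hp1⟩ := hp none
  set t := p none
  change _ ≤ _ + ∑ i, q i * (1 - q i) * _
  simp only [mul_add, Finset.sum_add_distrib]
  have e1 : ∀ G : α → ℝ, ∑ i, q i * (1 - q i) * (t * G i) = t * ∑ i, q i * (1 - q i) * G i := by
    intro G; rw [Finset.mul_sum]; exact Finset.sum_congr rfl fun _ _ => by ring
  have e0 : ∀ G : α → ℝ, ∑ i, q i * (1 - q i) * ((1 - t) * G i)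
      = (1 - t) * ∑ i, q i * (1 - q i) * G i := by
    intro G; rw [Finset.mul_sum]; exact Finset.sum_congr rfl fun _ _ => by ring
  rw [e1, e0]
  have k1 := mul_le_mul_of_nonneg_left h1 hp0
  have k0 := mul_le_mul_of_nonneg_left h0 (sub_nonneg.2 hp1)
  have kd := mul_le_mul_of_nonneg_left hd (mul_nonneg hp0 (sub_nonneg.2 hp1))
  nlinarith

/-- The Efron–Stein inequality for independent bits. -/
theorem efronStein (ι : Type*) [Fintype ι] : EfronStein ι := by
  have h0 : EfronStein PEmpty := by
    intro _ p _ F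
    have : ∀ F : (PEmpty → Bool) → ℝ, bitMean p F = F PEmpty.elim := by
      intro F
      unfold bitMean bitWeight
      rw [Fintype.sum_unique]
      simp only [Finset.univ_eq_empty, Finset.prod_empty, one_mul]
      congr 1
      funext x; exact x.elim
    simp [this]
  intro _
  exact Fintype.induction_empty_option (P := fun α _ => EfronStein α)
    (fun α β _ e h => @EfronStein.of_equiv α β (Fintype.ofEquiv _ e.symm) _ e h) h0 (fun α _ h => h.option) ι

/-! ### The experiment as a function of independent bits -/

/-- Indices of the bits: one for each spin, two for each ordered pair (an edge between equal
spins and an edge between opposite spins), and one for the cut at each vertex. -/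
abbrev BitIndex (n : ℕ) : Type := Fin n ⊕ (Fin n × Fin n × Bool) ⊕ Fin n

/-- The probability that a bit is `true`. -/
noncomputable def bitProb (a b : ℝ) (n : ℕ) : BitIndex n → ℝ
  | .inl _ => 1 / 2
  | .inr (.inl e) => min 1 ((if e.2.2 then a else b) / n)
  | .inr (.inr _) => cutProb a b

lemma bitProb_mem {a b : ℝ} (hb : 0 < b) (hab : b < a) (n : ℕ) (i : BitIndex n) :
    0 ≤ bitProb a b n i ∧ bitProb a b n i ≤ 1 := by
  have ha : 0 < a := hb.trans hab
  rcases i with v | ⟨u, v, k⟩ | v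
  · norm_num [bitProb]
  · refine ⟨?_, min_le_left _ _⟩
    simp only [bitProb]
    split_ifs <;> positivity
  · exact ⟨(cutProb_mem_Icc hb hab).1.le, (cutProb_mem_Icc hb hab).2⟩

variable {n : ℕ}

/-- The spins as a function of the bits. -/
def bitSpins (ω : BitIndex n → Bool) : Spins n := fun v => if ω (.inl v) then 1 else -1

/-- The precursor as a function of the bits. -/
def bitGraph (ω : BitIndex n → Bool) : SimpleGraph (Fin n) :=
  SimpleGraph.fromRel fun u v =>
    u < v ∧ ω (.inr (.inl (u, v, decide (bitSpins ω u = bitSpins ω v)))) = true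

/-- The cuts as a function of the bits. -/
noncomputable def bitCuts (ω : BitIndex n → Bool) : Finset (Fin n) :=
  (cuttableVertices (bitSpins ω) (bitGraph ω)).filter fun v => ω (.inr (.inr v)) = true

/-- The outcome as a function of the bits. -/
noncomputable def bitOutcome (ω : BitIndex n → Bool) : Outcome n :=
  (bitSpins ω, bitGraph ω, bitCuts ω)

lemma bitGraph_adj_of_lt (ω : BitIndex n → Bool) {u v : Fin n} (h : u < v) :
    (bitGraph ω).Adj u v ↔
      ω (.inr (.inl (u, v, decide (bitSpins ω u = bitSpins ω v)))) = true := by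
  unfold bitGraph
  rw [SimpleGraph.fromRel_adj]
  constructor
  · rintro ⟨_, h1 | h1⟩
    · exact h1.2
    · exact absurd h1.1 h.not_gt
  · exact fun h1 => ⟨h.ne, Or.inl ⟨h, h1⟩⟩

lemma graph_eq_of_forall_lt {G H : SimpleGraph (Fin n)}
    (h : ∀ u v, u < v → (G.Adj u v ↔ H.Adj u v)) : G = H := by
  ext u v
  rcases lt_trichotomy u v with k | k | k
  · exact h u v k
  · subst k; simp
  · rw [G.adj_comm, H.adj_comm]; exact h v u k

/-- The condition on a single bit under which the outcome is `(σ, H, D)`. -/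
def bitMatches (σ : Spins n) (H : SimpleGraph (Fin n)) (D : Finset (Fin n)) :
    BitIndex n → Bool → Prop
  | .inl v, c => c = true ↔ σ v = 1
  | .inr (.inl e), c => e.1 < e.2.1 → e.2.2 = decide (σ e.1 = σ e.2.1) →
      (c = true ↔ H.Adj e.1 e.2.1)
  | .inr (.inr v), c => v ∈ cuttableVertices σ H → (c = true ↔ v ∈ D)

/-- Once the outcome is prescribed, its spins tell which of the two edge bits of each pair is read,
and its cuttable vertices tell which cut bits are read. All other bits are free, so the event is a
product over single bits and `bitMean_cylinder` computes its probability. -/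
lemma bitOutcome_eq_iff {σ : Spins n} {H : SimpleGraph (Fin n)} {D : Finset (Fin n)}
    (hD : D ⊆ cuttableVertices σ H) (ω : BitIndex n → Bool) :
    bitOutcome ω = (σ, H, D) ↔ ∀ i, bitMatches σ H D i (ω i) := by
  constructor
  · intro h
    obtain ⟨rfl, h2⟩ := Prod.mk.inj h
    obtain ⟨rfl, rfl⟩ := Prod.mk.inj h2
    rintro (v | ⟨u, v, k⟩ | v)
    · simp only [bitMatches, bitSpins]
      split_ifs with h <;> simp [h]
    · rintro h1 h2
      simp only at h1 h2
      rw [h2]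
      exact (bitGraph_adj_of_lt ω h1).symm
    · intro hv
      simp [bitCuts, hv]
  · intro h
    have hs : bitSpins ω = σ := by
      funext v
      have := h (.inl v)
      simp only [bitMatches] at this
      simp only [bitSpins]
      split_ifs with hc
      · exact (this.1 hc).symm
      · rcases Int.units_eq_one_or (σ v) with h1 | h1
        · exact absurd (this.2 h1) hc
        · exact h1.symm
    have hg : bitGraph ω = H := by
      refine graph_eq_of_forall_lt fun u v huv => ?_
      rw [bitGraph_adj_of_lt ω huv, hs]
      exact h (.inr (.inl (u, v, _))) huv rfl
    have hc : bitCuts ω = D := by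
      ext v
      simp only [bitCuts, hs, hg, Finset.mem_filter]
      constructor
      · rintro ⟨h1, h2⟩
        exact (h (.inr (.inr v)) h1).1 h2
      · intro h1
        exact ⟨hD h1, (h (.inr (.inr v)) (hD h1)).2 h1⟩
    rw [bitOutcome, hs, hg, hc]

lemma bitOutcome_cuts_subset (ω : BitIndex n → Bool) :
    (bitOutcome ω).2.2 ⊆ cuttableVertices (bitOutcome ω).1 (bitOutcome ω).2.1 :=
  Finset.filter_subset _ _

/-- The outcome has the right distribution. -/
lemma bitMean_bitOutcome_eq (a b : ℝ) (o : Outcome n) :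
    bitMean (bitProb a b n) (fun ω => if bitOutcome ω = o then 1 else 0) = law a b n o := by
  obtain ⟨σ, H, D⟩ := o
  by_cases hD : D ⊆ cuttableVertices σ H
  · simp_rw [bitOutcome_eq_iff hD]
    rw [bitMean_cylinder, Fintype.prod_sum_type, Fintype.prod_sum_type]
    unfold law
    rw [mul_assoc]
    congr 1
    · rw [← Fin.prod_const]
      refine Finset.prod_congr rfl fun v _ => ?_
      rcases Int.units_eq_one_or (σ v) with h1 | h1 <;> norm_num [bitMatches, bitProb, h1]
    congr 1
    · unfold graphProb pairs
      rw [Finset.prod_filter]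
      simp_rw [Fintype.prod_prod_type]
      refine Finset.prod_congr rfl fun u _ => Finset.prod_congr rfl fun v _ => ?_
      simp only [Fintype.univ_bool, Finset.mem_singleton, Bool.true_eq_false, not_false_eq_true,
        Finset.prod_insert, Finset.prod_singleton, bitMatches, bitProb]
      by_cases huv : u < v
      · by_cases hs : σ u = σ v <;> by_cases hA : H.Adj u v <;>
          simp [huv, hs, hA, edgeProb]
      · simp [huv]
    · unfold cutSetProb
      rw [if_pos hD, Finset.prod_congr rfl
        (g := fun v => if v ∈ cuttableVertices σ H then (if v ∈ D then cutProb a b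
          else 1 - cutProb a b) else 1)]
      · rw [Finset.prod_ite_mem, Finset.univ_inter]
      · intro v _
        by_cases hv : v ∈ cuttableVertices σ H <;> by_cases hv' : v ∈ D <;>
          simp [bitMatches, bitProb, hv, hv']
  · have : ∀ ω : BitIndex n → Bool, bitOutcome ω ≠ (σ, H, D) := by
      rintro ω h
      have := bitOutcome_cuts_subset ω
      rw [h] at this
      exact hD this
    simp only [this, if_false, bitMean_const]
    simp [law, cutSetProb, hD]

/-- The mean of a function of the outcome. -/
noncomputable def mean (a b : ℝ) (F : Outcome n → ℝ) : ℝ := ∑ o, law a b n o * F o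

lemma mean_eq_bitMean (a b : ℝ) (F : Outcome n → ℝ) :
    mean a b F = bitMean (bitProb a b n) (fun ω => F (bitOutcome ω)) := by
  have : (fun ω => F (bitOutcome ω))
      = fun ω : BitIndex n → Bool => ∑ o, F o * (if bitOutcome ω = o then 1 else 0) := by
    funext ω; simp
  rw [this, bitMean_sum]
  simp_rw [bitMean_const_mul, bitMean_bitOutcome_eq]
  exact Finset.sum_congr rfl fun _ _ => mul_comm _ _

lemma prob_eq_mean (a b : ℝ) (E : Set (Outcome n)) :
    prob a b E = mean a b (fun o => if o ∈ E then 1 else 0) := by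
  simp [prob, mean, Finset.sum_filter]

/-! ### Locality of the markings -/

/-- The vertices of `S` and their neighbours. -/
noncomputable def closedNbhd (U : SimpleGraph (Fin n)) (S : Finset (Fin n)) : Finset (Fin n) :=
  S.biUnion fun s => insert s (U.neighborFinset s)

lemma mem_closedNbhd {U : SimpleGraph (Fin n)} {S : Finset (Fin n)} {v : Fin n} :
    v ∈ closedNbhd U S ↔ v ∈ S ∨ ∃ s ∈ S, U.Adj s v := by
  simp only [closedNbhd, Finset.mem_biUnion, Finset.mem_insert, SimpleGraph.mem_neighborFinset]
  constructor
  · rintro ⟨s, hs, rfl | h⟩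
    exacts [Or.inl hs, Or.inr ⟨s, hs, h⟩]
  · rintro (h | ⟨s, hs, h⟩)
    exacts [⟨v, h, Or.inl rfl⟩, ⟨s, hs, Or.inr h⟩]

lemma subset_closedNbhd (U : SimpleGraph (Fin n)) (S : Finset (Fin n)) : S ⊆ closedNbhd U S :=
  fun _ h => mem_closedNbhd.2 (Or.inl h)

lemma card_closedNbhd_le {U : SimpleGraph (Fin n)} {d : ℕ} (hd : ∀ v, U.degree v ≤ d)
    (S : Finset (Fin n)) : (closedNbhd U S).card ≤ S.card * (d + 1) :=
  Finset.card_biUnion_le_card_mul _ _ _ fun s _ =>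
    (Finset.card_insert_le _ _).trans (Nat.succ_le_succ (hd s))

section Locality

variable {H H' U : SimpleGraph (Fin n)} {X : Finset (Fin n)}

/-- `H` and `H'` can differ only at pairs that meet `X`, and `U` dominates both, so every
discrepancy is visible along `U`. Each definition that looks one step further costs one more closed
neighbourhood: adjacency and degree one, goodness two, marks and cuttability three. -/
lemma adj_iff_of_notMem_closedNbhd (hH : H ≤ U) (hH' : H' ≤ U)
    (hX : ∀ u w, u ∉ X → w ∉ X → (H.Adj u w ↔ H'.Adj u w)) {u : Fin n}
    (hu : u ∉ closedNbhd U X) (w : Fin n) : H.Adj u w ↔ H'.Adj u w := by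
  have key : U.Adj u w → (H.Adj u w ↔ H'.Adj u w) := fun h =>
    hX u w (fun k => hu (subset_closedNbhd U X k))
      (fun k => hu (mem_closedNbhd.2 (Or.inr ⟨w, k, h.symm⟩)))
  exact ⟨fun h => (key (hH h)).1 h, fun h => (key (hH' h)).2 h⟩

lemma degree_eq_of_notMem_closedNbhd (hH : H ≤ U) (hH' : H' ≤ U)
    (hX : ∀ u w, u ∉ X → w ∉ X → (H.Adj u w ↔ H'.Adj u w)) {u : Fin n}
    (hu : u ∉ closedNbhd U X) : H.degree u = H'.degree u := by
  rw [← SimpleGraph.card_neighborFinset_eq_degree, ← SimpleGraph.card_neighborFinset_eq_degree]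
  congr 1
  ext w
  simp only [SimpleGraph.mem_neighborFinset]
  exact adj_iff_of_notMem_closedNbhd hH hH' hX hu w

lemma notMem_of_adj {U : SimpleGraph (Fin n)} {S : Finset (Fin n)} {v w : Fin n}
    (hv : v ∉ closedNbhd U S) (h : U.Adj v w) : w ∉ S :=
  fun k => hv (mem_closedNbhd.2 (Or.inr ⟨w, k, h.symm⟩))

lemma mem_goodVertices_iff (hH : H ≤ U) (hH' : H' ≤ U)
    (hX : ∀ u w, u ∉ X → w ∉ X → (H.Adj u w ↔ H'.Adj u w)) {v : Fin n}
    (hv : v ∉ closedNbhd U (closedNbhd U X)) : v ∈ goodVertices H ↔ v ∈ goodVertices H' := by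
  unfold goodVertices
  simp only [Finset.mem_filter, Finset.mem_univ, true_and]
  have hv' : v ∉ closedNbhd U X := fun k => hv (subset_closedNbhd _ _ k)
  rw [Finset.filter_congr (q := fun u => H'.Adj v u ∧ H'.degree u ≠ 2)]
  intro u _
  rw [adj_iff_of_notMem_closedNbhd hH hH' hX hv' u]
  refine and_congr_right fun h => ?_
  rw [degree_eq_of_notMem_closedNbhd hH hH' hX (notMem_of_adj hv (hH' h))]

lemma mem_markedVertices_iff (hH : H ≤ U) (hH' : H' ≤ U)
    (hX : ∀ u w, u ∉ X → w ∉ X → (H.Adj u w ↔ H'.Adj u w)) {v : Fin n}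
    (hv : v ∉ closedNbhd U (closedNbhd U (closedNbhd U X))) :
    v ∈ markedVertices H ↔ v ∈ markedVertices H' := by
  unfold markedVertices
  simp only [Finset.mem_filter, Finset.mem_univ, true_and]
  have hv2 : v ∉ closedNbhd U (closedNbhd U X) := fun k => hv (subset_closedNbhd _ _ k)
  have hv' : v ∉ closedNbhd U X := fun k => hv2 (subset_closedNbhd _ _ k)
  rw [degree_eq_of_notMem_closedNbhd hH hH' hX hv']
  refine and_congr_right fun _ => forall_congr' fun w => ?_
  rw [adj_iff_of_notMem_closedNbhd hH hH' hX hv' w]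
  exact imp_congr_right fun h => mem_goodVertices_iff hH hH' hX (notMem_of_adj hv (hH' h))

lemma mem_cuttableVertices_iff (hH : H ≤ U) (hH' : H' ≤ U)
    (hX : ∀ u w, u ∉ X → w ∉ X → (H.Adj u w ↔ H'.Adj u w)) {σ σ' : Spins n}
    (hσ : ∀ v ∉ X, σ v = σ' v) {v : Fin n}
    (hv : v ∉ closedNbhd U (closedNbhd U (closedNbhd U X))) :
    v ∈ cuttableVertices σ H ↔ v ∈ cuttableVertices σ' H' := by
  unfold cuttableVertices
  simp only [Finset.mem_filter, Finset.mem_univ, true_and]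
  have hv2 : v ∉ closedNbhd U (closedNbhd U X) := fun k => hv (subset_closedNbhd _ _ k)
  have hv' : v ∉ closedNbhd U X := fun k => hv2 (subset_closedNbhd _ _ k)
  rw [mem_markedVertices_iff hH hH' hX hv]
  refine and_congr_right fun _ => forall_congr' fun w => ?_
  rw [adj_iff_of_notMem_closedNbhd hH hH' hX hv' w]
  refine imp_congr_right fun h => ?_
  rw [hσ v (fun k => hv' (subset_closedNbhd _ _ k)), hσ w (notMem_of_adj hv' (hH' h))]

end Locality

/-! ### The influence of a single bit on a local statistic. -/

/-- The vertices that an index refers to. -/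
def bitSupport : BitIndex n → Finset (Fin n)
  | .inl v => {v}
  | .inr (.inl e) => {e.1, e.2.1}
  | .inr (.inr v) => {v}

lemma card_bitSupport_le (i : BitIndex n) : (bitSupport i).card ≤ 2 := by
  rcases i with v | e | v
  · simp [bitSupport]
  · exact Finset.card_le_two
  · simp [bitSupport]

/-- The graph of all pairs for which some edge bit is `true`. -/
def unionGraph (ω : BitIndex n → Bool) : SimpleGraph (Fin n) :=
  SimpleGraph.fromRel fun u v => ∃ k, ω (.inr (.inl (u, v, k))) = true

/-- The union graph ignores the spins and keeps both edge bits of every pair. It therefore dominates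
the precursor before and after the flip of a spin bit, and its degrees are controlled by sums of
independent bits. -/
lemma bitGraph_le_unionGraph {ω ω' : BitIndex n → Bool} (h : ∀ i, ω i = true → ω' i = true) :
    bitGraph ω ≤ unionGraph ω' := by
  intro u v huv
  unfold bitGraph at huv
  unfold unionGraph
  rw [SimpleGraph.fromRel_adj] at huv ⊢
  exact ⟨huv.1, huv.2.imp (fun k => ⟨_, h _ k.2⟩) (fun k => ⟨_, h _ k.2⟩)⟩

/-- The indices of the edge bits at `v` that are `true`. -/
noncomputable def incidentBits (ω : BitIndex n → Bool) (v : Fin n) : Finset (BitIndex n) :=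
  {i | ω i = true ∧ ∃ e : Fin n × Fin n × Bool, i = .inr (.inl e) ∧ (e.1 = v ∨ e.2.1 = v)}

lemma degree_unionGraph_le (ω : BitIndex n → Bool) (v : Fin n) :
    (unionGraph ω).degree v ≤ (incidentBits ω v).card := by
  rw [← SimpleGraph.card_neighborFinset_eq_degree]
  have h : ∀ w ∈ (unionGraph ω).neighborFinset v, ∃ i ∈ incidentBits ω v,
      ∃ e : Fin n × Fin n × Bool, i = .inr (.inl e) ∧ (if e.1 = v then e.2.1 else e.1) = w := by
    intro w hw
    rw [SimpleGraph.mem_neighborFinset, unionGraph, SimpleGraph.fromRel_adj] at hw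
    obtain ⟨hne, ⟨k, hk⟩ | ⟨k, hk⟩⟩ := hw
    · exact ⟨_, Finset.mem_filter.2 ⟨Finset.mem_univ _, hk, _, rfl, Or.inl rfl⟩, (v, w, k), rfl,
        by simp⟩
    · exact ⟨_, Finset.mem_filter.2 ⟨Finset.mem_univ _, hk, _, rfl, Or.inr rfl⟩, (w, v, k), rfl,
        by simp [hne.symm]⟩
  choose! f hf e he using h
  refine Finset.card_le_card_of_injOn f hf fun w hw w' hw' hww => ?_
  have h1 := (he w hw).1
  have h2 := (he w' hw').1
  rw [hww, h2] at h1
  have h3 : e w' = e w := by simpa using h1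
  rw [← (he w hw).2, ← (he w' hw').2, h3]

lemma card_incidentBits_update_le (ω : BitIndex n → Bool) (i : BitIndex n) (v : Fin n) :
    (incidentBits (Function.update ω i true) v).card ≤ (incidentBits ω v).card + 1 := by
  refine (Finset.card_le_card (t := insert i (incidentBits ω v)) fun j hj => ?_).trans
    (Finset.card_insert_le _ _)
  by_cases hji : j = i
  · simp [hji]
  · simpa [incidentBits, hji] using hj

/-- A statistic attached to each vertex, determined by its spin, by whether it is good, and by
whether it is cut. -/
structure IsLocalStatistic (T : Outcome n → Fin n → ℝ) : Prop where
  abs_le : ∀ o v, |T o v| ≤ 1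
  congr : ∀ o o' v, o.1 v = o'.1 v → (v ∈ goodVertices o.2.1 ↔ v ∈ goodVertices o'.2.1) →
    (v ∈ o.2.2 ↔ v ∈ o'.2.2) → T o v = T o' v

lemma bitSpins_update_eq (ω : BitIndex n → Bool) (i : BitIndex n) (c c' : Bool) {v : Fin n}
    (hv : v ∉ bitSupport i) :
    bitSpins (Function.update ω i c) v = bitSpins (Function.update ω i c') v := by
  have : (Sum.inl v : BitIndex n) ≠ i := by rintro rfl; simp [bitSupport] at hv
  simp only [bitSpins, Function.update_of_ne this]

lemma bitGraph_update_adj_iff (ω : BitIndex n → Bool) (i : BitIndex n) (c c' : Bool) {u w : Fin n}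
    (hu : u ∉ bitSupport i) (hw : w ∉ bitSupport i) :
    (bitGraph (Function.update ω i c)).Adj u w ↔ (bitGraph (Function.update ω i c')).Adj u w := by
  have key : ∀ (u w : Fin n) k, u ∉ bitSupport i →
      Function.update ω i c (.inr (.inl (u, w, k))) =
        Function.update ω i c' (.inr (.inl (u, w, k))) := by
    intro u w k hu
    have : (.inr (.inl (u, w, k)) : BitIndex n) ≠ i := by rintro rfl; simp [bitSupport] at hu
    simp only [Function.update_of_ne this]
  unfold bitGraph
  simp only [SimpleGraph.fromRel_adj]
  rw [bitSpins_update_eq ω i c c' hu, bitSpins_update_eq ω i c c' hw, key _ _ _ hu, key _ _ _ hw]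

/-- A bit refers to at most two vertices, and its effect on the statistic stays within distance 3 of
them in the union graph. That graph has maximal degree at most `d + 1` (the flipped bit may add an
edge), so at most `2 * (d + 2) ^ 3` terms change, each by at most 2. -/
lemma abs_sum_sub_sum_le {T : Outcome n → Fin n → ℝ} (hT : IsLocalStatistic T)
    (ω : BitIndex n → Bool) (i : BitIndex n) {d : ℕ}
    (hd : ∀ v, (incidentBits ω v).card ≤ d) :
    |∑ v, T (bitOutcome (Function.update ω i true)) v
      - ∑ v, T (bitOutcome (Function.update ω i false)) v| ≤ 4 * ((d : ℝ) + 2) ^ 3 := by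
  set ω₁ := Function.update ω i true with h₁
  set ω₀ := Function.update ω i false with h₀
  set U := unionGraph ω₁
  set X := bitSupport i
  have hU1 : bitGraph ω₁ ≤ U := bitGraph_le_unionGraph fun _ h => h
  have hU0 : bitGraph ω₀ ≤ U := bitGraph_le_unionGraph fun j h => by
    by_cases hj : j = i
    · subst hj; simp [h₁]
    · simpa [h₁, h₀, hj] using h
  have hX : ∀ u w, u ∉ X → w ∉ X → ((bitGraph ω₁).Adj u w ↔ (bitGraph ω₀).Adj u w) :=
    fun u w hu hw => bitGraph_update_adj_iff ω i true false hu hw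
  have hσ : ∀ v ∉ X, bitSpins ω₁ v = bitSpins ω₀ v :=
    fun v hv => bitSpins_update_eq ω i true false hv
  set S := closedNbhd U (closedNbhd U (closedNbhd U X)) with hS
  have hdeg : ∀ v, U.degree v ≤ d + 1 := fun v => (degree_unionGraph_le ω₁ v).trans
    ((card_incidentBits_update_le ω i v).trans (Nat.succ_le_succ (hd v)))
  have hcard : S.card ≤ 2 * (d + 2) ^ 3 := by
    calc S.card ≤ _ := card_closedNbhd_le hdeg _
      _ ≤ (closedNbhd U X).card * (d + 1 + 1) * (d + 1 + 1) :=
        Nat.mul_le_mul_right _ (card_closedNbhd_le hdeg _)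
      _ ≤ (X.card * (d + 1 + 1)) * (d + 1 + 1) * (d + 1 + 1) :=
        Nat.mul_le_mul_right _ (Nat.mul_le_mul_right _ (card_closedNbhd_le hdeg _))
      _ ≤ (2 * (d + 1 + 1)) * (d + 1 + 1) * (d + 1 + 1) :=
        Nat.mul_le_mul_right _ (Nat.mul_le_mul_right _ (Nat.mul_le_mul_right _
          (card_bitSupport_le i)))
      _ = 2 * (d + 2) ^ 3 := by ring
  have hsame : ∀ v ∉ S, T (bitOutcome ω₁) v = T (bitOutcome ω₀) v := by
    intro v hv
    have hv2 : v ∉ closedNbhd U (closedNbhd U X) := fun k => hv (subset_closedNbhd _ _ k)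
    have hv0 : v ∉ X := fun k => hv2 (subset_closedNbhd _ _ (subset_closedNbhd _ _ k))
    refine hT.congr _ _ v (hσ v hv0) (mem_goodVertices_iff hU1 hU0 hX hv2) ?_
    change v ∈ bitCuts ω₁ ↔ v ∈ bitCuts ω₀
    unfold bitCuts
    rw [Finset.mem_filter, Finset.mem_filter, mem_cuttableVertices_iff hU1 hU0 hX hσ hv]
    have : (.inr (.inr v) : BitIndex n) ≠ i := by rintro rfl; simp [X, bitSupport] at hv0
    simp only [h₁, h₀, Function.update_of_ne this]
  rw [← Finset.sum_sub_distrib]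
  calc |∑ v, (T (bitOutcome ω₁) v - T (bitOutcome ω₀) v)|
      ≤ ∑ v, |T (bitOutcome ω₁) v - T (bitOutcome ω₀) v| := Finset.abs_sum_le_sum_abs _ _
    _ = ∑ v ∈ S, |T (bitOutcome ω₁) v - T (bitOutcome ω₀) v| := by
      refine (Finset.sum_subset (Finset.subset_univ S) fun v _ hv => ?_).symm
      rw [hsame v hv, sub_self, abs_zero]
    _ ≤ ∑ v ∈ S, (2 : ℝ) := Finset.sum_le_sum fun v _ =>
      (abs_sub _ _).trans (by linarith [hT.abs_le (bitOutcome ω₁) v, hT.abs_le (bitOutcome ω₀) v])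
    _ = S.card * 2 := by simp
    _ ≤ (2 * ((d : ℝ) + 2) ^ 3) * 2 := by
      have : (S.card : ℝ) ≤ 2 * ((d : ℝ) + 2) ^ 3 := by exact_mod_cast hcard
      linarith
    _ = 4 * ((d : ℝ) + 2) ^ 3 := by ring

/-! ### Variance of local statistics -/

lemma exists_pow_le_const_mul_two_pow :
    ∃ C : ℝ, 0 < C ∧ ∀ d : ℕ, ((d : ℝ) + 2) ^ 24 ≤ C * 2 ^ d := by
  have h := tendsto_pow_const_div_const_pow_of_one_lt 24 (r := (2 : ℝ)) (by norm_num)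
  obtain ⟨B, hB⟩ := h.bddAbove_range
  refine ⟨4 * max B 1, by positivity, fun d => ?_⟩
  have h1 : ((d + 2 : ℕ) : ℝ) ^ 24 / 2 ^ (d + 2) ≤ B := hB ⟨d + 2, rfl⟩
  rw [div_le_iff₀ (by positivity)] at h1
  push_cast at h1
  calc ((d : ℝ) + 2) ^ 24 ≤ B * 2 ^ (d + 2) := h1
    _ ≤ max B 1 * 2 ^ (d + 2) := by gcongr; exact le_max_left _ _
    _ = _ := by ring

lemma sum_bitProb_incident_le {a b : ℝ} (hb : 0 < b) (hab : b < a) (v : Fin n) :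
    ∑ e : Fin n × Fin n × Bool, (if e.1 = v ∨ e.2.1 = v then bitProb a b n (.inr (.inl e)) else 0)
      ≤ 2 * (a + b) := by
  have hn : (0 : ℝ) < n := by exact_mod_cast v.pos
  have ha : 0 < a := hb.trans hab
  calc _ ≤ ∑ e : Fin n × Fin n × Bool, ((if e.1 = v then (if e.2.2 then a else b) / n else 0)
        + (if e.2.1 = v then (if e.2.2 then a else b) / n else (0 : ℝ))) := by
        refine Finset.sum_le_sum fun e _ => ?_
        have h0 : (0 : ℝ) ≤ (if e.2.2 then a else b) / n := by split_ifs <;> positivity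
        have h1 : bitProb a b n (.inr (.inl e)) ≤ (if e.2.2 then a else b) / n := min_le_right _ _
        by_cases h2 : e.1 = v <;> by_cases h3 : e.2.1 = v <;> simp only [h2, h3, or_true, true_or,
          or_self, if_true, if_false] <;> linarith
    _ = 2 * (a + b) := by
        rw [Finset.sum_add_distrib]
        simp_rw [Fintype.sum_prod_type]
        simp only [Fintype.univ_bool, Finset.mem_singleton, Bool.true_eq_false, not_false_eq_true,
          Finset.sum_insert, Finset.sum_singleton, if_true, Bool.false_eq_true, if_false]
        have e1 : ∀ x : Fin n, ∑ y : Fin n, ((if x = v then a / (n : ℝ) else 0)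
            + (if x = v then b / (n : ℝ) else 0)) = if x = v then a + b else 0 := by
          intro x
          split_ifs
          · simp; field_simp
          · simp
        simp_rw [e1]
        have e2 : ∑ y : Fin n, ((if y = v then a / (n : ℝ) else 0)
            + (if y = v then b / (n : ℝ) else 0)) = (a + b) / n := by
          rw [Finset.sum_add_distrib]
          simp; field_simp
        rw [e2]
        simp
        field_simp
        ring

lemma bitMean_two_pow_card_le {a b : ℝ} (hb : 0 < b) (hab : b < a) (v : Fin n) :
    bitMean (bitProb a b n) (fun ω => 2 ^ (incidentBits ω v).card) ≤ Real.exp (2 * (a + b)) := by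
  set inc : BitIndex n → Prop := fun i =>
    ∃ e : Fin n × Fin n × Bool, i = .inr (.inl e) ∧ (e.1 = v ∨ e.2.1 = v) with hinc
  have e : ∀ ω : BitIndex n → Bool, (2 : ℝ) ^ (incidentBits ω v).card
      = ∏ i, (if ω i = true ∧ inc i then 2 else 1) := by
    intro ω
    rw [Finset.prod_ite, Finset.prod_const, Finset.prod_const_one, mul_one, incidentBits]
  simp_rw [e]
  -- By independence the mean is the product of `1 + p i` over the incident bits, and `1 + p i ≤ exp
  -- (p i)`.
  rw [bitMean_prod (bitProb a b n) (fun i c => if c = true ∧ inc i then 2 else 1)]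
  calc _ ≤ ∏ i, Real.exp (if inc i then bitProb a b n i else 0) := by
        refine Finset.prod_le_prod (fun i _ => ?_) (fun i _ => ?_)
        · have := bitProb_mem hb hab n i
          split_ifs <;> linarith
        · by_cases h : inc i
          · simp only [h, and_true, if_true, Bool.false_eq_true, if_false]
            linarith [Real.add_one_le_exp (bitProb a b n i)]
          · simp [h]
    _ = Real.exp (∑ i, if inc i then bitProb a b n i else 0) := (Real.exp_sum _ _).symm
    _ ≤ _ := by
        refine Real.exp_le_exp.2 ?_
        refine le_trans (le_of_eq ?_) (sum_bitProb_incident_le hb hab v)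
        rw [Fintype.sum_sum_type, Fintype.sum_sum_type]
        have h1 : ∀ e, inc (.inr (.inl e)) ↔ (e.1 = v ∨ e.2.1 = v) := fun e =>
          ⟨fun ⟨e', h, h'⟩ => by simpa [Sum.inl.inj (Sum.inr.inj h)] using h', fun h => ⟨e, rfl, h⟩⟩
        have h2 : ∀ v, ¬ inc (.inl v) := fun v ⟨_, h, _⟩ => by simp at h
        have h3 : ∀ v, ¬ inc (.inr (.inr v)) := fun v ⟨_, h, _⟩ => by simp at h
        simp [h1, h2, h3]

lemma sum_bitProb_le {a b : ℝ} (hb : 0 < b) (hab : b < a) (hn : 0 < n) :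
    ∑ i, bitProb a b n i ≤ (2 + a + b) * n := by
  have ha : 0 < a := hb.trans hab
  have hn' : (0 : ℝ) < n := by exact_mod_cast hn
  rw [Fintype.sum_sum_type, Fintype.sum_sum_type]
  have h1 : ∑ v : Fin n, bitProb a b n (.inl v) ≤ n := by
    simp only [bitProb, Finset.sum_const, Finset.card_univ, Fintype.card_fin, nsmul_eq_mul]
    linarith
  have h3 : ∑ v : Fin n, bitProb a b n (.inr (.inr v)) ≤ n := by
    refine (Finset.sum_le_sum fun v _ => (bitProb_mem hb hab n _).2).trans ?_
    simp
  have h2 : ∑ e : Fin n × Fin n × Bool, bitProb a b n (.inr (.inl e)) ≤ (a + b) * n := by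
    calc _ ≤ ∑ e : Fin n × Fin n × Bool, (if e.2.2 then a else b) / (n : ℝ) :=
          Finset.sum_le_sum fun e _ => min_le_right _ _
      _ = (a + b) * n := by
        simp_rw [Fintype.sum_prod_type]
        simp
        field_simp
  linarith

/-- The variance of the sum of a local statistic is of order at most `n ^ (5/4)`. -/
lemma exists_variance_le {a b : ℝ} (hb : 0 < b) (hab : b < a) :
    ∃ C : ℝ, 0 < C ∧ ∀ (n : ℕ) (X : ℝ), 0 < X → X ^ 8 = n →
      ∀ T : Outcome n → Fin n → ℝ, IsLocalStatistic T →
        mean a b (fun o => (∑ v, T o v) ^ 2) - mean a b (fun o => ∑ v, T o v) ^ 2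
          ≤ C * X ^ 10 := by
  obtain ⟨C₀, hC₀, hpow⟩ := exists_pow_le_const_mul_two_pow
  have ha : 0 < a := hb.trans hab
  set C₁ := C₀ * Real.exp (2 * (a + b)) with hC₁
  refine ⟨(2 + a + b) * (16 * (1 + C₁)), by positivity, fun n X hX hXn T hT => ?_⟩
  have hn : 0 < n := by
    have : (0 : ℝ) < n := hXn ▸ by positivity
    exact_mod_cast this
  have : Nonempty (Fin n) := ⟨⟨0, hn⟩⟩
  have hp := bitProb_mem hb hab n
  have hv : ∀ v : Fin n, bitMean (bitProb a b n)
      (fun ω => (((incidentBits ω v).card : ℝ) + 2) ^ 24) ≤ C₁ := fun v => by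
    calc _ ≤ bitMean (bitProb a b n) (fun ω => C₀ * 2 ^ (incidentBits ω v).card) :=
          bitMean_mono hp fun ω => hpow _
      _ ≤ C₁ := by
        rw [bitMean_const_mul]
        exact mul_le_mul_of_nonneg_left (bitMean_two_pow_card_le hb hab v) hC₀.le
  have hD : ∀ i : BitIndex n, bitMean (bitProb a b n) (fun ω =>
      (∑ v, T (bitOutcome (Function.update ω i true)) v
        - ∑ v, T (bitOutcome (Function.update ω i false)) v) ^ 2) ≤ 16 * (1 + C₁) * X ^ 2 := by
    intro i
    calc _ ≤ bitMean (bitProb a b n) (fun ω => 16 * (X ^ 2 +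
            ∑ v, (1 / X ^ 6) * (((incidentBits ω v).card : ℝ) + 2) ^ 24)) := by
          refine bitMean_mono hp fun ω => ?_
          obtain ⟨w, -, hw⟩ := Finset.exists_max_image Finset.univ
            (fun v => (incidentBits ω v).card) Finset.univ_nonempty
          have h1 := abs_sum_sub_sum_le hT ω i fun v => hw v (Finset.mem_univ v)
          rw [← sq_abs]
          set y := ((incidentBits ω w).card : ℝ) + 2 with hy
          have hy0 : 0 < y := by positivity
          calc _ ≤ (4 * y ^ 3) ^ 2 := by gcongr
            _ = 16 * y ^ 6 := by ring
            -- Truncation: either `y ^ 6 ≤ X ^ 2`, or `y ^ 18 ≥ X ^ 6`. Power 24 is chosen so that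
            -- replacing the maximum by the sum over the `n = X ^ 8` vertices, whose moments are
            -- bounded, again costs only `O(X ^ 2)`.
            _ ≤ 16 * (X ^ 2 + (1 / X ^ 6) * y ^ 24) := by
              refine mul_le_mul_of_nonneg_left ?_ (by norm_num)
              by_cases hc : y ^ 6 ≤ X ^ 2
              · have : 0 ≤ (1 / X ^ 6) * y ^ 24 := by positivity
                linarith
              · have h2 : X ^ 6 ≤ y ^ 18 := by
                  calc X ^ 6 = (X ^ 2) ^ 3 := by ring
                    _ ≤ (y ^ 6) ^ 3 := by gcongr; exact (not_le.1 hc).le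
                    _ = y ^ 18 := by ring
                have h3 : y ^ 6 ≤ (1 / X ^ 6) * y ^ 24 := by
                  rw [div_mul_eq_mul_div, one_mul, le_div_iff₀ (by positivity)]
                  calc y ^ 6 * X ^ 6 ≤ y ^ 6 * y ^ 18 := by gcongr
                    _ = y ^ 24 := by ring
                have : 0 ≤ X ^ 2 := by positivity
                linarith
            _ ≤ _ := by
              refine mul_le_mul_of_nonneg_left (add_le_add_right ?_ _) (by norm_num)
              exact Finset.single_le_sum (f := fun v => (1 / X ^ 6) *
                (((incidentBits ω v).card : ℝ) + 2) ^ 24) (fun v _ => by positivity)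
                (Finset.mem_univ w)
      _ = 16 * (X ^ 2 + ∑ v, (1 / X ^ 6) * bitMean (bitProb a b n)
            (fun ω => (((incidentBits ω v).card : ℝ) + 2) ^ 24)) := by
          rw [bitMean_const_mul, bitMean_add, bitMean_const, bitMean_sum]
          simp_rw [bitMean_const_mul]
      _ ≤ 16 * (X ^ 2 + ∑ v : Fin n, (1 / X ^ 6) * C₁) := by
          gcongr with v; exact hv v
      _ = _ := by
          rw [Finset.sum_const, Finset.card_univ, Fintype.card_fin, nsmul_eq_mul, ← hXn]
          field_simp
  rw [mean_eq_bitMean, mean_eq_bitMean]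
  refine (efronStein (BitIndex n) (bitProb a b n) hp _).trans ?_
  calc _ ≤ ∑ i, bitProb a b n i * (16 * (1 + C₁) * X ^ 2) := by
        refine Finset.sum_le_sum fun i _ => ?_
        refine mul_le_mul ?_ (hD i) ?_ (hp i).1
        · nlinarith [(hp i).1]
        · exact Finset.sum_nonneg fun ω _ => mul_nonneg (bitWeight_nonneg hp ω) (sq_nonneg _)
    _ = (∑ i, bitProb a b n i) * (16 * (1 + C₁) * X ^ 2) := (Finset.sum_mul _ _ _).symm
    _ ≤ ((2 + a + b) * n) * (16 * (1 + C₁) * X ^ 2) := by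
        have := sum_bitProb_le hb hab hn
        gcongr
    _ = _ := by rw [← hXn]; ring

/-! ### The number of good vertices -/

/-- The pairs of a star with centre `v` and set of leaves `T`. -/
def IsSpoke (v : Fin n) (T : Finset (Fin n)) (u w : Fin n) : Prop :=
  u < w ∧ (u = v ∧ w ∈ T ∨ w = v ∧ u ∈ T)

/-- A condition on each bit which ensures that the vertices in `T` are the neighbours of `v` and
have no other neighbours. -/
def starMatches (v : Fin n) (T : Finset (Fin n)) : BitIndex n → Bool → Prop
  | .inl u, c => u ∈ insert v T → c = true
  | .inr (.inl e), c => if IsSpoke v T e.1 e.2.1 then (e.2.2 = true → c = true)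
      else (e.1 ∈ insert v T ∨ e.2.1 ∈ insert v T → c = false)
  | .inr (.inr _), _ => True

lemma bitGraph_adj_of_starMatches {v : Fin n} {T : Finset (Fin n)} (hv : v ∉ T)
    {ω : BitIndex n → Bool} (h : ∀ i, starMatches v T i (ω i)) {u w : Fin n}
    (hu : u ∈ insert v T) :
    (bitGraph ω).Adj u w ↔ (u = v ∧ w ∈ T ∨ w = v ∧ u ∈ T) := by
  have hσ : ∀ u ∈ insert v T, bitSpins ω u = 1 := fun u hu => by
    have : ω (.inl u) = true := h (.inl u) hu
    simp [bitSpins, this]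
  have key : ∀ u w, u < w → (u ∈ insert v T ∨ w ∈ insert v T) →
      ((bitGraph ω).Adj u w ↔ (u = v ∧ w ∈ T ∨ w = v ∧ u ∈ T)) := by
    intro u w huw hT
    rw [bitGraph_adj_of_lt ω huw]
    have h' := h (.inr (.inl (u, w, decide (bitSpins ω u = bitSpins ω w))))
    by_cases hs : IsSpoke v T u w
    · simp only [starMatches, hs, if_true] at h'
      have hu' : u ∈ insert v T := by
        rcases hs.2 with k | k <;> simp [k]
      have hw' : w ∈ insert v T := by
        rcases hs.2 with k | k <;> simp [k]
      exact iff_of_true (h' (by simp [hσ u hu', hσ w hw'])) hs.2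
    · simp only [starMatches, hs, if_false] at h'
      refine iff_of_false (by simp [h' hT]) fun k => hs ⟨huw, k⟩
  rcases lt_trichotomy u w with k | k | k
  · exact key u w k (Or.inl hu)
  · subst k
    refine iff_of_false (SimpleGraph.irrefl _) ?_
    rintro (⟨k, k'⟩ | ⟨k, k'⟩) <;> exact hv (k ▸ k')
  · rw [SimpleGraph.adj_comm, key w u k (Or.inr hu)]
    exact or_comm

lemma mem_goodVertices_of_starMatches {v : Fin n} {T : Finset (Fin n)} (hv : v ∉ T)
    (hT : T.card = 3) {ω : BitIndex n → Bool} (h : ∀ i, starMatches v T i (ω i)) :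
    v ∈ goodVertices (bitGraph ω) := by
  unfold goodVertices
  simp only [Finset.mem_filter, Finset.mem_univ, true_and]
  rw [← hT]
  refine Finset.card_le_card fun t ht => ?_
  simp only [Finset.mem_filter, Finset.mem_univ, true_and]
  refine ⟨(bitGraph_adj_of_starMatches hv h (by simp)).2 (Or.inl ⟨rfl, ht⟩), ?_⟩
  have : (bitGraph ω).neighborFinset t = {v} := by
    ext w
    rw [SimpleGraph.mem_neighborFinset, bitGraph_adj_of_starMatches hv h (by simp [ht]),
      Finset.mem_singleton]
    constructor
    · rintro (⟨rfl, -⟩ | ⟨rfl, -⟩)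
      exacts [absurd ht hv, rfl]
    · exact fun k => Or.inr ⟨k, ht⟩
  rw [← SimpleGraph.card_neighborFinset_eq_degree, this]
  simp

/-- For fixed `v` the star events are disjoint, because each determines `T` as the neighbourhood of
`v`; and each makes `v` good, as its three leaves have degree 1. Their probabilities may therefore
be added. -/
lemma sum_starMatches_le (v : Fin n) (ω : BitIndex n → Bool) :
    ∑ T ∈ (Finset.univ.erase v).powersetCard 3,
      (if ∀ i, starMatches v T i (ω i) then (1 : ℝ) else 0)
        ≤ if v ∈ goodVertices (bitGraph ω) then 1 else 0 := by
  have hvT : ∀ T ∈ (Finset.univ.erase v).powersetCard 3, v ∉ T ∧ T.card = 3 := fun T hT => by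
    rw [Finset.mem_powersetCard] at hT
    exact ⟨fun h => by simpa using hT.1 h, hT.2⟩
  by_cases hex : ∃ T ∈ (Finset.univ.erase v).powersetCard 3, ∀ i, starMatches v T i (ω i)
  · obtain ⟨T, hT, h⟩ := hex
    have hN : ∀ S ∈ (Finset.univ.erase v).powersetCard 3, (∀ i, starMatches v S i (ω i)) →
        S = (bitGraph ω).neighborFinset v := by
      intro S hS h
      ext w
      rw [SimpleGraph.mem_neighborFinset, bitGraph_adj_of_starMatches (hvT S hS).1 h (by simp)]
      constructor
      · exact fun k => Or.inl ⟨rfl, k⟩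
      · rintro (k | k)
        exacts [k.2, absurd k.2 (hvT S hS).1]
    rw [if_pos (mem_goodVertices_of_starMatches (hvT T hT).1 (hvT T hT).2 h),
      Finset.sum_eq_single T, if_pos h]
    · intro S hS hne
      rw [if_neg]
      exact fun k => hne ((hN S hS k).trans (hN T hT h).symm)
    · exact fun k => absurd hT k
  · push Not at hex
    rw [Finset.sum_eq_zero]
    · split_ifs <;> norm_num
    · intro T hT
      obtain ⟨i, hi⟩ := hex T hT
      rw [if_neg fun k => hi (k i)]

lemma card_spokes_le (v : Fin n) (T : Finset (Fin n)) :
    (Finset.univ.filter fun e : Fin n × Fin n × Bool =>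
      IsSpoke v T e.1 e.2.1 ∧ e.2.2 = true).card ≤ T.card := by
  refine Finset.card_le_card_of_injOn (fun e => if e.1 = v then e.2.1 else e.1) ?_ ?_
  · rintro ⟨u, w, k⟩ h
    simp only [Finset.coe_filter, Finset.mem_univ, true_and, Set.mem_ofPred_eq] at h
    obtain ⟨⟨h1, h2 | h2⟩, -⟩ := h
    · simp [h2]
    · simp [h2.1 ▸ h1.ne, h2.2]
  · rintro ⟨u, w, k⟩ h ⟨u', w', k'⟩ h' he
    simp only [Finset.coe_filter, Finset.mem_univ, true_and, Set.mem_ofPred_eq] at h h' he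
    obtain ⟨⟨h1, h2⟩, rfl⟩ := h
    obtain ⟨⟨h3, h4⟩, rfl⟩ := h'
    rcases h2 with ⟨rfl, h2⟩ | ⟨rfl, h2⟩ <;> rcases h4 with ⟨rfl, h4⟩ | ⟨rfl, h4⟩ <;>
      split_ifs at he <;> grind

lemma card_touching_le (S : Finset (Fin n)) :
    (Finset.univ.filter fun e : Fin n × Fin n × Bool => e.1 ∈ S ∨ e.2.1 ∈ S).card
      ≤ 4 * n * S.card := by
  calc _ ≤ (S ×ˢ (Finset.univ : Finset (Fin n × Bool)) ∪ (Finset.univ : Finset (Fin n)) ×ˢ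
        (S ×ˢ (Finset.univ : Finset Bool))).card := by
        refine Finset.card_le_card fun e he => ?_
        simpa using he
    _ ≤ _ := Finset.card_union_le _ _
    _ = 4 * n * S.card := by
        simp only [Finset.card_product, Finset.card_univ, Fintype.card_prod, Fintype.card_fin,
          Fintype.card_bool]
        ring

lemma bitMean_starMatches_ge {a b : ℝ} (hb : 0 < b) (hab : b < a) (hn : 2 * a ≤ n) (v : Fin n)
    {T : Finset (Fin n)} (hv : v ∉ T) (hT : T.card = 3) :
    (1 / 16) * (a / n) ^ 3 * (1 - a / n) ^ (16 * n) ≤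
      bitMean (bitProb a b n) (fun ω => if ∀ i, starMatches v T i (ω i) then 1 else 0) := by
  have ha : 0 < a := hb.trans hab
  have hn0 : (0 : ℝ) < n := by exact_mod_cast v.pos
  have han : a / n ≤ 1 / 2 := by rw [div_le_iff₀ hn0]; linarith
  have han0 : 0 < a / n := by positivity
  have hbn0 : 0 < b / n := by positivity
  have hban : b / n ≤ a / n := by gcongr
  have hcard : (insert v T).card = 4 := by rw [Finset.card_insert_of_notMem hv, hT]
  rw [bitMean_cylinder, Fintype.prod_sum_type, Fintype.prod_sum_type, mul_assoc]
  have h1 : ∏ u : Fin n, (bitProb a b n (.inl u) * (if starMatches v T (.inl u) true then 1 else 0)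
      + (1 - bitProb a b n (.inl u)) * (if starMatches v T (.inl u) false then 1 else 0))
        = 1 / 16 := by
    calc _ = ∏ u : Fin n, if u ∈ insert v T then (1 / 2 : ℝ) else 1 := by
          refine Finset.prod_congr rfl fun u _ => ?_
          by_cases hu : u ∈ insert v T <;> norm_num [starMatches, bitProb, hu]
      _ = 1 / 16 := by
          rw [Finset.prod_ite_mem, Finset.univ_inter, Finset.prod_const, hcard]; norm_num
  have h3 : ∏ u : Fin n, (bitProb a b n (.inr (.inr u)) *
      (if starMatches v T (.inr (.inr u)) true then 1 else 0)
      + (1 - bitProb a b n (.inr (.inr u))) *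
        (if starMatches v T (.inr (.inr u)) false then 1 else 0)) = 1 := by
    refine Finset.prod_eq_one fun u _ => ?_
    simp [starMatches]
  rw [h1, h3, mul_one]
  refine mul_le_mul_of_nonneg_left ?_ (by norm_num)
  -- At most three bits have to be `true`, and at most `4 * n * 4` edge bits touch the star. The
  -- spokes are counted in both products, which only lowers the bound.
  calc (a / n) ^ 3 * (1 - a / n) ^ (16 * n)
      ≤ (∏ e : Fin n × Fin n × Bool, if IsSpoke v T e.1 e.2.1 ∧ e.2.2 = true then a / n else 1) *
        ∏ e : Fin n × Fin n × Bool,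
          if e.1 ∈ insert v T ∨ e.2.1 ∈ insert v T then 1 - a / n else (1 : ℝ) := by
        rw [Finset.prod_ite, Finset.prod_ite]
        simp only [Finset.prod_const, one_pow, mul_one]
        refine mul_le_mul ?_ ?_ (pow_nonneg (by linarith) _) (pow_nonneg han0.le _)
        · exact pow_le_pow_of_le_one han0.le (by linarith) ((card_spokes_le v T).trans hT.le)
        · refine pow_le_pow_of_le_one (by linarith) (by linarith) ?_
          refine (card_touching_le (insert v T)).trans (le_of_eq ?_)
          rw [hcard]; ring
    _ ≤ _ := by
        rw [← Finset.prod_mul_distrib]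
        refine Finset.prod_le_prod (fun e _ => ?_) (fun e _ => ?_)
        · have : 0 ≤ 1 - a / n := by linarith
          split_ifs <;> positivity
        · obtain ⟨u, w, k⟩ := e
          have hk : bitProb a b n (.inr (.inl (u, w, k))) = (if k then a else b) / n := by
            simp only [bitProb]
            refine min_eq_right ?_
            split_ifs <;> linarith
          simp only [starMatches, hk]
          by_cases hs : IsSpoke v T u w
          · have : u ∈ insert v T ∨ w ∈ insert v T := by
              rcases hs.2 with k | k <;> simp [k]
            cases k
            · simp only [hs, this, if_true]; simp; linarith
            · simp only [hs, this, if_true]; simp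
              exact mul_le_of_le_one_right han0.le (by linarith)
          · by_cases ht : u ∈ insert v T ∨ w ∈ insert v T
            · cases k <;> (simp only [hs, ht, if_true, if_false]; simp <;> linarith)
            · simp only [hs, ht, if_false]; simp

lemma exp_neg_le_one_sub_pow {x : ℝ} (h0 : 0 ≤ x) (h1 : x ≤ 1 / 2) (m : ℕ) :
    Real.exp (-(2 * x * m)) ≤ (1 - x) ^ m := by
  have h : Real.exp (-(2 * x)) ≤ 1 - x := by
    rw [Real.exp_neg, inv_le_comm₀ (Real.exp_pos _) (by linarith)]
    refine le_trans ?_ (Real.add_one_le_exp _)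
    rw [inv_le_iff_one_le_mul₀ (by linarith)]
    nlinarith
  calc Real.exp (-(2 * x * m)) = Real.exp (-(2 * x)) ^ m := by
        rw [← Real.exp_nat_mul]; congr 1; ring
    _ ≤ _ := by gcongr

/-- The expected number of good vertices is linear in `n`. -/
lemma exists_mean_card_good_ge {a b : ℝ} (hb : 0 < b) (hab : b < a) :
    ∃ c : ℝ, 0 < c ∧ ∀ n : ℕ, 6 ≤ n → 2 * a ≤ n →
      c * n ≤ mean a b (fun o : Outcome n => ∑ v, if v ∈ goodVertices o.2.1 then 1 else 0) := by
  have ha : 0 < a := hb.trans hab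
  -- There are at least `(n - 3) ^ 3 / 6 ≥ n ^ 3 / 48` sets of leaves when `n ≥ 6`. The four spins
  -- of a star cost `1 / 16`, and the absent edges cost `exp (-2 * (a / n) * 16 * n)`.
  refine ⟨(1 / 48) * ((1 / 16) * a ^ 3 * Real.exp (-(32 * a))), by positivity, fun n h6 hn => ?_⟩
  have hn0 : (0 : ℝ) < n := by exact_mod_cast (by omega : 0 < n)
  have han : a / n ≤ 1 / 2 := by rw [div_le_iff₀ hn0]; linarith
  have han0 : 0 < a / n := by positivity
  have key : ∀ v : Fin n, (1 / 48) * ((1 / 16) * a ^ 3 * Real.exp (-(32 * a))) ≤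
      bitMean (bitProb a b n) (fun ω => if v ∈ goodVertices (bitGraph ω) then 1 else 0) := by
    intro v
    refine le_trans ?_ (bitMean_mono (bitProb_mem hb hab n) (sum_starMatches_le v))
    rw [bitMean_sum]
    have hstar : ∀ T ∈ (Finset.univ.erase v).powersetCard 3,
        (1 / 16) * (a / n) ^ 3 * Real.exp (-(32 * a)) ≤
        bitMean (bitProb a b n) (fun ω => if ∀ i, starMatches v T i (ω i) then 1 else 0) := by
      intro T hT
      rw [Finset.mem_powersetCard] at hT
      refine le_trans ?_ (bitMean_starMatches_ge hb hab hn v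
        (fun h => by simpa using hT.1 h) hT.2)
      have := exp_neg_le_one_sub_pow han0.le han (16 * n)
      have e : 2 * (a / n) * ((16 * n : ℕ) : ℝ) = 32 * a := by push_cast; field_simp; norm_num
      rw [e] at this
      gcongr
    refine le_trans ?_ (Finset.sum_le_sum hstar)
    rw [Finset.sum_const, Finset.card_powersetCard, Finset.card_erase_of_mem (Finset.mem_univ v),
      Finset.card_univ, Fintype.card_fin, nsmul_eq_mul]
    have hch : (n : ℝ) ^ 3 / 48 ≤ ((n - 1).choose 3 : ℝ) := by
      refine le_trans ?_ (Nat.pow_le_choose (α := ℝ) 3 (n - 1))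
      have h3 : n - 1 + 1 - 3 = n - 3 := by omega
      have h4 : (n : ℝ) / 2 ≤ ((n - 3 : ℕ) : ℝ) := by
        rw [Nat.cast_sub (by omega)]
        have : (6 : ℝ) ≤ n := by exact_mod_cast h6
        push_cast; linarith
      rw [h3]
      calc (n : ℝ) ^ 3 / 48 = ((n : ℝ) / 2) ^ 3 / 6 := by ring
        _ ≤ ((n - 3 : ℕ) : ℝ) ^ 3 / 6 := by gcongr
        _ = _ := by norm_num [Nat.factorial]
    calc _ = (n : ℝ) ^ 3 / 48 * ((1 / 16) * (a / n) ^ 3 * Real.exp (-(32 * a))) := by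
          field_simp
      _ ≤ _ := by gcongr
  rw [mean_eq_bitMean]
  simp only [bitOutcome]
  rw [bitMean_sum]
  refine le_trans (le_of_eq ?_) (Finset.sum_le_sum fun v _ => key v)
  simp [mul_comm]

/-! ### Typical outcomes -/

lemma mean_mono {a b : ℝ} (hb : 0 < b) (hab : b < a) {F F' : Outcome n → ℝ} (h : ∀ o, F o ≤ F' o) :
    mean a b F ≤ mean a b F' :=
  Finset.sum_le_sum fun o _ => mul_le_mul_of_nonneg_left (h o) (law_nonneg hb hab n o)

lemma prob_mono {a b : ℝ} (hb : 0 < b) (hab : b < a) {E E' : Set (Outcome n)} (h : E ⊆ E') :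
    prob a b E ≤ prob a b E' := by
  rw [prob_eq_mean, prob_eq_mean]
  refine mean_mono hb hab fun o => ?_
  by_cases h1 : o ∈ E
  · simp [h1, h h1]
  · simp only [h1, if_false]; split_ifs <;> norm_num

lemma prob_union_le {a b : ℝ} (hb : 0 < b) (hab : b < a) (E E' : Set (Outcome n)) :
    prob a b (E ∪ E') ≤ prob a b E + prob a b E' := by
  rw [prob_eq_mean, prob_eq_mean, prob_eq_mean, mean, mean, mean, ← Finset.sum_add_distrib]
  refine Finset.sum_le_sum fun o _ => ?_
  rw [← mul_add]
  refine mul_le_mul_of_nonneg_left ?_ (law_nonneg hb hab n o)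
  by_cases h1 : o ∈ E <;> by_cases h2 : o ∈ E' <;> simp [h1, h2]

lemma prob_add_prob_compl (a b : ℝ) (E : Set (Outcome n)) :
    prob a b E + prob a b Eᶜ = 1 := by
  rw [prob_eq_mean, prob_eq_mean, mean, mean, ← Finset.sum_add_distrib]
  refine (Finset.sum_congr rfl fun o _ => ?_).trans (sum_law a b n)
  by_cases h1 : o ∈ E <;> simp [h1]

lemma prob_nonneg {a b : ℝ} (hb : 0 < b) (hab : b < a) (E : Set (Outcome n)) : 0 ≤ prob a b E :=
  Finset.sum_nonneg fun o _ => law_nonneg hb hab n o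

/-- The law depends only on which pairs of spins agree. This symmetry centres every sum of spins
over a set determined by the precursor and the cuts. -/
lemma law_neg (a b : ℝ) (σ : Spins n) (H : SimpleGraph (Fin n)) (D : Finset (Fin n)) :
    law a b n (-σ, H, D) = law a b n (σ, H, D) := by
  have h1 : graphProb a b (-σ) H = graphProb a b σ H := by
    simp [graphProb, edgeProb]
  have h2 : cuttableVertices (-σ) H = cuttableVertices σ H := by
    simp [cuttableVertices]
  simp [law, cutSetProb, h1, h2]

/-- A statistic that is odd in the spins has mean zero. -/
lemma mean_eq_zero_of_odd (a b : ℝ) {F : Outcome n → ℝ}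
    (hF : ∀ σ H D, F (-σ, H, D) = - F (σ, H, D)) : mean a b F = 0 := by
  have h : mean a b F = mean a b (fun o => - F o) := by
    unfold mean
    refine Fintype.sum_equiv ((Equiv.neg (Spins n)).prodCongr (Equiv.refl _)) _ _ ?_
    rintro ⟨σ, H, D⟩
    simp only [Equiv.prodCongr_apply, Prod.map, Equiv.neg_apply, Equiv.refl_apply]
    rw [law_neg, hF, neg_neg]
  have h' : mean a b (fun o => - F o) = - mean a b F := by
    simp [mean]
  linarith

lemma mean_const_mul (a b c : ℝ) (F : Outcome n → ℝ) :
    mean a b (fun o => c * F o) = c * mean a b F := by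
  simp only [mean, Finset.mul_sum]
  exact Finset.sum_congr rfl fun _ _ => by ring

/-- Chebyshev's inequality. -/
lemma prob_le_of_variance_le {a b : ℝ} (hb : 0 < b) (hab : b < a) {F : Outcome n → ℝ} {V t : ℝ}
    (ht : 0 < t) (hV : mean a b (fun o => F o ^ 2) - mean a b F ^ 2 ≤ V) :
    prob a b {o | t < |F o - mean a b F|} ≤ V / t ^ 2 := by
  rw [le_div_iff₀ (by positivity), mul_comm, prob_eq_mean, ← mean_const_mul]
  have h : mean a b (fun o => (F o - mean a b F) ^ 2)
      = mean a b (fun o => F o ^ 2) - mean a b F ^ 2 := by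
    set m := mean a b F with hm
    have e : ∀ o, law a b n o * (F o - m) ^ 2
        = law a b n o * F o ^ 2 - 2 * m * (law a b n o * F o) + m ^ 2 * law a b n o := by
      intro o; ring
    unfold mean
    simp_rw [e]
    rw [Finset.sum_add_distrib, Finset.sum_sub_distrib, ← Finset.mul_sum, ← Finset.mul_sum,
      sum_law]
    change _ - 2 * m * mean a b F + _ = _
    rw [← hm]; ring
  refine le_trans (mean_mono hb hab fun o => ?_) (h.trans_le hV)
  by_cases ho : t < |F o - mean a b F|
  · simp only [Set.mem_ofPred_eq, ho, if_true, mul_one]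
    rw [← sq_abs (F o - _)]
    gcongr
  · simp only [Set.mem_ofPred_eq, ho, if_false, mul_zero]
    positivity

/-- The spin of `v` as a real number. -/
def realSpin (σ : Spins n) (v : Fin n) : ℝ := ((σ v : ℤ) : ℝ)

lemma realSpin_eq_or (σ : Spins n) (v : Fin n) : realSpin σ v = 1 ∨ realSpin σ v = -1 := by
  unfold realSpin
  rcases Int.units_eq_one_or (σ v) with h | h <;> simp [h]

lemma abs_realSpin (σ : Spins n) (v : Fin n) : |realSpin σ v| = 1 := by
  rcases realSpin_eq_or σ v with h | h <;> simp [h]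

lemma realSpin_neg (σ : Spins n) (v : Fin n) : realSpin (-σ) v = - realSpin σ v := by
  simp [realSpin]

/-- The spins of an outcome with many good vertices are balanced on all vertices, on the good
vertices and on the cut vertices. -/
structure IsTypical (c X : ℝ) (o : Outcome n) : Prop where
  all : |∑ v, realSpin o.1 v| ≤ X ^ 6
  good : |∑ v ∈ goodVertices o.2.1, realSpin o.1 v| ≤ X ^ 6
  cut : |∑ v ∈ o.2.2, realSpin o.1 v| ≤ X ^ 6
  card_good : c * X ^ 8 ≤ ((goodVertices o.2.1).card : ℝ)

/-- Outcomes are typical with high probability. -/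
lemma exists_prob_not_isTypical_le {a b : ℝ} (hb : 0 < b) (hab : b < a) :
    ∃ c C X₀ : ℝ, 0 < c ∧ 0 < C ∧ ∀ (n : ℕ) (X : ℝ), X₀ ≤ X → 0 < X → X ^ 8 = n →
      prob a b {o : Outcome n | ¬ IsTypical c X o} ≤ C / X ^ 2 := by
  obtain ⟨C, hC, hvar⟩ := exists_variance_le hb hab
  obtain ⟨c, hc, hgood⟩ := exists_mean_card_good_ge hb hab
  -- Each of four applications of Chebyshev's inequality at deviation `X ^ 6` costs `C * X ^ 10 / X
  -- ^ 12`. The terms `6` and `2 * a` allow `exists_mean_card_good_ge` to be used; the term `2 / c`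
  -- makes `X ^ 6` at most half the mean number of good vertices, hence the constant `c / 2`.
  refine ⟨c / 2, 4 * C, 6 + 2 * a + 2 / c, by positivity, by positivity, fun n X hX₀ hX hXn => ?_⟩
  have ha : 0 < a := hb.trans hab
  have hc2 : 0 < 2 / c := by positivity
  have hX1 : 1 ≤ X := by linarith
  have hXn' : X ≤ n := by
    rw [← hXn]
    exact le_self_pow₀ hX1 (by norm_num)
  have hn6 : 6 ≤ n := by
    have : (6 : ℝ) ≤ n := by linarith
    exact_mod_cast this
  have hmean := hgood n hn6 (by linarith)
  have cheb : ∀ T : Outcome n → Fin n → ℝ, IsLocalStatistic T →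
      prob a b {o | X ^ 6 < |∑ v, T o v - mean a b (fun o => ∑ v, T o v)|} ≤ C / X ^ 2 := by
    intro T hT
    refine (prob_le_of_variance_le hb hab (by positivity) (hvar n X hX hXn T hT)).trans
      (le_of_eq ?_)
    field_simp
  have hspin : ∀ (σ : Spins n) (P : Prop) [Decidable P] (v : Fin n), |if P then realSpin σ v else 0| ≤ 1 := by
    intro σ P _ v
    split_ifs
    · exact (abs_realSpin σ v).le
    · simp
  have h1 := cheb (fun o v => realSpin o.1 v)
    ⟨fun o v => (abs_realSpin _ _).le, fun o o' v h _ _ => by simp [realSpin, h]⟩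
  have h2 := cheb (fun o v => if v ∈ goodVertices o.2.1 then realSpin o.1 v else 0)
    ⟨fun o v => hspin _ _ _, fun o o' v h h' _ => by simp [realSpin, h, h']⟩
  have h3 := cheb (fun o v => if v ∈ o.2.2 then realSpin o.1 v else 0)
    ⟨fun o v => hspin _ _ _, fun o o' v h _ h' => by simp [realSpin, h, h']⟩
  have h4 := cheb (fun o v => if v ∈ goodVertices o.2.1 then 1 else 0)
    ⟨fun o v => by split_ifs <;> simp, fun o o' v _ h _ => by simp [h]⟩
  simp only [Finset.sum_ite_mem, Finset.univ_inter] at h1 h2 h3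
  rw [mean_eq_zero_of_odd a b (fun σ H D => by simp [realSpin_neg])] at h1 h2 h3
  simp only [sub_zero] at h1 h2 h3
  have hsub : {o : Outcome n | ¬ IsTypical (c / 2) X o} ⊆
      (({o | X ^ 6 < |∑ v, realSpin o.1 v|} ∪
        {o | X ^ 6 < |∑ v ∈ goodVertices o.2.1, realSpin o.1 v|}) ∪
        {o | X ^ 6 < |∑ v ∈ o.2.2, realSpin o.1 v|}) ∪
        {o | X ^ 6 < |∑ v, (if v ∈ goodVertices o.2.1 then 1 else 0) - mean a b
          (fun o : Outcome n => ∑ v, if v ∈ goodVertices o.2.1 then 1 else 0)|} := by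
    intro o ho
    by_contra hcon
    simp only [Set.mem_union, Set.mem_ofPred_eq, not_or, not_lt] at hcon
    refine ho ⟨hcon.1.1.1, hcon.1.1.2, hcon.1.2, ?_⟩
    have h5 := (abs_le.1 hcon.2).1
    rw [Finset.sum_boole, Finset.filter_mem_eq_inter, Finset.univ_inter] at h5
    have h6 : 2 / c ≤ X ^ 2 := by nlinarith
    rw [div_le_iff₀ hc] at h6
    have h7 : 2 * X ^ 6 ≤ c * X ^ 8 := by
      have : X ^ 8 = X ^ 2 * X ^ 6 := by ring
      rw [this]
      have : 0 < X ^ 6 := by positivity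
      nlinarith
    rw [← hXn] at hmean
    linarith
  refine (prob_mono hb hab hsub).trans ((prob_union_le hb hab _ _).trans
    ((add_le_add_left ((prob_union_le hb hab _ _).trans
      (add_le_add_left (prob_union_le hb hab _ _) _)) _).trans ?_))
  have : 4 * C / X ^ 2 = C / X ^ 2 + C / X ^ 2 + C / X ^ 2 + C / X ^ 2 := by ring
  rw [this]
  linarith

/-! ### The precursors that are compatible with a revealed graph -/

lemma three_le_degree_of_mem_goodVertices {H : SimpleGraph (Fin n)} {v : Fin n}
    (hv : v ∈ goodVertices H) : 3 ≤ H.degree v := by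
  simp only [goodVertices, Finset.mem_filter, Finset.mem_univ, true_and] at hv
  refine hv.trans ?_
  rw [← SimpleGraph.card_neighborFinset_eq_degree]
  refine Finset.card_le_card fun w hw => ?_
  simp only [Finset.mem_filter, Finset.mem_univ, true_and] at hw
  simpa using hw.1

lemma degree_of_mem_markedVertices {H : SimpleGraph (Fin n)} {v : Fin n}
    (hv : v ∈ markedVertices H) : H.degree v = 2 := by
  simp only [markedVertices, Finset.mem_filter, Finset.mem_univ, true_and] at hv
  exact hv.1

lemma mem_goodVertices_of_adj {H : SimpleGraph (Fin n)} {v w : Fin n}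
    (hv : v ∈ markedVertices H) (h : H.Adj v w) : w ∈ goodVertices H := by
  simp only [markedVertices, Finset.mem_filter, Finset.mem_univ, true_and] at hv
  exact hv.2 w h

/-- The degree is 2 in one case and at least 3 in the other. Consequently marked vertices are
pairwise non-adjacent, and cutting some of them leaves the edges at the others intact. -/
lemma notMem_goodVertices_of_mem_markedVertices {H : SimpleGraph (Fin n)} {v : Fin n}
    (hv : v ∈ markedVertices H) : v ∉ goodVertices H := fun h => by
  have h1 := three_le_degree_of_mem_goodVertices h
  have h2 := degree_of_mem_markedVertices hv
  omega

lemma cutGraph_adj {H : SimpleGraph (Fin n)} {D : Finset (Fin n)} {u v : Fin n} :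
    (cutGraph H D).Adj u v ↔ H.Adj u v ∧ u ∉ D ∧ v ∉ D := Iff.rfl

lemma cuttableVertices_subset (σ : Spins n) (H : SimpleGraph (Fin n)) :
    cuttableVertices σ H ⊆ markedVertices H := fun v hv => by
  simp only [cuttableVertices, Finset.mem_filter, Finset.mem_univ, true_and] at hv
  exact hv.1

/-- The vertices that have been cut in a revealed graph: marked and isolated. -/
noncomputable def cutVertices (G : MarkedGraph n) : Finset (Fin n) :=
  G.marked.filter fun v => ∀ w, ¬ G.graph.Adj v w

/-- An uncut marked vertex keeps both its edges, since its neighbours are good and so never cut.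
Isolation thus identifies the cut vertices. -/
lemma cutVertices_observed {σ : Spins n} {H : SimpleGraph (Fin n)} {D : Finset (Fin n)}
    (hD : D ⊆ markedVertices H) : cutVertices (observed (σ, H, D)) = D := by
  ext v
  rw [cutVertices, Finset.mem_filter]
  change v ∈ markedVertices H ∧ (∀ w, ¬ (cutGraph H D).Adj v w) ↔ v ∈ D
  constructor
  · rintro ⟨hm, h⟩
    by_contra hv
    have hdeg := degree_of_mem_markedVertices hm
    obtain ⟨w, hw⟩ := (SimpleGraph.degree_pos_iff_exists_adj H v).1 (by omega)
    refine h w ⟨hw, hv, fun hwD => ?_⟩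
    exact notMem_goodVertices_of_mem_markedVertices (hD hwD) (mem_goodVertices_of_adj hm hw)
  · exact fun hv => ⟨hD hv, fun w hw => hw.2.1 hv⟩

/-- Moving the edges at `D` among good vertices is invisible to the markings. Neighbours in `D` have
degree 2 and do not count towards goodness, and the degree of a good vertex may change but never
becomes 2. Any other vertex outside `D` keeps its whole neighbourhood. -/
lemma markings_eq_of_cutGraph_eq {H H' : SimpleGraph (Fin n)} {D : Finset (Fin n)}
    (hD : D ⊆ markedVertices H) (hcut : cutGraph H D = cutGraph H' D)
    (hdeg : ∀ v ∈ D, H'.degree v = 2) (hgood : ∀ v ∈ D, ∀ w, H'.Adj v w → w ∈ goodVertices H) :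
    goodVertices H' = goodVertices H ∧ markedVertices H' = markedVertices H := by
  have hadj : ∀ u w, u ∉ D → w ∉ D → (H.Adj u w ↔ H'.Adj u w) := fun u w hu hw => by
    have : (cutGraph H D).Adj u w ↔ (cutGraph H' D).Adj u w := by rw [hcut]
    simpa [cutGraph_adj, hu, hw] using this
  have hadj' : ∀ u w, u ∉ D → u ∉ goodVertices H → (H.Adj u w ↔ H'.Adj u w) := by
    intro u w hu hg
    by_cases hw : w ∈ D
    · exact iff_of_false (fun h => hg (mem_goodVertices_of_adj (hD hw) h.symm))
        (fun h => hg (hgood w hw u h.symm))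
    · exact hadj u w hu hw
  have hdegD : ∀ v ∈ D, H.degree v = 2 := fun v hv => degree_of_mem_markedVertices (hD hv)
  have hgD : ∀ v ∈ goodVertices H, v ∉ D := fun v hv h =>
    notMem_goodVertices_of_mem_markedVertices (hD h) hv
  have hdeg2 : ∀ u, H'.degree u = 2 ↔ H.degree u = 2 := by
    intro u
    by_cases hu : u ∈ D
    · exact iff_of_true (hdeg u hu) (hdegD u hu)
    by_cases hg : u ∈ goodVertices H
    · refine iff_of_false ?_ (by have := three_le_degree_of_mem_goodVertices hg; omega)
      -- The three neighbours that witness goodness in `H` have degree different from 2, so they lie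
      -- outside `D` and remain neighbours in `H'`.
      have h3 : 3 ≤ H'.degree u := by
        simp only [goodVertices, Finset.mem_filter, Finset.mem_univ, true_and] at hg
        refine hg.trans ?_
        rw [← SimpleGraph.card_neighborFinset_eq_degree]
        refine Finset.card_le_card fun w hw => ?_
        simp only [Finset.mem_filter, Finset.mem_univ, true_and] at hw
        rw [SimpleGraph.mem_neighborFinset]
        exact (hadj u w hu fun h => hw.2 (hdegD w h)).1 hw.1
      omega
    · rw [← SimpleGraph.card_neighborFinset_eq_degree, ← SimpleGraph.card_neighborFinset_eq_degree]
      have : H'.neighborFinset u = H.neighborFinset u := by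
        ext w; simp [hadj' u w hu hg]
      rw [this]
  have hG : goodVertices H' = goodVertices H := by
    ext v
    by_cases hv : v ∈ D
    · refine iff_of_false (fun h => ?_) (fun h => hgD v h hv)
      have := three_le_degree_of_mem_goodVertices h
      have := hdeg v hv
      omega
    · simp only [goodVertices, Finset.mem_filter, Finset.mem_univ, true_and]
      rw [Finset.filter_congr (q := fun u => H.Adj v u ∧ H.degree u ≠ 2)]
      intro u _
      rw [ne_eq, hdeg2 u, ne_eq]
      refine and_congr_left fun h => ?_
      exact (hadj v u hv fun hu => h (hdegD u hu)).symm
  refine ⟨hG, ?_⟩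
  ext v
  simp only [markedVertices, Finset.mem_filter, Finset.mem_univ, true_and]
  rw [hdeg2, hG]
  refine and_congr_right fun h2 => ?_
  by_cases hv : v ∈ D
  · exact iff_of_true (hgood v hv) (fun w hw => mem_goodVertices_of_adj (hD hv) hw)
  · have hg : v ∉ goodVertices H := fun h => by
      have := three_le_degree_of_mem_goodVertices h
      omega
    exact forall_congr' fun w => by rw [hadj' v w hv hg]

/-- The graph `g` together with the edges from each `v` to the vertices in `φ v`. -/
def restore (g : SimpleGraph (Fin n)) (φ : Fin n → Finset (Fin n)) : SimpleGraph (Fin n) :=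
  g ⊔ SimpleGraph.fromRel fun u v => v ∈ φ u

lemma restore_adj {g : SimpleGraph (Fin n)} {φ : Fin n → Finset (Fin n)} {u v : Fin n} :
    (restore g φ).Adj u v ↔ g.Adj u v ∨ u ≠ v ∧ (v ∈ φ u ∨ u ∈ φ v) := by
  simp [restore]

/-- The precursors that are compatible with the revealed graph `G`, the spins `τ` and the set `D`
of cut vertices. -/
noncomputable def precursors (G : MarkedGraph n) (D : Finset (Fin n)) (τ : Spins n) :
    Finset (SimpleGraph (Fin n)) :=
  {H | observed (τ, H, D) = G ∧ D ⊆ cuttableVertices τ H}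

/-- The possible neighbourhoods of `v` when `v` is cut: pairs of good vertices of opposite spin. -/
noncomputable def cutChoices (G : MarkedGraph n) (D : Finset (Fin n)) (τ : Spins n) (v : Fin n) :
    Finset (Finset (Fin n)) :=
  if v ∈ D then (G.good.filter fun w => τ w ≠ τ v).powersetCard 2 else {∅}

lemma mem_cuttableVertices {σ : Spins n} {H : SimpleGraph (Fin n)} {v : Fin n} :
    v ∈ cuttableVertices σ H ↔ v ∈ markedVertices H ∧ ∀ w, H.Adj v w → σ w ≠ σ v := by
  simp [cuttableVertices]

/-- The number of compatible precursors. -/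
lemma card_precursors {σ : Spins n} {H₀ : SimpleGraph (Fin n)} {D : Finset (Fin n)}
    (hD : D ⊆ markedVertices H₀) (τ : Spins n) :
    (precursors (observed (σ, H₀, D)) D τ).card =
      ∏ v ∈ D, ((goodVertices H₀).filter fun w => τ w ≠ τ v).card.choose 2 := by
  set G := observed (σ, H₀, D) with hG
  have hGgood : G.good = goodVertices H₀ := rfl
  have hGgraph : G.graph = cutGraph H₀ D := rfl
  have hgD : ∀ v ∈ goodVertices H₀, v ∉ D := fun v hv h =>
    notMem_goodVertices_of_mem_markedVertices (hD h) hv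
  have hcard : (Fintype.piFinset (cutChoices G D τ)).card =
      ∏ v ∈ D, ((goodVertices H₀).filter fun w => τ w ≠ τ v).card.choose 2 := by
    rw [Fintype.card_piFinset, ← Finset.prod_subset (Finset.subset_univ D)]
    · refine Finset.prod_congr rfl fun v hv => ?_
      rw [cutChoices, if_pos hv, Finset.card_powersetCard, hGgood]
    · intro v _ hv
      simp [cutChoices, hv]
  rw [← hcard]
  have hφin : ∀ φ ∈ Fintype.piFinset (cutChoices G D τ),
      (∀ v ∈ D, (∀ w ∈ φ v, w ∈ goodVertices H₀ ∧ τ w ≠ τ v) ∧ (φ v).card = 2) ∧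
      ∀ v ∉ D, φ v = ∅ := by
    intro φ hφ
    rw [Fintype.mem_piFinset] at hφ
    refine ⟨fun v hv => ?_, fun v hv => ?_⟩
    · have := hφ v
      rw [cutChoices, if_pos hv, Finset.mem_powersetCard] at this
      exact ⟨fun w hw => by simpa [hGgood] using this.1 hw, this.2⟩
    · have := hφ v
      rwa [cutChoices, if_neg hv, Finset.mem_singleton] at this
  have hnb : ∀ φ ∈ Fintype.piFinset (cutChoices G D τ), ∀ v ∈ D, ∀ w,
      (restore G.graph φ).Adj v w ↔ w ∈ φ v := by
    intro φ hφ v hv w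
    obtain ⟨h1, h2⟩ := hφin φ hφ
    rw [restore_adj, hGgraph, cutGraph_adj]
    constructor
    · rintro (h | ⟨_, h | h⟩)
      · exact absurd hv h.2.1
      · exact h
      · by_cases hw : w ∈ D
        · exact absurd hv (hgD v ((h1 w hw).1 v h).1)
        · simp [h2 w hw] at h
    · intro h
      refine Or.inr ⟨?_, Or.inl h⟩
      rintro rfl
      exact hgD v ((h1 v hv).1 v h).1 hv
  refine Finset.card_bij' (fun H _ v => if v ∈ D then H.neighborFinset v else ∅)
    (fun φ _ => restore G.graph φ) ?_ ?_ ?_ ?_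
  · intro H hH
    simp only [precursors, Finset.mem_filter, Finset.mem_univ, true_and] at hH
    obtain ⟨hobs, hcut⟩ := hH
    rw [Fintype.mem_piFinset]
    intro v
    by_cases hv : v ∈ D
    · have hm := mem_cuttableVertices.1 (hcut hv)
      simp only [cutChoices, hv, if_true]
      rw [Finset.mem_powersetCard, SimpleGraph.card_neighborFinset_eq_degree]
      refine ⟨fun w hw => ?_, degree_of_mem_markedVertices hm.1⟩
      rw [SimpleGraph.mem_neighborFinset] at hw
      rw [Finset.mem_filter, ← hobs]
      exact ⟨mem_goodVertices_of_adj hm.1 hw, hm.2 w hw⟩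
    · simp [cutChoices, hv]
  · intro φ hφ
    obtain ⟨h1, h2⟩ := hφin φ hφ
    have hcut : cutGraph H₀ D = cutGraph (restore G.graph φ) D := by
      ext u w
      rw [cutGraph_adj, cutGraph_adj, restore_adj, hGgraph, cutGraph_adj]
      constructor
      · exact fun h => ⟨Or.inl h, h.2⟩
      · rintro ⟨h | ⟨_, h⟩, hu, hw⟩
        · exact h
        · simp [h2 u hu, h2 w hw] at h
    have hdeg : ∀ v ∈ D, (restore G.graph φ).degree v = 2 := by
      intro v hv
      rw [← SimpleGraph.card_neighborFinset_eq_degree, ← (h1 v hv).2]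
      congr 1
      ext w
      rw [SimpleGraph.mem_neighborFinset, hnb φ hφ v hv]
    obtain ⟨e1, e2⟩ := markings_eq_of_cutGraph_eq hD hcut hdeg fun v hv w hw =>
      ((h1 v hv).1 w ((hnb φ hφ v hv w).1 hw)).1
    simp only [precursors, Finset.mem_filter, Finset.mem_univ, true_and]
    refine ⟨?_, fun v hv => mem_cuttableVertices.2 ⟨e2 ▸ hD hv, fun w hw =>
      ((h1 v hv).1 w ((hnb φ hφ v hv w).1 hw)).2⟩⟩
    simp only [hG, observed, MarkedGraph.mk.injEq]
    exact ⟨hcut.symm, e1, e2⟩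
  · intro H hH
    simp only [precursors, Finset.mem_filter, Finset.mem_univ, true_and] at hH
    have hg : G.graph = cutGraph H D := by rw [← hH.1]; rfl
    ext u w
    rw [restore_adj, hg, cutGraph_adj]
    constructor
    · rintro (h | ⟨_, h | h⟩)
      · exact h.1
      · split_ifs at h <;> simp_all
      · split_ifs at h
        · simpa [SimpleGraph.adj_comm] using h
        · simp at h
    · intro h
      by_cases hu : u ∈ D
      · exact Or.inr ⟨h.ne, Or.inl (by simp [hu, h])⟩
      by_cases hw : w ∈ D
      · exact Or.inr ⟨h.ne, Or.inr (by simp [hw, h.symm])⟩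
      exact Or.inl ⟨h, hu, hw⟩
  · intro φ hφ
    funext v
    by_cases hv : v ∈ D
    · simp only [hv, if_true]
      ext w
      rw [SimpleGraph.mem_neighborFinset, hnb φ hφ v hv]
    · simp only [hv, if_false]
      exact ((hφin φ hφ).2 v hv).symm

/-! ### The joint weight of the revealed graph and the spins -/

/-- The probability that the revealed graph is `G` and that the spins are `τ`. -/
noncomputable def jointWeight (a b : ℝ) (G : MarkedGraph n) (τ : Spins n) : ℝ :=
  ∑ ω with observed ω = G ∧ spins ω = τ, law a b n ω

lemma jointWeight_nonneg {a b : ℝ} (hb : 0 < b) (hab : b < a) (G : MarkedGraph n) (τ : Spins n) :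
    0 ≤ jointWeight a b G τ :=
  Finset.sum_nonneg fun ω _ => law_nonneg hb hab n ω

lemma prob_graphEvent_inter (a b : ℝ) (G : MarkedGraph n) (P : Spins n → Prop) :
    prob a b (graphEvent G ∩ {ω | P (spins ω)}) = ∑ τ with P τ, jointWeight a b G τ := by
  unfold prob jointWeight
  rw [← Finset.sum_fiberwise_of_maps_to (t := Finset.univ.filter P) (g := spins)]
  · refine Finset.sum_congr rfl fun τ hτ => Finset.sum_congr ?_ fun _ _ => rfl
    have hτ' : P τ := by simpa using hτ
    ext ω
    simp only [graphEvent, Finset.mem_filter, Finset.mem_univ, true_and, Set.mem_inter_iff,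
      Set.mem_ofPred_eq]
    constructor
    · exact fun h => ⟨h.1.1, h.2⟩
    · exact fun h => ⟨⟨h.1, h.2 ▸ hτ'⟩, h.2⟩
  · intro ω hω
    simp only [Finset.mem_filter, Finset.mem_univ, true_and, Set.mem_inter_iff,
      Set.mem_ofPred_eq] at hω ⊢
    exact hω.2

/-- The vertex `v` contributes a factor `1 - δ` when it is marked, uncut and cuttable. -/
noncomputable def uncutFactor (a b : ℝ) (g : SimpleGraph (Fin n)) (τ : Spins n) (v : Fin n) : ℝ :=
  if ∀ w, g.Adj v w → τ w ≠ τ v then 1 - cutProb a b else 1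

/-- Each cut vertex loses two edges, and no edge is lost twice because cut vertices are pairwise
non-adjacent. -/
lemma card_restored_pairs {H : SimpleGraph (Fin n)} {D : Finset (Fin n)}
    (hD : D ⊆ markedVertices H) :
    ((pairs n).filter fun p => H.Adj p.1 p.2 ∧ ¬ (cutGraph H D).Adj p.1 p.2).card
      = 2 * D.card := by
  have hDD : ∀ u w, H.Adj u w → u ∈ D → w ∉ D := fun u w h hu hw =>
    notMem_goodVertices_of_mem_markedVertices (hD hw) (mem_goodVertices_of_adj (hD hu) h)
  have h2 : (D.sigma fun v => H.neighborFinset v).card = 2 * D.card := by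
    rw [Finset.card_sigma, mul_comm, ← smul_eq_mul, ← Finset.sum_const]
    refine Finset.sum_congr rfl fun v hv => ?_
    rw [SimpleGraph.card_neighborFinset_eq_degree]
    exact degree_of_mem_markedVertices (hD hv)
  rw [← h2]
  refine Finset.card_bij'
    (fun p _ => if p.1 ∈ D then (⟨p.1, p.2⟩ : Σ _ : Fin n, Fin n) else ⟨p.2, p.1⟩)
    (fun q _ => if q.1 < q.2 then (q.1, q.2) else (q.2, q.1)) ?_ ?_ ?_ ?_
  · rintro ⟨u, w⟩ hp
    simp only [Finset.mem_filter, cutGraph_adj] at hp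
    obtain ⟨-, h, h'⟩ := hp
    by_cases hu : u ∈ D
    · simp [hu, h]
    · have hw : w ∈ D := by by_contra hw; exact h' ⟨h, hu, hw⟩
      simp [hu, hw, h.symm]
  · rintro ⟨v, w⟩ hq
    simp only [Finset.mem_sigma, SimpleGraph.mem_neighborFinset] at hq
    rcases lt_or_gt_of_ne hq.2.ne with h | h
    · simp [h, pairs, cutGraph_adj, hq]
    · simp [h, h.not_gt, pairs, cutGraph_adj, hq, hq.2.symm]
  · rintro ⟨u, w⟩ hp
    simp only [Finset.mem_filter, pairs, Finset.mem_univ, true_and] at hp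
    by_cases hu : u ∈ D
    · simp [hu, hp.1]
    · simp [hu, hp.1.not_gt]
  · rintro ⟨v, w⟩ hq
    simp only [Finset.mem_sigma, SimpleGraph.mem_neighborFinset] at hq
    rcases lt_or_gt_of_ne hq.2.ne with h | h
    · simp [h, hq.1]
    · simp [h.not_gt, hDD _ _ hq.2 hq.1]

/-- The edge probability of vertices of opposite spin. -/
noncomputable def acrossProb (b : ℝ) (n : ℕ) : ℝ := min 1 (b / n)

/-- Every deleted edge joins opposite spins, so restoring it multiplies the probability by the same
odds whatever the spins and the endpoints are. Only the number of restorations remains to depend on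
the spins. -/
lemma graphProb_eq_of_subset_cuttable {a b : ℝ} (hq : acrossProb b n < 1) {τ : Spins n}
    {H : SimpleGraph (Fin n)} {D : Finset (Fin n)} (hD : D ⊆ cuttableVertices τ H) :
    graphProb a b τ H = (acrossProb b n / (1 - acrossProb b n)) ^ (2 * D.card)
      * graphProb a b τ (cutGraph H D) := by
  rw [← card_restored_pairs (hD.trans (cuttableVertices_subset τ H)), ← Finset.prod_const,
    Finset.prod_filter]
  unfold graphProb
  rw [← Finset.prod_mul_distrib]
  refine Finset.prod_congr rfl fun p _ => ?_
  by_cases h : H.Adj p.1 p.2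
  · by_cases h' : (cutGraph H D).Adj p.1 p.2
    · simp [h, h']
    · have hs : τ p.1 ≠ τ p.2 := by
        by_cases h1 : p.1 ∈ D
        · exact ((mem_cuttableVertices.1 (hD h1)).2 _ h).symm
        · have h2 : p.2 ∈ D := by by_contra h2; exact h' ⟨h, h1, h2⟩
          exact (mem_cuttableVertices.1 (hD h2)).2 _ h.symm
      have he : edgeProb a b n (τ p.1) (τ p.2) = acrossProb b n := by
        simp [edgeProb, acrossProb, hs]
      have : 1 - acrossProb b n ≠ 0 := by linarith
      simp only [h, h', if_true, if_false, not_false_eq_true, and_self, he]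
      field_simp
  · have h' : ¬ (cutGraph H D).Adj p.1 p.2 := fun k => h k.1
    simp [h, h']

/-- An uncut marked vertex has the same neighbours before and after the cuts, so its cuttability can
be read off the revealed graph. This makes the factor local in that graph. -/
lemma cutSetProb_eq_of_subset_cuttable {a b : ℝ} {τ : Spins n}
    {H : SimpleGraph (Fin n)} {D : Finset (Fin n)} (hD : D ⊆ cuttableVertices τ H) :
    cutSetProb a b τ H D = cutProb a b ^ D.card
      * ∏ v ∈ markedVertices H \ D, uncutFactor a b (cutGraph H D) τ v := by
  have hDm := hD.trans (cuttableVertices_subset τ H)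
  have hu : cuttableVertices τ H = D ∪ (cuttableVertices τ H \ D) :=
    (Finset.union_sdiff_of_subset hD).symm
  rw [cutSetProb, if_pos hD, hu, Finset.prod_union Finset.disjoint_sdiff]
  congr 1
  · rw [Finset.prod_congr rfl fun v hv => if_pos hv, Finset.prod_const]
  · rw [Finset.prod_congr rfl fun v hv => if_neg (Finset.mem_sdiff.1 hv).2]
    unfold uncutFactor
    rw [← Finset.prod_filter]
    refine Finset.prod_congr ?_ fun _ _ => rfl
    ext v
    rw [Finset.mem_sdiff, Finset.mem_filter, Finset.mem_sdiff, mem_cuttableVertices]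
    constructor
    · rintro ⟨⟨h1, h2⟩, h3⟩
      exact ⟨⟨h1, h3⟩, fun w hw => h2 w hw.1⟩
    · rintro ⟨⟨h1, h3⟩, h2⟩
      refine ⟨⟨h1, fun w hw => h2 w ⟨hw, h3, fun hwD => ?_⟩⟩, h3⟩
      exact notMem_goodVertices_of_mem_markedVertices (hDm hwD) (mem_goodVertices_of_adj h1 hw)

/-- The number of ways of restoring the cut edges. -/
noncomputable def restoreCount (G : MarkedGraph n) (τ : Spins n) : ℕ :=
  ∏ v ∈ cutVertices G, (G.good.filter fun w => τ w ≠ τ v).card.choose 2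

/-- The joint weight, up to a factor that does not depend on the spins. -/
lemma exists_jointWeight_eq {a b : ℝ} (hb : 0 < b) (hab : b < a) (hq : acrossProb b n < 1)
    {σ : Spins n} {H₀ : SimpleGraph (Fin n)} {D : Finset (Fin n)} (hD : D ⊆ markedVertices H₀)
    {G : MarkedGraph n} (hG : G = observed (σ, H₀, D)) :
    ∃ c : ℝ, 0 ≤ c ∧ ∀ τ, jointWeight a b G τ = c * (graphProb a b τ G.graph
      * (∏ v ∈ G.marked \ cutVertices G, uncutFactor a b G.graph τ v) * restoreCount G τ) := by
  have hcutG : cutVertices G = D := by rw [hG]; exact cutVertices_observed hD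
  have hq0 : 0 ≤ acrossProb b n := le_min zero_le_one (by positivity)
  have hδ := (cutProb_mem_Icc hb hab).1
  refine ⟨(1 / 2) ^ n * (acrossProb b n / (1 - acrossProb b n)) ^ (2 * D.card)
    * cutProb a b ^ D.card, ?_, fun τ => ?_⟩
  · have : 0 ≤ 1 - acrossProb b n := by linarith
    positivity
  have hcount : restoreCount G τ = (precursors G D τ).card := by
    rw [restoreCount, hcutG, hG, card_precursors hD]
    rfl
  have hsum : jointWeight a b G τ = ∑ H ∈ precursors G D τ, law a b n (τ, H, D) := by
    unfold jointWeight
    symm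
    -- Outcomes that cut a vertex which is not cuttable have weight zero; in all others the cut set
    -- is determined by `G`.
    refine Finset.sum_bij_ne_zero (fun H _ _ => (τ, H, D)) ?_ ?_ ?_ ?_
    · intro H hH _
      simp only [precursors, Finset.mem_filter, Finset.mem_univ, true_and] at hH
      exact Finset.mem_filter.2 ⟨Finset.mem_univ _, hH.1, rfl⟩
    · intro H _ _ H' _ _ h
      exact (Prod.mk.inj (Prod.mk.inj h).2).1
    · rintro ⟨τ', H, D'⟩ hω hne
      obtain ⟨hobs, hτ⟩ := (Finset.mem_filter.1 hω).2
      obtain rfl : τ' = τ := hτ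
      have hsub : D' ⊆ cuttableVertices τ' H := by
        by_contra hcon
        exact hne (by simp [law, cutSetProb, hcon])
      have hDD : D' = D := by
        rw [← hcutG, ← hobs, cutVertices_observed (hsub.trans (cuttableVertices_subset _ _))]
      subst hDD
      exact ⟨H, by simp [precursors, hobs, hsub], hne, rfl⟩
    · intro H _ _; rfl
  rw [hsum, hcount, hcutG]
  rw [Finset.sum_congr rfl (g := fun _ => (1 / 2) ^ n *
    (acrossProb b n / (1 - acrossProb b n)) ^ (2 * D.card) * cutProb a b ^ D.card *
    (graphProb a b τ G.graph * (∏ v ∈ G.marked \ D, uncutFactor a b G.graph τ v)))]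
  · rw [Finset.sum_const, nsmul_eq_mul]; ring
  · intro H hH
    simp only [precursors, Finset.mem_filter, Finset.mem_univ, true_and] at hH
    obtain ⟨hobs, hcut⟩ := hH
    have e1 : G.graph = cutGraph H D := by rw [← hobs]; rfl
    have e2 : G.marked = markedVertices H := by rw [← hobs]; rfl
    simp only [law]
    rw [graphProb_eq_of_subset_cuttable hq hcut, cutSetProb_eq_of_subset_cuttable hcut, e1, e2]
    ring

/-! ### The number of ways of restoring the cut edges -/

lemma abs_log_sub_log_le {u v m : ℝ} (hm : 0 < m) (hu : m ≤ u) (hv : m ≤ v) :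
    |Real.log u - Real.log v| ≤ |u - v| / m := by
  have key : ∀ {u v : ℝ}, m ≤ u → m ≤ v → Real.log u - Real.log v ≤ |u - v| / m := by
    intro u v hu hv
    have hu0 := hm.trans_le hu
    have hv0 := hm.trans_le hv
    rw [← Real.log_div hu0.ne' hv0.ne']
    calc Real.log (u / v) ≤ u / v - 1 := Real.log_le_sub_one_of_pos (by positivity)
      _ = (u - v) / v := by field_simp
      _ ≤ |u - v| / v := by gcongr; exact le_abs_self _
      _ ≤ |u - v| / m := by gcongr
  exact abs_sub_le_iff.2 ⟨key hu hv, by rw [abs_sub_comm]; exact key hv hu⟩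

/-- The logarithm of the number of pairs from `m` objects. -/
noncomputable def logPairs (m : ℝ) : ℝ := Real.log m + Real.log (m - 1) - Real.log 2

lemma choose_two_eq_exp {m : ℕ} (hm : 2 ≤ m) : ((m.choose 2 : ℕ) : ℝ) = Real.exp (logPairs m) := by
  have h : (2 : ℝ) ≤ m := by exact_mod_cast hm
  rw [Nat.cast_choose_two, logPairs, Real.exp_sub, Real.exp_add, Real.exp_log (by linarith),
    Real.exp_log (by linarith), Real.exp_log (by norm_num)]

/-- The logarithm of the number of ways of restoring the edges at `D` cut vertices with sum of
spins `y`, when there are `M` good vertices with sum of spins `x`. -/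
noncomputable def logRestoreCount (M D x y : ℝ) : ℝ :=
  (D + y) / 2 * logPairs ((M - x) / 2) + (D - y) / 2 * logPairs ((M + x) / 2)

/-- The grouping makes each term small. In the first, the logarithms combine to that of a product
which is even in `x`, so there is no first-order term at `x = 0`. In the second, the small change of
`y` meets a logarithmic ratio of order `x / M`. In the third, `y'` meets logarithmic changes of
order `(x - x') / M`. -/
lemma logRestoreCount_sub_eq (M D x x' y y' : ℝ) :
    logRestoreCount M D x y - logRestoreCount M D x' y' =
      D / 2 * ((Real.log ((M + x) / 2) + Real.log ((M - x) / 2)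
          - (Real.log ((M + x') / 2) + Real.log ((M - x') / 2)))
        + (Real.log ((M + x) / 2 - 1) + Real.log ((M - x) / 2 - 1)
          - (Real.log ((M + x') / 2 - 1) + Real.log ((M - x') / 2 - 1))))
      + (y - y') / 2 * ((Real.log ((M - x) / 2) - Real.log ((M + x) / 2))
        + (Real.log ((M - x) / 2 - 1) - Real.log ((M + x) / 2 - 1)))
      + y' / 2 * ((Real.log ((M - x) / 2) - Real.log ((M - x') / 2))
        - (Real.log ((M + x) / 2) - Real.log ((M + x') / 2))
        + (Real.log ((M - x) / 2 - 1) - Real.log ((M - x') / 2 - 1))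
        - (Real.log ((M + x) / 2 - 1) - Real.log ((M + x') / 2 - 1))) := by
  simp only [logRestoreCount, logPairs]
  generalize Real.log ((M + x) / 2) = p
  generalize Real.log ((M - x) / 2) = q
  generalize Real.log ((M + x') / 2) = p'
  generalize Real.log ((M - x') / 2) = q'
  generalize Real.log ((M + x) / 2 - 1) = r
  generalize Real.log ((M - x) / 2 - 1) = s
  generalize Real.log ((M + x') / 2 - 1) = r'
  generalize Real.log ((M - x') / 2 - 1) = s'
  ring

set_option maxHeartbeats 1000000 in
lemma abs_logRestoreCount_sub_le {c K X M D x x' y y' : ℝ} (hc : 0 < c) (hK : 0 ≤ K) (hX : 0 < X)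
    (hcX : 16 ≤ c * X ^ 2) (hX1 : 1 ≤ X)
    (hM : c * X ^ 8 ≤ M) (hD : 0 ≤ D) (hD' : D ≤ X ^ 8) (hx : |x| ≤ 3 * X ^ 6)
    (hx' : |x'| ≤ 3 * X ^ 6) (hy' : |y'| ≤ 3 * X ^ 6)
    (hxx : |x - x'| ≤ 2 * K * X) (hyy : |y - y'| ≤ 2 * K * X) :
    |logRestoreCount M D x y - logRestoreCount M D x' y'| ≤ (48 * K / c ^ 2 + 48 * K / c) / X := by
  -- A common lower bound for all eight arguments of logarithms: `16 ≤ c * X ^ 2` makes `x`, `x'`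
  -- and the shift by 1 negligible against `M`.
  set m := c / 4 * X ^ 8 with hm
  have hm0 : 0 < m := by positivity
  have hX6 : 1 ≤ X ^ 6 := one_le_pow₀ hX1
  have hbig : 4 * X ^ 6 ≤ c * X ^ 8 / 4 := by
    have : c * X ^ 8 = (c * X ^ 2) * X ^ 6 := by ring
    nlinarith
  obtain ⟨hx1, hx2⟩ := abs_le.1 hx
  obtain ⟨hx1', hx2'⟩ := abs_le.1 hx'
  set P := (M + x) / 2 with hP
  set Q := (M - x) / 2 with hQ
  set P' := (M + x') / 2 with hP'
  set Q' := (M - x') / 2 with hQ'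
  have bP : m ≤ P - 1 := by rw [hm, hP]; linarith
  have bQ : m ≤ Q - 1 := by rw [hm, hQ]; linarith
  have bP' : m ≤ P' - 1 := by rw [hm, hP']; linarith
  have bQ' : m ≤ Q' - 1 := by rw [hm, hQ']; linarith
  have hsq : |x' ^ 2 - x ^ 2| ≤ 12 * K * X ^ 7 := by
    have e : x' ^ 2 - x ^ 2 = -((x - x') * (x + x')) := by ring
    rw [e, abs_neg, abs_mul]
    calc |x - x'| * |x + x'| ≤ (2 * K * X) * (6 * X ^ 6) := by
          gcongr
          exact (abs_add_le _ _).trans (by linarith)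
      _ = 12 * K * X ^ 7 := by ring
  have l1 : |Real.log (P * Q) - Real.log (P' * Q')| ≤ 48 * K / c ^ 2 / X ^ 9 := by
    refine (abs_log_sub_log_le (m := m * m) (by positivity) (by nlinarith) (by nlinarith)).trans ?_
    have e : P * Q - P' * Q' = (x' ^ 2 - x ^ 2) / 4 := by rw [hP, hQ, hP', hQ']; ring
    rw [e, abs_div, abs_of_pos (by norm_num : (0 : ℝ) < 4), div_le_iff₀ (by positivity)]
    refine (div_le_div_of_nonneg_right hsq (by norm_num)).trans (le_of_eq ?_)
    rw [hm]; field_simp; ring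
  have l2 : |Real.log ((P - 1) * (Q - 1)) - Real.log ((P' - 1) * (Q' - 1))|
      ≤ 48 * K / c ^ 2 / X ^ 9 := by
    refine (abs_log_sub_log_le (m := m * m) (by positivity) (by nlinarith) (by nlinarith)).trans ?_
    have e : (P - 1) * (Q - 1) - (P' - 1) * (Q' - 1) = (x' ^ 2 - x ^ 2) / 4 := by
      rw [hP, hQ, hP', hQ']; ring
    rw [e, abs_div, abs_of_pos (by norm_num : (0 : ℝ) < 4), div_le_iff₀ (by positivity)]
    refine (div_le_div_of_nonneg_right hsq (by norm_num)).trans (le_of_eq ?_)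
    rw [hm]; field_simp; ring
  rw [Real.log_mul (by linarith) (by linarith), Real.log_mul (by linarith) (by linarith)] at l1 l2
  have far : ∀ {u v : ℝ}, m ≤ u → m ≤ v → |u - v| ≤ 3 * X ^ 6 →
      |Real.log u - Real.log v| ≤ 12 / c / X ^ 2 := by
    intro u v hu hv huv
    refine (abs_log_sub_log_le hm0 hu hv).trans ?_
    rw [div_le_iff₀ hm0]
    refine huv.trans (le_of_eq ?_)
    rw [hm]; field_simp; norm_num
  have near : ∀ {u v : ℝ}, m ≤ u → m ≤ v → |u - v| ≤ K * X →
      |Real.log u - Real.log v| ≤ 4 * K / c / X ^ 7 := by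
    intro u v hu hv huv
    refine (abs_log_sub_log_le hm0 hu hv).trans ?_
    rw [div_le_iff₀ hm0]
    refine huv.trans (le_of_eq ?_)
    rw [hm]; field_simp
  have ePQ : |Q - P| ≤ 3 * X ^ 6 := by
    have : Q - P = -x := by rw [hP, hQ]; ring
    rw [this, abs_neg]; exact hx
  have f1 := far (u := Q) (v := P) (by linarith) (by linarith) ePQ
  have f2 := far bQ bP (by rw [sub_sub_sub_cancel_right]; exact ePQ)
  have ePP : |P - P'| ≤ K * X := by
    have : P - P' = (x - x') / 2 := by rw [hP, hP']; ring
    rw [this, abs_div, abs_of_pos (by norm_num : (0 : ℝ) < 2)]; linarith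
  have eQQ : |Q - Q'| ≤ K * X := by
    have : Q - Q' = -((x - x') / 2) := by rw [hQ, hQ']; ring
    rw [this, abs_neg, abs_div, abs_of_pos (by norm_num : (0 : ℝ) < 2)]; linarith
  have n1 := near (u := P) (v := P') (by linarith) (by linarith) ePP
  have n2 := near (u := Q) (v := Q') (by linarith) (by linarith) eQQ
  have n3 := near bP bP' (by rw [sub_sub_sub_cancel_right]; exact ePP)
  have n4 := near bQ bQ' (by rw [sub_sub_sub_cancel_right]; exact eQQ)
  have main := logRestoreCount_sub_eq M D x x' y y'
  simp only [← hP, ← hQ, ← hP', ← hQ'] at main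
  rw [main]
  -- The three orders of magnitude are `X ^ 8 / X ^ 9`, `X / X ^ 2` and `X ^ 6 / X ^ 7`, each equal
  -- to `1 / X`.
  have t1 : |D / 2 * ((Real.log P + Real.log Q - (Real.log P' + Real.log Q'))
        + (Real.log (P - 1) + Real.log (Q - 1) - (Real.log (P' - 1) + Real.log (Q' - 1))))|
      ≤ X ^ 8 / 2 * (48 * K / c ^ 2 / X ^ 9 + 48 * K / c ^ 2 / X ^ 9) := by
    rw [abs_mul, abs_of_nonneg (by positivity : 0 ≤ D / 2)]
    gcongr
    exact (abs_add_le _ _).trans (add_le_add l1 l2)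
  have t2 : |(y - y') / 2 * ((Real.log Q - Real.log P) + (Real.log (Q - 1) - Real.log (P - 1)))|
      ≤ (2 * K * X) / 2 * (12 / c / X ^ 2 + 12 / c / X ^ 2) := by
    rw [abs_mul, abs_div, abs_of_pos (by norm_num : (0 : ℝ) < 2)]
    gcongr
    exact (abs_add_le _ _).trans (add_le_add f1 f2)
  have t3 : |y' / 2 * ((Real.log Q - Real.log Q') - (Real.log P - Real.log P')
        + (Real.log (Q - 1) - Real.log (Q' - 1)) - (Real.log (P - 1) - Real.log (P' - 1)))|
      ≤ (3 * X ^ 6) / 2 * (4 * (4 * K / c / X ^ 7)) := by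
    rw [abs_mul, abs_div, abs_of_pos (by norm_num : (0 : ℝ) < 2)]
    gcongr
    obtain ⟨a1, b1⟩ := abs_le.1 n1
    obtain ⟨a2, b2⟩ := abs_le.1 n2
    obtain ⟨a3, b3⟩ := abs_le.1 n3
    obtain ⟨a4, b4⟩ := abs_le.1 n4
    exact abs_le.2 ⟨by linarith, by linarith⟩
  refine (abs_add_le _ _).trans ((add_le_add ((abs_add_le _ _).trans (add_le_add t1 t2)) t3).trans
    (le_of_eq ?_))
  field_simp
  ring

lemma card_filter_ne_eq (σ : Spins n) (S : Finset (Fin n)) (v : Fin n) :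
    ((S.filter fun w => σ w ≠ σ v).card : ℝ)
      = ((S.card : ℝ) - realSpin σ v * ∑ w ∈ S, realSpin σ w) / 2 := by
  rw [Finset.card_eq_sum_ones, Finset.sum_filter, Finset.card_eq_sum_ones, Finset.mul_sum]
  push_cast
  rw [← Finset.sum_sub_distrib, Finset.sum_div]
  refine Finset.sum_congr rfl fun w _ => ?_
  unfold realSpin
  rcases Int.units_eq_one_or (σ w) with h | h <;> rcases Int.units_eq_one_or (σ v) with h' | h' <;>
    simp [h, h']

/-- A cut vertex of spin `+1` chooses two of the `(M - x) / 2` good vertices of spin `-1`, and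
conversely. The hypothesis gives at least two candidates for either sign, so that the binomials are
positive and have logarithms. -/
lemma restoreCount_eq_exp {G : MarkedGraph n} {σ : Spins n}
    (h : 4 + |∑ v ∈ G.good, realSpin σ v| ≤ G.good.card) :
    (restoreCount G σ : ℝ) = Real.exp (logRestoreCount G.good.card (cutVertices G).card
      (∑ v ∈ G.good, realSpin σ v) (∑ v ∈ cutVertices G, realSpin σ v)) := by
  set x := ∑ v ∈ G.good, realSpin σ v with hx
  set M : ℝ := (G.good.card : ℝ)
  have hfac : ∀ v, (((G.good.filter fun w => σ w ≠ σ v).card.choose 2 : ℕ) : ℝ)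
      = Real.exp ((1 + realSpin σ v) / 2 * logPairs ((M - x) / 2)
        + (1 - realSpin σ v) / 2 * logPairs ((M + x) / 2)) := by
    intro v
    have hc := card_filter_ne_eq σ G.good v
    have h2 : 2 ≤ (G.good.filter fun w => σ w ≠ σ v).card := by
      have : (2 : ℝ) ≤ (G.good.filter fun w => σ w ≠ σ v).card := by
        rw [hc, ← hx]
        obtain ⟨h1, h2⟩ := abs_le.1 (le_refl |x|)
        rcases realSpin_eq_or σ v with hv | hv <;> rw [hv] <;> linarith
      exact_mod_cast this
    rw [choose_two_eq_exp h2, hc, ← hx]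
    rcases realSpin_eq_or σ v with hv | hv <;> rw [hv] <;> norm_num [M]
  unfold restoreCount
  push_cast
  rw [Finset.prod_congr rfl fun v _ => hfac v, ← Real.exp_sum]
  congr 1
  rw [Finset.sum_add_distrib, ← Finset.sum_mul, ← Finset.sum_mul, ← Finset.sum_div,
    ← Finset.sum_div, Finset.sum_add_distrib, Finset.sum_sub_distrib]
  simp [logRestoreCount]

/-! ### Exchanging the spins on one side of a separator -/

/-- The spins that are `τ` on `A` and `ρ` elsewhere. -/
noncomputable def mix (A : Finset (Fin n)) (τ ρ : Spins n) : Spins n :=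
  fun v => if v ∈ A then τ v else ρ v

lemma mix_of_mem {A : Finset (Fin n)} {τ ρ : Spins n} {v : Fin n} (h : v ∈ A) :
    mix A τ ρ v = τ v := if_pos h

lemma mix_of_notMem {A : Finset (Fin n)} {τ ρ : Spins n} {v : Fin n} (h : v ∉ A) :
    mix A τ ρ v = ρ v := if_neg h

lemma mix_mix (A : Finset (Fin n)) (τ ρ : Spins n) : mix A (mix A τ ρ) (mix A ρ τ) = τ := by
  funext v
  by_cases h : v ∈ A
  · rw [mix_of_mem h, mix_of_mem h]
  · rw [mix_of_notMem h, mix_of_notMem h]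

/-- The sum over pairs with one vertex in `A` and the other in `C`. -/
lemma sum_pairs_crossing {A C : Finset (Fin n)} (hAC : Disjoint A C) (f : Fin n → ℝ) :
    ∑ p ∈ pairs n, (if p.1 ∈ A ∧ p.2 ∈ C ∨ p.1 ∈ C ∧ p.2 ∈ A then f p.1 * f p.2 else 0)
      = (∑ u ∈ A, f u) * ∑ v ∈ C, f v := by
  have hd : ∀ {v}, v ∈ A → v ∉ C := fun h => Finset.disjoint_left.1 hAC h
  rw [Finset.sum_mul_sum, ← Finset.sum_product', ← Finset.sum_filter]
  refine Finset.sum_bij' (fun p _ => if p.1 ∈ A then p else p.swap)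
    (fun p _ => if p.1 < p.2 then p else p.swap) ?_ ?_ ?_ ?_ ?_
  · rintro ⟨u, v⟩ h
    obtain ⟨-, h | h⟩ := Finset.mem_filter.1 h
    · simp [h]
    · simp only at h
      have hu : u ∉ A := fun k => hd k h.1
      simp [h, hu]
  · rintro ⟨u, v⟩ h
    rw [Finset.mem_product] at h
    simp only at h
    have hne : u ≠ v := by rintro rfl; exact hd h.1 h.2
    rcases lt_or_gt_of_ne hne with k | k
    · simp [k, pairs, h]
    · simp [k, k.not_gt, pairs, h]
  · rintro ⟨u, v⟩ h
    obtain ⟨hlt, h⟩ := Finset.mem_filter.1 h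
    simp only [pairs, Finset.mem_filter, Finset.mem_univ, true_and] at hlt
    by_cases hu : u ∈ A
    · simp [hu, hlt]
    · simp [hu, hlt.not_gt]
  · rintro ⟨u, v⟩ h
    rw [Finset.mem_product] at h
    simp only at h
    have hne : u ≠ v := by rintro rfl; exact hd h.1 h.2
    rcases lt_or_gt_of_ne hne with k | k
    · simp [k, h]
    · have hv : v ∉ A := fun k => hd k h.2
      simp [k.not_gt, hv]
  · rintro ⟨u, v⟩ _
    by_cases hu : u ∈ A
    · simp [hu]
    · simp [hu, mul_comm]

/-- The interaction of the spins of two vertices that are not joined by an edge. -/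
noncomputable def nonedgeInteraction (a b : ℝ) (n : ℕ) : ℝ :=
  (Real.log (1 - a / n) - Real.log (1 - b / n)) / 2

/-- The non-edge probability takes two values according to the product of the spins, so its
logarithm is affine in that product. The two spins may come from different configurations, as they
do after an exchange. -/
lemma one_sub_edgeProb_eq_exp {a b : ℝ} (hb : 0 < b) (hab : b < a) (hn : 2 * a ≤ n)
    (σ : Spins n) (u v : Fin n) (s t : ℝ) (ρ : Spins n) (hs : s = realSpin σ u)
    (ht : t = realSpin ρ v) :
    1 - edgeProb a b n (σ u) (ρ v)
      = Real.exp ((Real.log (1 - a / n) + Real.log (1 - b / n)) / 2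
          + nonedgeInteraction a b n * (s * t)) := by
  have hn0 : (0 : ℝ) < n := by linarith
  have ha : a / n ≤ 1 / 2 := by rw [div_le_iff₀ hn0]; linarith
  have hb' : b / n ≤ 1 / 2 := by rw [div_le_iff₀ hn0]; linarith
  subst hs ht
  by_cases h : σ u = ρ v
  · have hst : realSpin σ u * realSpin ρ v = 1 := by
      unfold realSpin
      rw [h]
      rcases Int.units_eq_one_or (ρ v) with k | k <;> simp [k]
    rw [hst, edgeProb, if_pos h, min_eq_right (by linarith), nonedgeInteraction]
    rw [show (Real.log (1 - a / n) + Real.log (1 - b / n)) / 2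
      + (Real.log (1 - a / n) - Real.log (1 - b / n)) / 2 * 1 = Real.log (1 - a / n) by ring,
      Real.exp_log (by linarith)]
  · have hst : realSpin σ u * realSpin ρ v = -1 := by
      unfold realSpin
      rcases Int.units_eq_one_or (ρ v) with k | k <;>
        rcases Int.units_eq_one_or (σ u) with k' | k' <;> simp_all
    rw [hst, edgeProb, if_neg h, min_eq_right (by linarith), nonedgeInteraction]
    rw [show (Real.log (1 - a / n) + Real.log (1 - b / n)) / 2
      + (Real.log (1 - a / n) - Real.log (1 - b / n)) / 2 * -1 = Real.log (1 - b / n) by ring,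
      Real.exp_log (by linarith)]

/-- `A`, `B`, `C` partition the vertices, and `B` separates `A` from `C` in `g`. -/
structure Separates (g : SimpleGraph (Fin n)) (A B C : Finset (Fin n)) : Prop where
  disjoint_AB : Disjoint A B
  disjoint_AC : Disjoint A C
  cover : A ∪ B ∪ C = Finset.univ
  not_adj : ∀ u ∈ A, ∀ v ∈ C, ¬ g.Adj u v

/-- For a pair inside `A ∪ B` or inside `B ∪ C` the exchange at most swaps the two factors. A pair
between `A` and `C` is a non-edge; there the exponents of the unmixed and mixed products differ by
the interaction constant times `(τ u - ρ u) * (τ v - ρ v)`, and the sum over these pairs factorises.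
-/
lemma graphProb_mul_graphProb {a b : ℝ} (hb : 0 < b) (hab : b < a) (hn : 2 * a ≤ n)
    {g : SimpleGraph (Fin n)} {A B C : Finset (Fin n)} (h : Separates g A B C) {τ ρ : Spins n}
    (hB : ∀ v ∈ B, τ v = ρ v) :
    graphProb a b τ g * graphProb a b ρ g =
      Real.exp (nonedgeInteraction a b n * ((∑ v ∈ A, (realSpin τ v - realSpin ρ v))
        * ∑ v ∈ C, (realSpin τ v - realSpin ρ v)))
      * (graphProb a b (mix A τ ρ) g * graphProb a b (mix A ρ τ) g) := by
  rw [← sum_pairs_crossing h.disjoint_AC (fun v => realSpin τ v - realSpin ρ v), Finset.mul_sum,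
    Real.exp_sum]
  unfold graphProb
  rw [← Finset.prod_mul_distrib, ← Finset.prod_mul_distrib, ← Finset.prod_mul_distrib]
  refine Finset.prod_congr rfl fun p _ => ?_
  obtain ⟨u, v⟩ := p
  simp only
  have hAC : ∀ {v}, v ∈ C → v ∉ A := fun h' => Finset.disjoint_right.1 h.disjoint_AC h'
  have hAB : ∀ {v}, v ∈ B → v ∉ A := fun h' => Finset.disjoint_right.1 h.disjoint_AB h'
  have hcov : ∀ v, v ∈ A ∨ v ∈ B ∨ v ∈ C := fun v => by
    have : v ∈ A ∪ B ∪ C := h.cover ▸ Finset.mem_univ v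
    simpa [or_assoc] using this
  have E := one_sub_edgeProb_eq_exp hb hab hn
  by_cases hc : u ∈ A ∧ v ∈ C ∨ u ∈ C ∧ v ∈ A
  · have hna : ¬ g.Adj u v := by
      rcases hc with hc | hc
      · exact h.not_adj u hc.1 v hc.2
      · exact fun k => h.not_adj v hc.2 u hc.1 k.symm
    rw [if_pos hc]
    simp only [hna, if_false]
    rw [E τ u v _ _ τ rfl rfl, E ρ u v _ _ ρ rfl rfl]
    rcases hc with hc | hc
    · rw [mix_of_mem hc.1, mix_of_mem hc.1, mix_of_notMem (hAC hc.2), mix_of_notMem (hAC hc.2),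
        E τ u v _ _ ρ rfl rfl, E ρ u v _ _ τ rfl rfl, ← Real.exp_add, ← Real.exp_add, ← Real.exp_add]
      congr 1; ring
    · rw [mix_of_mem hc.2, mix_of_mem hc.2, mix_of_notMem (hAC hc.1), mix_of_notMem (hAC hc.1),
        E τ u v _ _ ρ rfl rfl, E ρ u v _ _ τ rfl rfl, ← Real.exp_add, ← Real.exp_add, ← Real.exp_add]
      congr 1; ring
  · rw [if_neg hc, mul_zero, Real.exp_zero, one_mul]
    push Not at hc
    have hBmix : ∀ {w}, w ∈ B → mix A τ ρ w = τ w ∧ mix A ρ τ w = ρ w := fun hw => by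
      rw [mix_of_notMem (hAB hw), mix_of_notMem (hAB hw), hB _ hw]; exact ⟨rfl, rfl⟩
    by_cases hu : u ∈ A
    · rw [mix_of_mem hu, mix_of_mem hu]
      have hv : mix A τ ρ v = τ v ∧ mix A ρ τ v = ρ v := by
        rcases hcov v with hv | hv | hv
        · rw [mix_of_mem hv, mix_of_mem hv]; exact ⟨rfl, rfl⟩
        · exact hBmix hv
        · exact absurd hv (hc.1 hu)
      rw [hv.1, hv.2]
    · rw [mix_of_notMem hu, mix_of_notMem hu]
      by_cases hv : v ∈ A
      · rw [mix_of_mem hv, mix_of_mem hv]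
        have huB : u ∈ B := by
          rcases hcov u with k | k | k
          · exact absurd k hu
          · exact k
          · exact absurd hv (hc.2 k)
        rw [hB u huB]
      · rw [mix_of_notMem hv, mix_of_notMem hv, mul_comm]

lemma uncutFactor_congr (a b : ℝ) {g : SimpleGraph (Fin n)} {τ ρ : Spins n} {v : Fin n}
    (hv : τ v = ρ v) (h : ∀ w, g.Adj v w → τ w = ρ w) :
    uncutFactor a b g τ v = uncutFactor a b g ρ v := by
  unfold uncutFactor
  have : (∀ w, g.Adj v w → τ w ≠ τ v) ↔ ∀ w, g.Adj v w → ρ w ≠ ρ v :=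
    forall_congr' fun w => imp_congr_right fun hw => by rw [h w hw, hv]
  simp only [this]

/-- A vertex of `S` lies in `A` or in `C`, so its closed neighbourhood lies in `A ∪ B` or in `B ∪
C`, and the exchange at most swaps its two factors. A vertex of `B` could have neighbours on both
sides; this is why `B` must avoid the marked vertices. -/
lemma prod_uncutFactor_mul (a b : ℝ) {g : SimpleGraph (Fin n)} {A B C S : Finset (Fin n)}
    (h : Separates g A B C) (hS : Disjoint B S) {τ ρ : Spins n} (hB : ∀ v ∈ B, τ v = ρ v) :
    (∏ v ∈ S, uncutFactor a b g τ v) * ∏ v ∈ S, uncutFactor a b g ρ v =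
      (∏ v ∈ S, uncutFactor a b g (mix A τ ρ) v) * ∏ v ∈ S, uncutFactor a b g (mix A ρ τ) v := by
  rw [← Finset.prod_mul_distrib, ← Finset.prod_mul_distrib]
  refine Finset.prod_congr rfl fun v hv => ?_
  have hcov : ∀ v, v ∈ A ∨ v ∈ B ∨ v ∈ C := fun v => by
    have : v ∈ A ∪ B ∪ C := h.cover ▸ Finset.mem_univ v
    simpa [or_assoc] using this
  by_cases hA : v ∈ A
  · have key : ∀ {τ ρ : Spins n}, (∀ v ∈ B, τ v = ρ v) →
        uncutFactor a b g τ v = uncutFactor a b g (mix A τ ρ) v := fun {τ ρ} hB => by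
      refine uncutFactor_congr a b (mix_of_mem hA).symm fun w hw => ?_
      by_cases hwA : w ∈ A
      · exact (mix_of_mem hwA).symm
      · rw [mix_of_notMem hwA]
        rcases hcov w with k | k | k
        · exact absurd k hwA
        · exact hB w k
        · exact absurd hw (h.not_adj v hA w k)
    rw [key hB, key fun v hv => (hB v hv).symm]
  · have hC : v ∈ C := by
      rcases hcov v with k | k | k
      · exact absurd k hA
      · exact absurd hv (Finset.disjoint_left.1 hS k)
      · exact k
    have key : ∀ {τ ρ : Spins n}, uncutFactor a b g ρ v = uncutFactor a b g (mix A τ ρ) v :=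
      fun {τ ρ} => by
        refine uncutFactor_congr a b (mix_of_notMem hA).symm fun w hw => ?_
        exact (mix_of_notMem fun hwA => h.not_adj w hwA v hC hw.symm).symm
    rw [key (τ := ρ) (ρ := τ), key (τ := τ) (ρ := ρ), mul_comm]

/-- The spins are balanced on `C`, on the good vertices in `C` and on the cut vertices in `C`. -/
structure IsBalancedOn (G : MarkedGraph n) (C : Finset (Fin n)) (X : ℝ) (σ : Spins n) : Prop where
  all : |∑ v ∈ C, realSpin σ v| ≤ 2 * X ^ 6
  good : |∑ v ∈ G.good ∩ C, realSpin σ v| ≤ 2 * X ^ 6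
  cut : |∑ v ∈ cutVertices G ∩ C, realSpin σ v| ≤ 2 * X ^ 6

/-- Balance is required on `C` only, so that it is carried along with the spins on `C` when those on
`A` are exchanged. -/
lemma IsBalancedOn.congr {G : MarkedGraph n} {C : Finset (Fin n)} {X : ℝ} {σ σ' : Spins n}
    (h : IsBalancedOn G C X σ) (hC : ∀ v ∈ C, σ v = σ' v) : IsBalancedOn G C X σ' := by
  have key : ∀ S ⊆ C, ∑ v ∈ S, realSpin σ' v = ∑ v ∈ S, realSpin σ v := fun S hS =>
    Finset.sum_congr rfl fun v hv => by simp [realSpin, hC v (hS hv)]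
  exact ⟨by rw [key C subset_rfl]; exact h.all,
    by rw [key _ Finset.inter_subset_right]; exact h.good,
    by rw [key _ Finset.inter_subset_right]; exact h.cut⟩

lemma abs_sum_realSpin_le (σ : Spins n) (S : Finset (Fin n)) :
    |∑ v ∈ S, realSpin σ v| ≤ S.card := by
  refine (Finset.abs_sum_le_sum_abs _ _).trans ?_
  simp [abs_realSpin]

/-- A sum of spins changes little when restricted to the complement of a small set. -/
lemma abs_sum_sub_sum_inter_le (σ : Spins n) {S C E : Finset (Fin n)} (hE : ∀ v ∉ C, v ∈ E) :
    |∑ v ∈ S, realSpin σ v - ∑ v ∈ S ∩ C, realSpin σ v| ≤ E.card := by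
  rw [← Finset.sum_sdiff (Finset.inter_subset_left : S ∩ C ⊆ S), add_sub_cancel_right]
  refine (abs_sum_realSpin_le σ _).trans ?_
  exact_mod_cast Finset.card_le_card fun v hv => by
    rw [Finset.mem_sdiff, Finset.mem_inter] at hv
    exact hE v fun h => hv.2 ⟨hv.1, h⟩

lemma abs_sum_sub_sum_le_of_eq_off {τ ρ : Spins n} {A S : Finset (Fin n)}
    (h : ∀ v ∉ A, τ v = ρ v) :
    |∑ v ∈ S, realSpin τ v - ∑ v ∈ S, realSpin ρ v| ≤ 2 * A.card := by
  rw [← Finset.sum_sub_distrib, ← Finset.sum_inter_add_sum_sdiff S A]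
  have h0 : ∑ v ∈ S \ A, (realSpin τ v - realSpin ρ v) = 0 :=
    Finset.sum_eq_zero fun v hv => by
      simp [realSpin, h v (Finset.mem_sdiff.1 hv).2]
  rw [h0, add_zero]
  refine (Finset.abs_sum_le_sum_abs _ _).trans ?_
  calc _ ≤ ∑ v ∈ S ∩ A, (2 : ℝ) := Finset.sum_le_sum fun v _ =>
        (abs_sub _ _).trans (by rw [abs_realSpin, abs_realSpin]; norm_num)
    _ = 2 * ((S ∩ A).card : ℝ) := by simp [mul_comm]
    _ ≤ 2 * A.card := by gcongr; exact Finset.inter_subset_right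

/-- Changing the spins on `A` moves the sums over good and over cut vertices by at most `2 * K * X`,
and passing from `C` to all vertices moves them by at most `K * X ≤ X ^ 6`, so
`abs_logRestoreCount_sub_le` applies. -/
lemma restoreCount_le {c K X : ℝ} (hc : 0 < c) (hK : 0 ≤ K) (hX1 : 1 ≤ X)
    (hcX : 16 ≤ c * X ^ 2) (hXn : X ^ 8 = n) (hKX : K * X ≤ X ^ 6) {G : MarkedGraph n}
    (hgood : c * X ^ 8 ≤ G.good.card) {A E C : Finset (Fin n)} (hE : ∀ v ∉ C, v ∈ E)
    (hEcard : (E.card : ℝ) ≤ K * X) (hA : A ⊆ E) {σ σ' : Spins n} (hσ : IsBalancedOn G C X σ)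
    (hσ' : IsBalancedOn G C X σ') (heq : ∀ v ∉ A, σ v = σ' v) :
    (restoreCount G σ : ℝ) ≤
      Real.exp ((48 * K / c ^ 2 + 48 * K / c) / X) * restoreCount G σ' := by
  have hX : 0 < X := by linarith
  have hAcard : (A.card : ℝ) ≤ K * X := le_trans (by exact_mod_cast Finset.card_le_card hA) hEcard
  have hfull : ∀ {τ : Spins n} {S : Finset (Fin n)}, |∑ v ∈ S ∩ C, realSpin τ v| ≤ 2 * X ^ 6 →
      |∑ v ∈ S, realSpin τ v| ≤ 3 * X ^ 6 := by
    intro τ S h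
    have h1 := abs_sum_sub_sum_inter_le τ (S := S) hE
    obtain ⟨h2, h3⟩ := abs_le.1 h1
    obtain ⟨h4, h5⟩ := abs_le.1 h
    exact abs_le.2 ⟨by linarith, by linarith⟩
  have hX6 : 1 ≤ X ^ 6 := one_le_pow₀ hX1
  have hbig : 4 + 3 * X ^ 6 ≤ c * X ^ 8 := by
    have : c * X ^ 8 = (c * X ^ 2) * X ^ 6 := by ring
    nlinarith
  have hdiff : ∀ S : Finset (Fin n), |∑ v ∈ S, realSpin σ v - ∑ v ∈ S, realSpin σ' v|
      ≤ 2 * K * X := fun S => (abs_sum_sub_sum_le_of_eq_off heq).trans (by linarith)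
  rw [restoreCount_eq_exp (by linarith [hfull hσ.good]),
    restoreCount_eq_exp (by linarith [hfull hσ'.good]), ← Real.exp_add]
  refine Real.exp_le_exp.2 ?_
  have h := abs_logRestoreCount_sub_le hc hK hX hcX hX1 hgood
    (D := ((cutVertices G).card : ℝ)) (by positivity)
    (by rw [hXn]; exact_mod_cast card_finset_fin_le _) (hfull hσ.good) (hfull hσ'.good)
    (hfull hσ'.cut) (hdiff G.good) (hdiff (cutVertices G))
  linarith [(abs_le.1 h).2]

lemma abs_nonedgeInteraction_le {a b : ℝ} (hb : 0 < b) (hab : b < a) (hn : 2 * a ≤ n) :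
    |nonedgeInteraction a b n| ≤ a / n := by
  have hn0 : (0 : ℝ) < n := by linarith
  have ha : a / n ≤ 1 / 2 := by rw [div_le_iff₀ hn0]; linarith
  have hb' : b / n ≤ a / n := by gcongr
  have hb0 : 0 < b / n := by positivity
  have h := abs_log_sub_log_le (m := 1 / 2) (u := 1 - a / n) (v := 1 - b / n) (by norm_num)
    (by linarith) (by linarith)
  unfold nonedgeInteraction
  rw [abs_div, abs_of_pos (by norm_num : (0 : ℝ) < 2)]
  have e : |1 - a / (n : ℝ) - (1 - b / n)| ≤ a / n := abs_le.2 ⟨by linarith, by linarith⟩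
  have : |1 - a / (n : ℝ) - (1 - b / n)| / (1 / 2) ≤ 2 * (a / n) := by
    rw [div_le_iff₀ (by norm_num)]; linarith
  linarith

/-- The error in the exponent when spins are exchanged, multiplied by `X`. -/
noncomputable def exchangeError (a c K : ℝ) : ℝ := 8 * a * K + 2 * (48 * K / c ^ 2 + 48 * K / c)

/-- Exchanging the spins of two balanced configurations on one side of a separator hardly
changes the product of their weights. -/
lemma jointWeight_mul_le {a b : ℝ} (hb : 0 < b) (hab : b < a) {c K X : ℝ} (hc : 0 < c)
    (hK : 0 ≤ K) (hX1 : 1 ≤ X) (hcX : 16 ≤ c * X ^ 2) (hXn : X ^ 8 = n) (hKX : K * X ≤ X ^ 6)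
    (hn : 2 * a ≤ n) {σ : Spins n} {H₀ : SimpleGraph (Fin n)} {D : Finset (Fin n)}
    (hD : D ⊆ markedVertices H₀) {G : MarkedGraph n} (hG : G = observed (σ, H₀, D))
    (hgood : c * X ^ 8 ≤ G.good.card) {A B C : Finset (Fin n)} (hsep : Separates G.graph A B C)
    (hcard : ((A ∪ B).card : ℝ) ≤ K * X) (hBm : Disjoint B G.marked) {τ ρ : Spins n}
    (hB : ∀ v ∈ B, τ v = ρ v) (hτ : IsBalancedOn G C X τ) (hρ : IsBalancedOn G C X ρ) :
    jointWeight a b G τ * jointWeight a b G ρ ≤ Real.exp (exchangeError a c K / X) *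
      (jointWeight a b G (mix A τ ρ) * jointWeight a b G (mix A ρ τ)) := by
  have hX : 0 < X := by linarith
  have ha : 0 < a := hb.trans hab
  have hn0 : (0 : ℝ) < n := by linarith
  have hq : acrossProb b n < 1 := by
    refine (min_le_right _ _).trans_lt ?_
    rw [div_lt_one hn0]; linarith
  have hAC : ∀ v ∈ C, v ∉ A := fun v h' => Finset.disjoint_right.1 hsep.disjoint_AC h'
  have hE : ∀ v ∉ C, v ∈ A ∪ B := fun v hv => by
    have : v ∈ A ∪ B ∪ C := hsep.cover ▸ Finset.mem_univ v
    exact (Finset.mem_union.1 this).resolve_right hv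
  obtain ⟨k, hk, hW⟩ := exists_jointWeight_eq hb hab hq hD hG
  set e₁ := (48 * K / c ^ 2 + 48 * K / c) / X with he₁
  have hm1 : IsBalancedOn G C X (mix A τ ρ) :=
    hρ.congr fun v hv => (mix_of_notMem (hAC v hv)).symm
  have hm2 : IsBalancedOn G C X (mix A ρ τ) :=
    hτ.congr fun v hv => (mix_of_notMem (hAC v hv)).symm
  -- The comparison is crosswise: `mix A ρ τ` differs from `τ` only on the small set `A`, whereas
  -- `mix A τ ρ` may differ from it on all of `C`.
  have r1 : (restoreCount G τ : ℝ) ≤ Real.exp e₁ * restoreCount G (mix A ρ τ) :=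
    restoreCount_le hc hK hX1 hcX hXn hKX hgood hE hcard Finset.subset_union_left hτ hm2
      fun v hv => (mix_of_notMem hv).symm
  have r2 : (restoreCount G ρ : ℝ) ≤ Real.exp e₁ * restoreCount G (mix A τ ρ) :=
    restoreCount_le hc hK hX1 hcX hXn hKX hgood hE hcard Finset.subset_union_left hρ hm1
      fun v hv => (mix_of_notMem hv).symm
  have hr : (restoreCount G τ : ℝ) * restoreCount G ρ ≤ Real.exp (2 * e₁) *
      (restoreCount G (mix A τ ρ) * restoreCount G (mix A ρ τ)) := by
    calc _ ≤ (Real.exp e₁ * restoreCount G (mix A ρ τ)) *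
          (Real.exp e₁ * restoreCount G (mix A τ ρ)) := by gcongr
      _ = _ := by rw [two_mul, Real.exp_add]; ring
  have hp := graphProb_mul_graphProb hb hab hn hsep hB
  have hu := prod_uncutFactor_mul a b hsep (hBm.mono_right
    (Finset.sdiff_subset : G.marked \ cutVertices G ⊆ G.marked)) hB
  have hI : nonedgeInteraction a b n * ((∑ v ∈ A, (realSpin τ v - realSpin ρ v))
        * ∑ v ∈ C, (realSpin τ v - realSpin ρ v)) ≤ 8 * a * K / X := by
    refine (le_abs_self _).trans ?_
    rw [abs_mul, abs_mul, Finset.sum_sub_distrib, Finset.sum_sub_distrib]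
    have hAcard : (A.card : ℝ) ≤ K * X :=
      le_trans (by exact_mod_cast Finset.card_le_card Finset.subset_union_left) hcard
    have s1 : |∑ v ∈ A, realSpin τ v - ∑ v ∈ A, realSpin ρ v| ≤ 2 * (K * X) :=
      (abs_sub _ _).trans (by linarith [abs_sum_realSpin_le τ A, abs_sum_realSpin_le ρ A])
    have s2 : |∑ v ∈ C, realSpin τ v - ∑ v ∈ C, realSpin ρ v| ≤ 4 * X ^ 6 :=
      (abs_sub _ _).trans (by linarith [hτ.all, hρ.all])
    -- The set `A` is small and the spins on `C` are balanced; bounding the sum over `C` by its `n`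
    -- terms would not suffice.
    calc _ ≤ (a / n) * ((2 * (K * X)) * (4 * X ^ 6)) := by
          have := abs_nonedgeInteraction_le hb hab hn
          gcongr
      _ = 8 * a * K / X := by
          rw [← hXn]; field_simp; ring
  have hg0 : ∀ σ : Spins n, 0 ≤ graphProb a b σ G.graph := fun σ =>
    Finset.prod_nonneg fun p _ => by
      split_ifs
      · exact edgeProb_nonneg hb hab ..
      · exact sub_nonneg.2 (min_le_left _ _)
  have hu0 : ∀ σ : Spins n, 0 ≤ ∏ v ∈ G.marked \ cutVertices G, uncutFactor a b G.graph σ v :=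
    fun σ => Finset.prod_nonneg fun v _ => by
      unfold uncutFactor
      split_ifs
      · exact sub_nonneg.2 (cutProb_mem_Icc hb hab).2
      · norm_num
  rw [hW, hW, hW, hW]
  set U₁ := ∏ v ∈ G.marked \ cutVertices G, uncutFactor a b G.graph τ v
  set U₂ := ∏ v ∈ G.marked \ cutVertices G, uncutFactor a b G.graph ρ v
  set U₃ := ∏ v ∈ G.marked \ cutVertices G, uncutFactor a b G.graph (mix A τ ρ) v
  set U₄ := ∏ v ∈ G.marked \ cutVertices G, uncutFactor a b G.graph (mix A ρ τ) v
  have hexp : Real.exp (exchangeError a c K / X) = Real.exp (8 * a * K / X) * Real.exp (2 * e₁) := by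
    rw [← Real.exp_add, exchangeError, he₁]; congr 1; ring
  have hU34 : 0 ≤ U₃ * U₄ := mul_nonneg (hu0 _) (hu0 _)
  have hg34 : 0 ≤ graphProb a b (mix A τ ρ) G.graph * graphProb a b (mix A ρ τ) G.graph :=
    mul_nonneg (hg0 _) (hg0 _)
  calc _ = k ^ 2 * ((graphProb a b τ G.graph * graphProb a b ρ G.graph) * (U₁ * U₂) *
        (restoreCount G τ * restoreCount G ρ)) := by ring
    _ ≤ k ^ 2 * ((Real.exp (8 * a * K / X) * (graphProb a b (mix A τ ρ) G.graph *
        graphProb a b (mix A ρ τ) G.graph)) * (U₃ * U₄) * (Real.exp (2 * e₁) *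
      (restoreCount G (mix A τ ρ) * restoreCount G (mix A ρ τ)))) := by
        rw [hp, hu]
        gcongr
    _ = _ := by rw [hexp]; ring

/-! ### Comparison of the posteriors -/

/-- The total weight of the configurations that agree with `σ` on `S`. -/
noncomputable def agreeSum (W : Spins n → ℝ) (S : Finset (Fin n)) (σ : Spins n) : ℝ :=
  ∑ τ with ∀ v ∈ S, τ v = σ v, W τ

/-- The total weight of the configurations with property `T` that agree with `σ` on `S`. -/
noncomputable def agreeSumOn (W : Spins n → ℝ) (T : Spins n → Prop) (S : Finset (Fin n))
    (σ : Spins n) : ℝ :=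
  ∑ τ with (∀ v ∈ S, τ v = σ v) ∧ T τ, W τ

lemma agreeSumOn_add (W : Spins n → ℝ) (T : Spins n → Prop) (S : Finset (Fin n)) (σ : Spins n) :
    agreeSumOn W T S σ + agreeSumOn W (fun τ => ¬ T τ) S σ = agreeSum W S σ := by
  unfold agreeSumOn agreeSum
  have h := Finset.sum_filter_add_sum_filter_not
    (Finset.univ.filter fun τ : Spins n => ∀ v ∈ S, τ v = σ v) T W
  rw [Finset.filter_filter, Finset.filter_filter] at h
  convert h

lemma posterior_eq (a b : ℝ) (G : MarkedGraph n) (σ : Spins n) (A S : Finset (Fin n)) :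
    posterior a b G σ A S
      = agreeSum (jointWeight a b G) (A ∪ S) σ / agreeSum (jointWeight a b G) S σ := by
  have h : ∀ S, prob a b (graphEvent G ∩ {ω | ∀ v ∈ S, spins ω v = σ v})
      = agreeSum (jointWeight a b G) S σ := fun S => by
    rw [prob_graphEvent_inter a b G (fun τ => ∀ v ∈ S, τ v = σ v)]
    unfold agreeSum
    congr!
  unfold posterior condProb
  rw [← h, ← h]
  congr 2
  ext ω
  simp only [spinEvent, Set.mem_inter_iff, Set.mem_ofPred_eq, Finset.mem_union]
  constructor
  · rintro ⟨k1, k2, k3⟩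
    exact ⟨k2, fun v hv => hv.elim (k1 v) (k3 v)⟩
  · rintro ⟨k1, k2⟩
    exact ⟨fun v hv => k2 v (Or.inl hv), k1, fun v hv => k2 v (Or.inr hv)⟩

section Compare

variable {W : Spins n → ℝ} {T : Spins n → Prop} {A B C : Finset (Fin n)} {σ : Spins n}

/-- A configuration `ρ` fixed on `A ∪ B` is free on `C`, and a configuration `τ` fixed on `B ∪ C` is
free on `A`. Gluing the free parts gives one `π` fixed on `B`, and this is a bijection. Since `T`
depends on the spins on `C` alone, it holds for `π` exactly when it holds for `ρ`. -/
lemma agreeSumOn_mul_agreeSum (hAB : Disjoint A B) (hAC : Disjoint A C)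
    (hcov : A ∪ B ∪ C = Finset.univ) (hT : ∀ τ ρ, (∀ v ∈ C, τ v = ρ v) → T τ → T ρ) :
    agreeSumOn W T (A ∪ B) σ * agreeSum W (B ∪ C) σ
      = ∑ π with (∀ v ∈ B, π v = σ v) ∧ T π, W (mix A σ π) * W (mix A π σ) := by
  have hA : ∀ v, v ∈ B ∪ C → v ∉ A := fun v hv => by
    rcases Finset.mem_union.1 hv with h | h
    exacts [Finset.disjoint_right.1 hAB h, Finset.disjoint_right.1 hAC h]
  have hA' : ∀ v, v ∉ A → v ∈ B ∪ C := fun v hv => by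
    have : v ∈ A ∪ (B ∪ C) := by rw [← Finset.union_assoc, hcov]; exact Finset.mem_univ v
    exact (Finset.mem_union.1 this).resolve_left hv
  have inv1 : ∀ {ρ τ : Spins n}, (∀ v ∈ A ∪ B, ρ v = σ v) → mix A σ (mix A τ ρ) = ρ :=
    fun {ρ τ} h => by
      funext v
      by_cases hv : v ∈ A
      · rw [mix_of_mem hv, h v (Finset.mem_union_left _ hv)]
      · rw [mix_of_notMem hv, mix_of_notMem hv]
  have inv2 : ∀ {ρ τ : Spins n}, (∀ v ∈ B ∪ C, τ v = σ v) → mix A (mix A τ ρ) σ = τ :=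
    fun {ρ τ} h => by
      funext v
      by_cases hv : v ∈ A
      · rw [mix_of_mem hv, mix_of_mem hv]
      · rw [mix_of_notMem hv, h v (hA' v hv)]
  unfold agreeSumOn agreeSum
  rw [Finset.sum_mul_sum, ← Finset.sum_product']
  refine Finset.sum_bij' (fun x _ => mix A x.2 x.1) (fun π _ => (mix A σ π, mix A π σ))
    ?_ ?_ ?_ ?_ ?_
  · rintro ⟨ρ, τ⟩ h
    simp only [Finset.mem_product, Finset.mem_filter, Finset.mem_univ, true_and] at h ⊢
    obtain ⟨⟨h1, h2⟩, h3⟩ := h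
    refine ⟨fun v hv => ?_, hT ρ _ (fun v hv => ?_) h2⟩
    · rw [mix_of_notMem (hA v (Finset.mem_union_left _ hv)), h1 v (Finset.mem_union_right _ hv)]
    · rw [mix_of_notMem (hA v (Finset.mem_union_right _ hv))]
  · intro π h
    simp only [Finset.mem_product, Finset.mem_filter, Finset.mem_univ, true_and] at h ⊢
    refine ⟨⟨fun v hv => ?_, hT π _ (fun v hv => ?_) h.2⟩, fun v hv => mix_of_notMem (hA v hv)⟩
    · by_cases hvA : v ∈ A
      · exact mix_of_mem hvA
      · rw [mix_of_notMem hvA, h.1 v ((Finset.mem_union.1 hv).resolve_left hvA)]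
    · rw [mix_of_notMem (hA v (Finset.mem_union_right _ hv))]
  · rintro ⟨ρ, τ⟩ h
    simp only [Finset.mem_product, Finset.mem_filter, Finset.mem_univ, true_and] at h
    rw [inv1 h.1.1, inv2 h.2]
  · intro π _
    exact mix_mix A π σ ▸ by
      funext v
      by_cases hv : v ∈ A <;> simp [mix, hv]
  · rintro ⟨ρ, τ⟩ h
    simp only [Finset.mem_product, Finset.mem_filter, Finset.mem_univ, true_and] at h
    rw [inv1 h.1.1, inv2 h.2]

/-- If the exchange of spins on `A` hardly changes the weights, and configurations without
property `T` carry little weight, then the spins on `C` hardly influence those on `A`. -/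
lemma abs_ratio_sub_le (hW : ∀ τ, 0 ≤ W τ) (hAB : Disjoint A B) (hAC : Disjoint A C)
    (hcov : A ∪ B ∪ C = Finset.univ) (hT : ∀ τ ρ, (∀ v ∈ C, τ v = ρ v) → T τ → T ρ)
    {q θ : ℝ} (hq : 1 ≤ q) (hθ0 : 0 ≤ θ) (hθ1 : θ < 1)
    (hex : ∀ τ ρ, (∀ v ∈ B, τ v = ρ v) → T τ → T ρ →
      W τ * W ρ ≤ q * (W (mix A τ ρ) * W (mix A ρ τ)))
    (hσ : T σ) (hσW : 0 < W σ)
    (h1 : agreeSumOn W (fun τ => ¬ T τ) (A ∪ B) σ ≤ θ * agreeSum W (A ∪ B) σ)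
    (h2 : agreeSumOn W (fun τ => ¬ T τ) B σ ≤ θ * agreeSum W B σ) :
    |agreeSum W (A ∪ (B ∪ C)) σ / agreeSum W (B ∪ C) σ - agreeSum W (A ∪ B) σ / agreeSum W B σ|
      ≤ (q / (1 - θ) - 1) * (agreeSum W (A ∪ B) σ / agreeSum W B σ) := by
  have hall : agreeSum W (A ∪ (B ∪ C)) σ = W σ := by
    rw [← Finset.union_assoc, hcov, agreeSum]
    have : (Finset.univ.filter fun τ : Spins n => ∀ v ∈ Finset.univ, τ v = σ v) = {σ} := by
      ext τ; simp [funext_iff]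
    rw [this, Finset.sum_singleton]
  have hpos : ∀ S, 0 < agreeSum W S σ := fun S =>
    hσW.trans_le (Finset.single_le_sum (f := W) (fun τ _ => hW τ) (by simp))
  have hle : ∀ S, agreeSumOn W T S σ ≤ agreeSum W S σ := fun S => by
    rw [← agreeSumOn_add W T S σ]
    linarith [show 0 ≤ agreeSumOn W (fun τ => ¬ T τ) S σ from Finset.sum_nonneg fun τ _ => hW τ]
  have g1 : (1 - θ) * agreeSum W (A ∪ B) σ ≤ agreeSumOn W T (A ∪ B) σ := by
    linarith [agreeSumOn_add W T (A ∪ B) σ]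
  have g2 : (1 - θ) * agreeSum W B σ ≤ agreeSumOn W T B σ := by
    linarith [agreeSumOn_add W T B σ]
  have hA : ∀ v ∈ C, v ∉ A := fun v hv => Finset.disjoint_right.1 hAC hv
  have hB : ∀ v ∈ B, v ∉ A := fun v hv => Finset.disjoint_right.1 hAB hv
  have hprod := agreeSumOn_mul_agreeSum (W := W) (σ := σ) hAB hAC hcov hT
  -- Exchanging on `A` turns the pair `mix A σ π`, `mix A π σ` back into `σ`, `π`. Both members of
  -- the first pair inherit `T`, one from `π` and the other from `σ`, so the exchange inequality may
  -- be used in either direction.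
  have up : agreeSumOn W T (A ∪ B) σ * agreeSum W (B ∪ C) σ ≤ q * (W σ * agreeSumOn W T B σ) := by
    rw [hprod, agreeSumOn, Finset.mul_sum, Finset.mul_sum]
    refine Finset.sum_le_sum fun π hπ => ?_
    simp only [Finset.mem_filter, Finset.mem_univ, true_and] at hπ
    have := hex (mix A σ π) (mix A π σ)
      (fun v hv => by rw [mix_of_notMem (hB v hv), mix_of_notMem (hB v hv), hπ.1 v hv])
      (hT π _ (fun v hv => (mix_of_notMem (hA v hv)).symm) hπ.2)
      (hT σ _ (fun v hv => (mix_of_notMem (hA v hv)).symm) hσ)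
    rwa [mix_mix, mix_mix] at this
  have low : W σ * agreeSumOn W T B σ ≤ q * (agreeSumOn W T (A ∪ B) σ * agreeSum W (B ∪ C) σ) := by
    rw [hprod, agreeSumOn, Finset.mul_sum, Finset.mul_sum]
    refine Finset.sum_le_sum fun π hπ => ?_
    simp only [Finset.mem_filter, Finset.mem_univ, true_and] at hπ
    exact hex σ π (fun v hv => (hπ.1 v hv).symm) hσ hπ.2
  rw [hall]
  have pZ := hpos (B ∪ C)
  have pAB := hpos (A ∪ B)
  have pB := hpos B
  have lAB := hle (A ∪ B)
  have lB := hle B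
  set Z := agreeSum W (B ∪ C) σ
  set N₁ := agreeSum W (A ∪ B) σ
  set N₂ := agreeSum W B σ
  set T₁ := agreeSumOn W T (A ∪ B) σ
  set T₂ := agreeSumOn W T B σ
  have hθ : 0 < 1 - θ := by linarith
  set Q := q / (1 - θ) with hQ
  have hQ1 : 1 ≤ Q := by rw [hQ, le_div_iff₀ hθ]; linarith
  have hQq : q = Q * (1 - θ) := by rw [hQ]; field_simp
  have u1 : W σ / Z ≤ Q * (N₁ / N₂) := by
    rw [mul_div_assoc', div_le_div_iff₀ pZ pB, hQ, div_mul_eq_mul_div, div_mul_eq_mul_div,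
      le_div_iff₀ hθ]
    calc W σ * N₂ * (1 - θ) = W σ * ((1 - θ) * N₂) := by ring
      _ ≤ W σ * T₂ := by gcongr
      _ ≤ q * (T₁ * Z) := low
      _ ≤ q * (N₁ * Z) := by gcongr
      _ = q * N₁ * Z := by ring
  have u2 : N₁ / N₂ ≤ Q * (W σ / Z) := by
    rw [mul_div_assoc', div_le_div_iff₀ pB pZ, hQ, div_mul_eq_mul_div, div_mul_eq_mul_div,
      le_div_iff₀ hθ]
    calc N₁ * Z * (1 - θ) = ((1 - θ) * N₁) * Z := by ring
      _ ≤ T₁ * Z := by gcongr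
      _ ≤ q * (W σ * T₂) := up
      _ ≤ q * (W σ * N₂) := by gcongr
      _ = q * W σ * N₂ := by ring
  have p2 : 0 < N₁ / N₂ := by positivity
  refine abs_le.2 ⟨?_, by linarith⟩
  have p1 : 0 < W σ / Z := by positivity
  -- With `w = W σ / Z` and `r = N₁ / N₂`, the bound `r ≤ Q * w` gives `r - w ≤ (1 - 1 / Q) * r ≤ (Q
  -- - 1) * r`.
  nlinarith

/-- Markov's inequality for the conditional weight of the configurations without property `T`. -/
lemma markov_agreeSum (hW : ∀ τ, 0 ≤ W τ) {θ : ℝ} (hθ : 0 ≤ θ) (S : Finset (Fin n)) :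
    θ * ∑ σ with θ * agreeSum W S σ < agreeSumOn W (fun τ => ¬ T τ) S σ, W σ
      ≤ ∑ τ with ¬ T τ, W τ := by
  -- Resetting the spins off `S` to `1` gives a canonical representative of each class of
  -- configurations that agree on `S`. Both conditional sums are constant on a class, so the
  -- inequality is proved class by class.
  have hrep : ∀ τ σ : Spins n, mix S τ 1 = mix S σ 1 ↔ ∀ v ∈ S, τ v = σ v := by
    intro τ σ
    constructor
    · intro h v hv
      have := congrFun h v
      rwa [mix_of_mem hv, mix_of_mem hv] at this
    · intro h
      funext v
      by_cases hv : v ∈ S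
      · rw [mix_of_mem hv, mix_of_mem hv, h v hv]
      · rw [mix_of_notMem hv, mix_of_notMem hv]
  rw [← Finset.sum_fiberwise (Finset.univ.filter _) (fun τ => mix S τ 1),
    ← Finset.sum_fiberwise (Finset.univ.filter fun τ => ¬ T τ) (fun τ => mix S τ 1),
    Finset.mul_sum]
  refine Finset.sum_le_sum fun x _ => ?_
  rw [Finset.filter_filter, Finset.filter_filter]
  by_cases hex : ∃ σ, θ * agreeSum W S σ < agreeSumOn W (fun τ => ¬ T τ) S σ ∧ mix S σ 1 = x
  · obtain ⟨σ, hσ, rfl⟩ := hex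
    have h1 : ∑ τ with (θ * agreeSum W S τ < agreeSumOn W (fun τ => ¬ T τ) S τ) ∧
        mix S τ 1 = mix S σ 1, W τ ≤ agreeSum W S σ := by
      refine Finset.sum_le_sum_of_subset_of_nonneg (fun τ hτ => ?_) fun τ _ _ => hW τ
      simp only [Finset.mem_filter, Finset.mem_univ, true_and] at hτ ⊢
      exact (hrep τ σ).1 hτ.2
    refine (mul_le_mul_of_nonneg_left h1 hθ).trans (hσ.le.trans (le_of_eq ?_))
    unfold agreeSumOn
    refine Finset.sum_congr ?_ fun _ _ => rfl
    ext τ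
    simp only [Finset.mem_filter, Finset.mem_univ, true_and, hrep]
    exact and_comm
  · rw [Finset.sum_eq_zero fun τ hτ => ?_, mul_zero]
    · exact Finset.sum_nonneg fun τ _ => hW τ
    · simp only [Finset.mem_filter, Finset.mem_univ, true_and] at hτ
      exact absurd ⟨τ, hτ⟩ hex

end Compare

/-! ### Typical revealed graphs and spins -/

lemma prob_observed_spins (a b : ℝ) (P : MarkedGraph n → Spins n → Prop) :
    prob a b {ω : Outcome n | P (observed ω) (spins ω)}
      = ∑ G ∈ Finset.univ.image (observed (n := n)), ∑ τ with P G τ, jointWeight a b G τ := by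
  unfold prob
  rw [← Finset.sum_fiberwise_of_maps_to (t := Finset.univ.image (observed (n := n)))
    (g := observed) fun ω _ => Finset.mem_image_of_mem _ (Finset.mem_univ ω)]
  refine Finset.sum_congr rfl fun G _ => ?_
  rw [← prob_graphEvent_inter a b G (P G), prob, Finset.filter_filter]
  refine Finset.sum_congr ?_ fun _ _ => rfl
  ext ω
  simp only [Finset.mem_filter, Finset.mem_univ, true_and, Set.mem_ofPred_eq, graphEvent,
    Set.mem_inter_iff]
  constructor
  · rintro ⟨h, rfl⟩
    exact ⟨rfl, h⟩
  · rintro ⟨rfl, h⟩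
    exact ⟨h, rfl⟩

/-- The event that, given the revealed graph and the spins on `S`, the property `T` fails with
conditional probability greater than `θ`. -/
def failureEvent (a b : ℝ) (T : MarkedGraph n → Spins n → Prop) (θ : ℝ)
    (S : MarkedGraph n → Finset (Fin n)) : Set (Outcome n) :=
  {ω | θ * agreeSum (jointWeight a b (observed ω)) (S (observed ω)) (spins ω) <
    agreeSumOn (jointWeight a b (observed ω)) (fun τ => ¬ T (observed ω) τ) (S (observed ω))
      (spins ω)}

/-- Markov's inequality for the conditional probability, given the revealed graph and the spins
on `S`, that the property `T` fails. -/
lemma prob_markov {a b : ℝ} (hb : 0 < b) (hab : b < a) (T : MarkedGraph n → Spins n → Prop)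
    (S : MarkedGraph n → Finset (Fin n)) {θ : ℝ} (hθ : 0 ≤ θ) :
    θ * prob a b (failureEvent a b T θ S) ≤
      prob a b {ω : Outcome n | ¬ T (observed ω) (spins ω)} := by
  rw [failureEvent, prob_observed_spins a b (fun G σ => θ * agreeSum (jointWeight a b G) (S G) σ <
    agreeSumOn (jointWeight a b G) (fun τ => ¬ T G τ) (S G) σ),
    prob_observed_spins a b (fun G σ => ¬ T G σ), Finset.mul_sum]
  refine Finset.sum_le_sum fun G _ => ?_
  refine (le_of_eq ?_).trans ((markov_agreeSum (W := jointWeight a b G) (T := T G)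
    (fun τ => jointWeight_nonneg hb hab G τ) hθ (S G)).trans (le_of_eq ?_)) <;> congr!

lemma prob_mono_of_law_ne_zero {a b : ℝ} (hb : 0 < b) (hab : b < a) {E E' : Set (Outcome n)}
    (h : ∀ ω, law a b n ω ≠ 0 → ω ∈ E → ω ∈ E') : prob a b E ≤ prob a b E' := by
  rw [prob_eq_mean, prob_eq_mean]
  refine Finset.sum_le_sum fun ω _ => ?_
  by_cases h0 : law a b n ω = 0
  · simp [h0]
  · refine mul_le_mul_of_nonneg_left ?_ (law_nonneg hb hab n ω)
    by_cases h1 : ω ∈ E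
    · simp [h1, h ω h0 h1]
    · simp only [h1, if_false]; split_ifs <;> norm_num

lemma cuts_subset_of_law_ne_zero {a b : ℝ} {ω : Outcome n} (h : law a b n ω ≠ 0) :
    ω.2.2 ⊆ cuttableVertices ω.1 ω.2.1 := by
  by_contra hcon
  exact h (by simp [law, cutSetProb, hcon])

lemma isPossible_of_law_ne_zero {a b : ℝ} (hb : 0 < b) (hab : b < a) {ω : Outcome n}
    (h : law a b n ω ≠ 0) : IsPossible a b (observed ω) :=
  ((law_nonneg hb hab n ω).lt_of_ne' h).trans_le
    (Finset.single_le_sum (f := law a b n) (fun ω _ => law_nonneg hb hab n ω)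
      (Finset.mem_filter.2 ⟨Finset.mem_univ ω, rfl⟩))

/-! ### The quantitative theorem and the limit. -/

/-- The spins are balanced on `C`, and there are many good vertices. -/
def IsBalancedGraph (C : MarkedGraph n → Finset (Fin n)) (c X : ℝ) (G : MarkedGraph n)
    (σ : Spins n) : Prop :=
  IsBalancedOn G (C G) X σ ∧ c * X ^ 8 ≤ (G.good.card : ℝ)

/-- The event of the theorem has probability at least `1 - ε` when the error is `ε`. -/
def NoCorrelations (a b K : ℝ) (n : ℕ) (ε : ℝ) : Prop :=
  ∀ (A B C : MarkedGraph n → Finset (Fin n)),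
    (∀ G : MarkedGraph n, IsPossible a b G → IsSeparatingPartition K G (A G) (B G) (C G)) →
    1 - ε ≤ prob a b {ω : Outcome n |
      ∀ (G : MarkedGraph n) (σ : Spins n), G = observed ω → σ = spins ω →
        |posterior a b G σ (A G) (B G ∪ C G) - posterior a b G σ (A G) (B G)|
          ≤ ε * posterior a b G σ (A G) (B G)}

lemma posterior_nonneg {a b : ℝ} (hb : 0 < b) (hab : b < a) (G : MarkedGraph n) (σ : Spins n)
    (A S : Finset (Fin n)) : 0 ≤ posterior a b G σ A S :=
  div_nonneg (prob_nonneg hb hab _) (prob_nonneg hb hab _)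

lemma NoCorrelations.mono {a b K : ℝ} (hb : 0 < b) (hab : b < a) {ε ε' : ℝ} (hε : ε ≤ ε')
    (h : NoCorrelations a b K n ε) : NoCorrelations a b K n ε' := by
  intro A B C hABC
  refine (sub_le_sub_left hε 1).trans ((h A B C hABC).trans (prob_mono hb hab fun ω hω G σ hG hσ =>
    (hω G σ hG hσ).trans ?_))
  exact mul_le_mul_of_nonneg_right hε (posterior_nonneg hb hab _ _ _ _)

lemma noCorrelations_one {a b : ℝ} (hb : 0 < b) (hab : b < a) (K : ℝ) (n : ℕ) :
    NoCorrelations a b K n 1 := by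
  intro A B C _
  rw [sub_self]
  exact prob_nonneg hb hab _

/-- The quantitative form of the theorem, in terms of `X = n ^ (1/8)`. -/
lemma noCorrelations_of_large {a b : ℝ} (hb : 0 < b) (hab : b < a) {c C₀ K K' X : ℝ} (hc : 0 < c)
    (hK' : 0 ≤ K') (hKK' : K ≤ K') (hX1 : 1 < X) (hcX : 16 ≤ c * X ^ 2) (hXn : X ^ 8 = n)
    (hXn' : X = (n : ℝ) ^ (1 / 8 : ℝ)) (hKX : K' * X ≤ X ^ 6) (hn : 2 * a ≤ n)
    (htyp : prob a b {o : Outcome n | ¬ IsTypical c X o} ≤ C₀ / X ^ 2) {ε : ℝ}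
    (hε₁ : Real.exp (exchangeError a c K' / X) / (1 - 1 / X) - 1 ≤ ε)
    (hε₂ : C₀ / X ^ 2 + C₀ / X + C₀ / X ≤ ε) : NoCorrelations a b K n ε := by
  intro A B C hABC
  have hX : 0 < X := by linarith
  have ha : 0 < a := hb.trans hab
  have hsepOf : ∀ G, IsPossible a b G → Separates G.graph (A G) (B G) (C G) ∧
      ((A G ∪ B G).card : ℝ) ≤ K' * X := fun G hG => by
    have h := hABC G hG
    refine ⟨⟨h.disjoint_AB, h.disjoint_AC, h.cover, h.separates⟩, h.card_le.trans ?_⟩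
    rw [hXn']
    gcongr
  have hT0 : prob a b {ω : Outcome n | ¬ IsBalancedGraph C c X (observed ω) (spins ω)}
      ≤ C₀ / X ^ 2 := by
    -- Outcomes of weight zero must be discarded: `A`, `B`, `C` are known to be a separating
    -- partition only for possible graphs, and the revealed cut set is the true one only when the
    -- cuts are admissible.
    refine (prob_mono_of_law_ne_zero hb hab (E' := {o | ¬ IsTypical c X o}) ?_).trans htyp
    rintro ω hω (h : ¬ _) (htypω : IsTypical c X ω)
    refine h ?_
    have hposs := isPossible_of_law_ne_zero hb hab hω
    obtain ⟨hsep, hcard⟩ := hsepOf _ hposs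
    have hcuts := (cuts_subset_of_law_ne_zero hω).trans (cuttableVertices_subset _ _)
    have hcv : cutVertices (observed ω) = ω.2.2 := cutVertices_observed (σ := ω.1) hcuts
    have hE : ∀ v ∉ C (observed ω), v ∈ A (observed ω) ∪ B (observed ω) := fun v hv => by
      have : v ∈ A (observed ω) ∪ B (observed ω) ∪ C (observed ω) :=
        hsep.cover ▸ Finset.mem_univ v
      exact (Finset.mem_union.1 this).resolve_right hv
    have key : ∀ S : Finset (Fin n), |∑ v ∈ S, realSpin ω.1 v| ≤ X ^ 6 →
        |∑ v ∈ S ∩ C (observed ω), realSpin ω.1 v| ≤ 2 * X ^ 6 := fun S hS => by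
      have h1 := abs_sum_sub_sum_inter_le ω.1 (S := S) hE
      obtain ⟨h2, h3⟩ := abs_le.1 h1
      obtain ⟨h4, h5⟩ := abs_le.1 hS
      exact abs_le.2 ⟨by linarith, by linarith⟩
    refine ⟨⟨?_, key _ htypω.good, ?_⟩, htypω.card_good⟩
    · have := key Finset.univ htypω.all
      rwa [Finset.univ_inter] at this
    · rw [hcv]
      exact key _ htypω.cut
  -- Markov's inequality at level `1 / X` loses a factor `X` from `C₀ / X ^ 2`, which leaves both
  -- the level and the exceptional probability tending to zero.
  have hbadS : ∀ S, prob a b (failureEvent a b (IsBalancedGraph C c X) (1 / X) S) ≤ C₀ / X :=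
    fun S => by
      have h := (prob_markov hb hab (IsBalancedGraph C c X) S (θ := 1 / X) (by positivity)).trans hT0
      calc _ = X * (1 / X * prob a b (failureEvent a b (IsBalancedGraph C c X) (1 / X) S)) := by
            field_simp
        _ ≤ X * (C₀ / X ^ 2) := by gcongr
        _ = C₀ / X := by field_simp
  rw [sub_le_iff_le_add]
  rw [← prob_add_prob_compl a b {ω : Outcome n |
      ∀ (G : MarkedGraph n) (σ : Spins n), G = observed ω → σ = spins ω →
        |posterior a b G σ (A G) (B G ∪ C G) - posterior a b G σ (A G) (B G)|
          ≤ ε * posterior a b G σ (A G) (B G)}]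
  refine add_le_add_right (le_trans ?_ hε₂) _
  -- The estimate can fail only if the true spins are unbalanced, or if balance is conditionally
  -- unlikely given the spins on `A ∪ B` or given those on `B`.
  refine le_trans (prob_mono_of_law_ne_zero hb hab (E' :=
    ({ω : Outcome n | ¬ IsBalancedGraph C c X (observed ω) (spins ω)} ∪
      failureEvent a b (IsBalancedGraph C c X) (1 / X) fun G => A G ∪ B G) ∪
      failureEvent a b (IsBalancedGraph C c X) (1 / X) B) ?_)
    ((prob_union_le hb hab _ _).trans (add_le_add ((prob_union_le hb hab _ _).trans
      (add_le_add hT0 (hbadS _))) (hbadS _)))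
  intro ω hω hnot
  by_contra hcon
  simp only [failureEvent, Set.mem_union, Set.mem_ofPred_eq, not_or, not_not, not_lt] at hcon
  obtain ⟨⟨hTω, hb1⟩, hb2⟩ := hcon
  refine hnot ?_
  rintro G σ rfl rfl
  have hposs := isPossible_of_law_ne_zero hb hab hω
  obtain ⟨hsep, hcard⟩ := hsepOf _ hposs
  have hcuts := (cuts_subset_of_law_ne_zero hω).trans (cuttableVertices_subset _ _)
  have hW : ∀ τ, 0 ≤ jointWeight a b (observed ω) τ := jointWeight_nonneg hb hab _
  have hWσ : 0 < jointWeight a b (observed ω) (spins ω) :=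
    ((law_nonneg hb hab n ω).lt_of_ne' hω).trans_le
      (Finset.single_le_sum (f := law a b n) (fun ω _ => law_nonneg hb hab n ω)
        (Finset.mem_filter.2 ⟨Finset.mem_univ ω, rfl, rfl⟩))
  have hθ1 : 1 / X < 1 := by rw [div_lt_one hX]; exact hX1
  have hq : 1 ≤ Real.exp (exchangeError a c K' / X) := by
    rw [Real.one_le_exp_iff, exchangeError]
    positivity
  rw [posterior_eq, posterior_eq]
  refine (abs_ratio_sub_le (T := IsBalancedGraph C c X (observed ω)) hW hsep.disjoint_AB hsep.disjoint_AC hsep.cover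
    (fun τ ρ h hτ => ⟨hτ.1.congr h, hτ.2⟩) hq (by positivity) hθ1 ?_ hTω hWσ hb1 hb2).trans ?_
  · intro τ ρ hB hτ hρ
    exact jointWeight_mul_le hb hab hc hK' hX1.le hcX hXn hKX hn (σ := ω.1) hcuts rfl hτ.2 hsep
      hcard (hABC _ hposs).not_marked hB hτ.1 hρ.1
  · refine mul_le_mul_of_nonneg_right hε₁ (div_nonneg ?_ ?_) <;>
      exact Finset.sum_nonneg fun τ _ => hW τ

lemma eventually_noCorrelations {a b : ℝ} (hb : 0 < b) (hab : b < a) (K : ℝ) {ε : ℝ} (hε : 0 < ε) :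
    ∀ᶠ n in atTop, NoCorrelations a b K n ε := by
  obtain ⟨c, C₀, X₀, hc, hC₀, htyp⟩ := exists_prob_not_isTypical_le hb hab
  have ha : 0 < a := hb.trans hab
  have hev : ∀ᶠ X : ℝ in atTop, 1 < X ∧ X₀ ≤ X ∧ 16 / c ≤ X ∧ |K| ≤ X ∧ 2 * a ≤ X ∧
      Real.exp (exchangeError a c |K| / X) / (1 - 1 / X) - 1 ≤ ε ∧
      C₀ / X ^ 2 + C₀ / X + C₀ / X ≤ ε := by
    have hdiv : ∀ r : ℝ, Tendsto (fun X : ℝ => r / X) atTop (𝓝 0) := fun r =>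
      tendsto_const_nhds.div_atTop tendsto_id
    have h1 : Tendsto (fun X : ℝ => Real.exp (exchangeError a c |K| / X) / (1 - 1 / X) - 1)
        atTop (𝓝 0) := by
      have h := (((Real.continuous_exp.tendsto 0).comp (hdiv (exchangeError a c |K|))).div
        ((hdiv 1).const_sub 1) (by norm_num)).sub_const 1
      simpa using h
    have h2 : Tendsto (fun X : ℝ => C₀ / X ^ 2 + C₀ / X + C₀ / X) atTop (𝓝 0) := by
      have h := ((tendsto_const_nhds (x := C₀)).div_atTop
        (tendsto_pow_atTop (α := ℝ) (two_ne_zero))).add (hdiv C₀) |>.add (hdiv C₀)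
      simpa using h
    filter_upwards [eventually_gt_atTop 1, eventually_ge_atTop X₀, eventually_ge_atTop (16 / c),
      eventually_ge_atTop |K|, eventually_ge_atTop (2 * a), h1.eventually_le_const hε,
      h2.eventually_le_const hε] with X k1 k2 k3 k4 k5 k6 k7
    exact ⟨k1, k2, k3, k4, k5, k6, k7⟩
  have hlim : Tendsto (fun n : ℕ => (n : ℝ) ^ (1 / 8 : ℝ)) atTop atTop :=
    (tendsto_rpow_atTop (by norm_num)).comp tendsto_natCast_atTop_atTop
  filter_upwards [hlim.eventually hev] with n hn
  obtain ⟨k1, k2, k3, k4, k5, k6, k7⟩ := hn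
  have hXn : ((n : ℝ) ^ (1 / 8 : ℝ)) ^ 8 = n := by
    rw [← Real.rpow_natCast, ← Real.rpow_mul (Nat.cast_nonneg n)]
    norm_num
  set X := (n : ℝ) ^ (1 / 8 : ℝ) with hX
  have hX0 : 0 < X := by linarith
  refine noCorrelations_of_large hb hab hc (abs_nonneg K) (le_abs_self K) k1 ?_ hXn hX ?_ ?_
    (htyp n X k2 hX0 hXn) k6 k7
  · rw [div_le_iff₀ hc] at k3
    nlinarith
  · calc |K| * X ≤ X * X := by gcongr
      _ = X ^ 2 := by ring
      _ ≤ X ^ 6 := pow_le_pow_right₀ k1.le (by norm_num)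
  · rw [← hXn]
    exact k5.trans (le_self_pow₀ k1.le (by norm_num))

end SemirandomBlockModel

/-- No long-range correlations. The error sequence `η` depends only on `a`, `b` and the constant
`K` hidden in `O(n ^ (1/8))`; the parts `A`, `B`, `C` may depend on the revealed marked graph. -/
theorem mainTheorem3 (a b : ℝ) (hb : 0 < b) (hab : b < a) (K : ℝ) :
    ∃ η : ℕ → ℝ, Tendsto η atTop (𝓝 0) ∧
      ∀ (n : ℕ) (A B C : MarkedGraph n → Finset (Fin n)),
        (∀ G : MarkedGraph n, IsPossible a b G →
          IsSeparatingPartition K G (A G) (B G) (C G)) →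
        1 - η n ≤ prob a b {ω : Outcome n |
          ∀ (G : MarkedGraph n) (σ : Spins n), G = observed ω → σ = spins ω →
            |posterior a b G σ (A G) (B G ∪ C G) - posterior a b G σ (A G) (B G)|
              ≤ η n * posterior a b G σ (A G) (B G)} := by
  -- Taking nearly the best error for each `n` turns the statements for fixed `ε` and large `n` into
  -- a single sequence. The set contains `1`, for which the probability bound is trivial.
  set s : ℕ → Set ℝ := fun n => {ε | 0 < ε ∧ NoCorrelations a b K n ε} with hs
  have hne : ∀ n, (s n).Nonempty := fun n => ⟨1, one_pos, noCorrelations_one hb hab K n⟩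
  have hbdd : ∀ n, BddBelow (s n) := fun n => ⟨0, fun ε hε => hε.1.le⟩
  -- The infimum need not be attained; the vanishing surplus leaves room for an admissible error
  -- below `η n`, and `NoCorrelations.mono` passes up to it.
  refine ⟨fun n => sInf (s n) + 1 / ((n : ℝ) + 1), ?_, fun n => ?_⟩
  · have h : Tendsto (fun n => sInf (s n)) atTop (𝓝 0) := by
      rw [Metric.tendsto_atTop']
      intro ε hε
      obtain ⟨N, hN⟩ := eventually_atTop.1 (eventually_noCorrelations hb hab K (half_pos hε))
      refine ⟨N, fun n hn => ?_⟩
      have h0 : 0 ≤ sInf (s n) := le_csInf (hne n) fun x hx => hx.1.le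
      have h1 : sInf (s n) ≤ ε / 2 := csInf_le (hbdd n) ⟨half_pos hε, hN n (le_of_lt hn)⟩
      rw [Real.dist_eq, sub_zero, abs_of_nonneg h0]
      linarith
    simpa using h.add (tendsto_one_div_add_atTop_nhds_zero_nat (𝕜 := ℝ))
  · have hlt : sInf (s n) < sInf (s n) + 1 / ((n : ℝ) + 1) := by
      have : (0 : ℝ) < 1 / ((n : ℝ) + 1) := by positivity
      linarith
    obtain ⟨ε, hε, hεlt⟩ := exists_lt_of_csInf_lt (hne n) hlt
    exact hε.2.mono hb hab hεlt.le
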